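/- Let $G$ be a smooth real Lie group (finite-dimensional, or more generally modelled on a Banach space) with Lie algebra $\mathfrak g=T_1G$, and for $n\ge 0$ let $J^nG$ be the group of $n$-jets $j^nc$ at $0$ of smooth curves $c:\mathbb R\to G$, with multiplication $(j^nc)(j^nb)=j^n(cb)$. Let $\delta^rc=c'c^{-1}:\mathbb R\to\mathfrak g$ denote the right logarithmic derivative. The right trivialization $$J^nG\to G\times\mathfrak g^n,\qquad j^nc\mapsto\big(c(0),(\delta^rc)(0),(\delta^rc)'(0),\dots,(\delta^rc)^{(n-1)}(0)\big)$$ is a well-defined bijection, and with the group structure transported along it the product manifold $G\times\mathfrak g^n$ is a Lie group, again denoted $J^nG$; let $J^n\mathfrak g$ be its Lie algebra, identified as a vector space with $T_{(1,0)}(G\times\mathfrak g^n)=\mathfrak g\times\mathfrak g^n$. For $m\ge1$ let $\mathcal P_m$ be the set of partitions $\lambda=\lambda_1|\dots|\lambda_\ell$ of $\{1,\dots,m\}$ into nonempty blocks, ordered by increasing greatest element (anti-lexicographically); put $\ell=\ell(\lambda)$ and $i_r=|\lambda_r|$. For $i_1,\dots,i_\ell\ge1$ put $N_{(i_1,\dots,i_\ell)}=\prod_{r=2}^{\ell}\binom{i_1+\dots+i_r-1}{i_r-1}$.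 Let $k\ge1$. (1) The maps $\iota(v)=(1,0,\dots,0,v)$ and $\pi(g,x_1,\dots,x_k)=(g,x_1,\dots,x_{k-1})$ (the jet projection) form an abelian Lie group extension $\mathfrak g\xrightarrow{\ \iota\ }J^kG\xrightarrow{\ \pi\ }J^{k-1}G$, with smooth section $s(g,x_1,\dots,x_{k-1})=(g,x_1,\dots,x_{k-1},0)$: the maps $\iota$, $\pi$ are smooth homomorphisms forming a short exact sequence, and $(b,v)\mapsto\iota(v)s(b)$ is a diffeomorphism $J^{k-1}G\times\mathfrak g\to J^kG$. The induced action of $J^{k-1}G$ on $\mathfrak g$ is the smooth action $(g,x)\cdot v=\mathrm{Ad}_gv$, that is, $a\,\iota(v)\,a^{-1}=\iota(\pi(a)\cdot v)$ for $a\in J^kG$. The extension is characterized by the smooth group $2$-cocycle $$c_k\big((g,x_1,\dots,x_{k-1}),(h,y_1,\dots,y_{k-1})\big)=\sum_{\lambda\in\mathcal P_k\setminus\{12\dots k\}}\mathrm{ad}_{x_{i_{\ell-1}}}\cdots\mathrm{ad}_{x_{i_1}}\mathrm{Ad}_g\,y_{i_\ell}=\sum_{\ell=2}^{k}\ \sum_{i_1+\dots+i_\ell=k}N_{(i_1,\dots,i_\ell)}\,\mathrm{ad}_{x_{i_{\ell-1}}}\cdots\mathrm{ad}_{x_{i_1}}\mathrm{Ad}_g\,y_{i_\ell},$$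 that is, $s(a)s(b)=\iota(c_k(a,b))\,s(ab)$ for all $a,b\in J^{k-1}G$. (2) The derivatives of $\iota$ and $\pi$ at the identity form an abelian extension of Lie algebras $\mathfrak g\to J^k\mathfrak g\to J^{k-1}\mathfrak g$ (with $\mathfrak g$ regarded as an abelian Lie algebra). For its linear section $\tau$, the derivative of $s$ at the identity, the induced action of $J^{k-1}\mathfrak g$ on $\mathfrak g$ is $(\xi,x_1,\dots,x_{k-1})\cdot v=[\xi,v]$, and its Lie algebra $2$-cocycle is $$\sigma_k\big((\xi,x_1,\dots,x_{k-1}),(\eta,y_1,\dots,y_{k-1})\big)=\sum_{i=1}^{k-1}\binom ki[x_i,y_{k-i}],$$ that is, $[\tau X,\tau Y]=\tau[X,Y]+d\iota(\sigma_k(X,Y))$ for all $X,Y\in J^{k-1}\mathfrak g$. -/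

import Mathlib

open scoped Manifold ContDiff

/-! ### Smooth curves and their jets -/

section Jets

variable (E : Type*) [NormedAddCommGroup E] [NormedSpace ℝ E]
  (G : Type*) [TopologicalSpace G] [ChartedSpace E G]

/-- Smooth curves `ℝ → G`. If `G` is a Lie group, they form a group under pointwise
multiplication. -/
abbrev SmoothCurve : Type _ := C^∞⟮𝓘(ℝ, ℝ), ℝ; 𝓘(ℝ, E), G⟯

variable {E G}

/-- Two curves have the same `k`-jet at `0`: they have the same value at `0`, and in the preferred
chart at this point all their derivatives at `0` up to order `k` agree. -/
def SameJet (k : ℕ) (c b : SmoothCurve E G) : Prop :=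
  c 0 = b 0 ∧ ∀ n ≤ k,
    iteratedDeriv n (fun t : ℝ => extChartAt 𝓘(ℝ, E) (c 0) (c t)) 0 =
      iteratedDeriv n (fun t : ℝ => extChartAt 𝓘(ℝ, E) (c 0) (b t)) 0

theorem SameJet.equivalence (k : ℕ) : Equivalence (SameJet (E := E) (G := G) k) where
  refl _ := ⟨rfl, fun _ _ => rfl⟩
  symm h := ⟨h.1.symm, fun n hn => by rw [← h.1]; exact (h.2 n hn).symm⟩
  trans h h' := ⟨h.1.trans h'.1, fun n hn => (h.2 n hn).trans (by
    have := h'.2 n hn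
    rwa [← h.1] at this)⟩

theorem iteratedDeriv_comp_congr {E₁ E₂ : Type*} [NormedAddCommGroup E₁] [NormedSpace ℝ E₁]
    [NormedAddCommGroup E₂] [NormedSpace ℝ E₂] {F : E₁ → E₂} {u v : ℝ → E₁} {k : ℕ}
    (h0 : u 0 = v 0) (hF : ContDiffAt ℝ k F (u 0)) (hu : ContDiffAt ℝ k u 0)
    (hv : ContDiffAt ℝ k v 0)
    (h : ∀ n ≤ k, iteratedFDeriv ℝ n u 0 = iteratedFDeriv ℝ n v 0) {n : ℕ} (hn : n ≤ k) :
    iteratedDeriv n (F ∘ u) 0 = iteratedDeriv n (F ∘ v) 0 := by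
  have hn' : (n : ℕ∞ω) ≤ k := by exact_mod_cast hn
  have key : iteratedFDeriv ℝ n (F ∘ u) 0 = iteratedFDeriv ℝ n (F ∘ v) 0 := by
    rw [iteratedFDeriv_comp hF hu hn', iteratedFDeriv_comp (h0 ▸ hF) hv hn', h0]
    unfold FormalMultilinearSeries.taylorComp
    refine Finset.sum_congr rfl fun p _ => ?_
    unfold FormalMultilinearSeries.compAlongOrderedFinpartition
    congr 1
    funext m
    exact h _ ((p.partSize_le m).trans hn)
  simp only [iteratedDeriv_eq_iteratedFDeriv, key]

variable [Group G] [LieGroup 𝓘(ℝ, E) ∞ G]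

theorem SameJet.mul {k : ℕ} {c c' b b' : SmoothCurve E G} (hc : SameJet k c c')
    (hb : SameJet k b b') : SameJet k (c * b) (c' * b') := by
  refine ⟨by simp [hc.1, hb.1], fun n hn => ?_⟩
  set φ := extChartAt 𝓘(ℝ, E) (c 0) with hφ
  set ψ := extChartAt 𝓘(ℝ, E) (b 0) with hψ
  set χ := extChartAt 𝓘(ℝ, E) (c 0 * b 0) with hχ
  let F : E × E → E := fun p => χ (φ.symm p.1 * ψ.symm p.2)
  have hcoord : ∀ (x : G) (f : SmoothCurve E G), f 0 = x →
      ContDiffAt ℝ ∞ (fun t : ℝ => extChartAt 𝓘(ℝ, E) x (f t)) 0 := by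
    intro x f hf
    refine ContMDiffAt.contDiffAt ?_
    have h1 : ContMDiffAt 𝓘(ℝ, E) 𝓘(ℝ, E) ∞ (extChartAt 𝓘(ℝ, E) x) (f 0) := by
      rw [hf]; exact contMDiffAt_extChartAt
    exact h1.comp (0 : ℝ) f.contMDiff.contMDiffAt
  have hev : ∀ (f g : SmoothCurve E G), f 0 = c 0 → g 0 = b 0 →
      (fun t : ℝ => χ ((f * g) t)) =ᶠ[nhds 0] F ∘ fun t => (φ (f t), ψ (g t)) := by
    intro f g hf hg
    have e1 : ∀ᶠ t in nhds (0 : ℝ), f t ∈ φ.source :=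
      f.contMDiff.continuous.continuousAt.eventually_mem (by
        rw [hf]; exact extChartAt_source_mem_nhds _)
    have e2 : ∀ᶠ t in nhds (0 : ℝ), g t ∈ ψ.source :=
      g.contMDiff.continuous.continuousAt.eventually_mem (by
        rw [hg]; exact extChartAt_source_mem_nhds _)
    filter_upwards [e1, e2] with t h1 h2
    simp [F, φ.left_inv h1, ψ.left_inv h2]
  have hF : ContDiffAt ℝ ∞ F (φ (c 0), ψ (b 0)) := by
    refine ContMDiffAt.contDiffAt ?_
    have s1 : ContMDiffAt 𝓘(ℝ, E) 𝓘(ℝ, E) ∞ φ.symm (φ (c 0)) :=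
      (contMDiffOn_extChartAt_symm (c 0)).contMDiffAt (extChartAt_target_mem_nhds _)
    have s2 : ContMDiffAt 𝓘(ℝ, E) 𝓘(ℝ, E) ∞ ψ.symm (ψ (b 0)) :=
      (contMDiffOn_extChartAt_symm (b 0)).contMDiffAt (extChartAt_target_mem_nhds _)
    have s3 : ContMDiffAt 𝓘(ℝ, E × E) 𝓘(ℝ, E) ∞
        (fun p : E × E => φ.symm p.1 * ψ.symm p.2) (φ (c 0), ψ (b 0)) :=
      ContMDiffAt.mul
        (s1.comp (φ (c 0), ψ (b 0)) (contDiff_fst.contMDiff.contMDiffAt (f := Prod.fst)))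
        (s2.comp (φ (c 0), ψ (b 0)) (contDiff_snd.contMDiff.contMDiffAt (f := Prod.snd)))
    have s4 : ContMDiffAt 𝓘(ℝ, E) 𝓘(ℝ, E) ∞ χ (φ.symm (φ (c 0)) * ψ.symm (ψ (b 0))) := by
      rw [hφ, hψ, extChartAt_to_inv, extChartAt_to_inv]
      exact contMDiffAt_extChartAt
    exact ContMDiffAt.comp (φ (c 0), ψ (b 0)) s4 s3
  have hk : ((k : ℕ) : ℕ∞ω) ≤ ∞ := by exact_mod_cast le_top
  have hfd : ∀ {f g : ℝ → E} {m : ℕ}, iteratedDeriv m f 0 = iteratedDeriv m g 0 →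
      iteratedFDeriv ℝ m f 0 = iteratedFDeriv ℝ m g 0 := by
    intro f g m h
    simp only [iteratedFDeriv_eq_equiv_comp, Function.comp, h]
  have hc0 := (hcoord _ c rfl).of_le hk
  have hc1 := (hcoord _ c' hc.1.symm).of_le hk
  have hb0 := (hcoord _ b rfl).of_le hk
  have hb1 := (hcoord _ b' hb.1.symm).of_le hk
  have hl := (hev c b rfl rfl).iteratedDeriv_eq n
  have hr := (hev c' b' hc.1.symm hb.1.symm).iteratedDeriv_eq n
  change iteratedDeriv n (fun t : ℝ => χ ((c * b) t)) 0
    = iteratedDeriv n (fun t : ℝ => χ ((c' * b') t)) 0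
  rw [hl, hr]
  refine iteratedDeriv_comp_congr (k := k) (by simp [hc.1, hb.1]) (hF.of_le hk)
    (hc0.prodMk hb0) (hc1.prodMk hb1) (fun m hm => ?_) hn
  have hm' : (m : ℕ∞ω) ≤ k := by exact_mod_cast hm
  rw [iteratedFDeriv_prodMk hc0 hb0 hm', iteratedFDeriv_prodMk hc1 hb1 hm',
    hfd (hc.2 m hm), hfd (hb.2 m hm)]

variable (E G) in
/-- Equality of `k`-jets at `0` is compatible with the pointwise multiplication of curves. -/
noncomputable def jetCon (k : ℕ) : Con (SmoothCurve E G) where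
  r := SameJet k
  iseqv := SameJet.equivalence k
  mul' := SameJet.mul

variable (E G) in
/-- `J^k G`: the group of `k`-jets at `0` of smooth curves in `G`, with multiplication
`(j^k c) (j^k b) = j^k (c b)`. -/
abbrev Jet (k : ℕ) : Type _ := (jetCon E G k).Quotient

/-- The `k`-jet `j^k c` at `0` of a smooth curve `c`. -/
noncomputable def jet (k : ℕ) (c : SmoothCurve E G) : Jet E G k := (c : (jetCon E G k).Quotient)

end Jets

/-! ### The Lie algebra `𝔤` and the right trivialization

The Lie algebra `𝔤 = T₁G` of `G` has the model space `E` as underlying normed space. -/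

section RightTrivialization

variable {E : Type*} [NormedAddCommGroup E] [NormedSpace ℝ E]
  {G : Type*} [TopologicalSpace G] [ChartedSpace E G] [Group G]

variable (G) in
/-- The adjoint action `ad_x y = [x, y]` of `𝔤` on itself. -/
noncomputable def ad (x y : E) : E :=
  Bracket.bracket (L := GroupLieAlgebra 𝓘(ℝ, E) G) (M := GroupLieAlgebra 𝓘(ℝ, E) G) x y

variable (E) in
/-- The adjoint action `Ad_g` of `G` on `𝔤`: the derivative at `1` of conjugation by `g`. -/
noncomputable def Ad (g : G) : E →L[ℝ] E :=
  mfderiv 𝓘(ℝ, E) 𝓘(ℝ, E) (fun h : G => g * h * g⁻¹) 1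

/-- The right logarithmic derivative `δʳc = c' c⁻¹ : ℝ → 𝔤` of a curve in `G`. -/
noncomputable def rightLogDeriv (c : ℝ → G) (t : ℝ) : E :=
  mfderiv 𝓘(ℝ, ℝ) 𝓘(ℝ, E) (fun s : ℝ => c s * (c t)⁻¹) t (1 : ℝ)

variable (E G) in
/-- The right trivialized jet bundle `G × 𝔤^n`. -/
abbrev TrivJet (n : ℕ) : Type _ := G × (Fin n → E)

variable (E) in
/-- The model of the product manifold `G × 𝔤^n`. -/
noncomputable abbrev trivJetModel (n : ℕ) :
    ModelWithCorners ℝ (E × (Fin n → E)) (ModelProd E (Fin n → E)) :=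
  𝓘(ℝ, E).prod 𝓘(ℝ, Fin n → E)

/-- The right trivialization of the `n`-jet of a curve `c`:
`(c(0), (δʳc)(0), (δʳc)'(0), …, (δʳc)^{(n-1)}(0))`. -/
noncomputable def rightTriv (n : ℕ) (c : SmoothCurve E G) : TrivJet E G n :=
  (c 0, fun j => iteratedDeriv j (rightLogDeriv (c : ℝ → G)) 0)

/-- The component `x_i`, `1 ≤ i ≤ n`, of `x = (x_1, …, x_n)`. -/
def jetComp {n : ℕ} (x : Fin n → E) (i : ℕ) : E :=
  if h : 1 ≤ i ∧ i ≤ n then x ⟨i - 1, by omega⟩ else 0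

/-- The projection `(g, x_1, …, x_{k+1}) ↦ (g, x_1, …, x_k)`. -/
def truncate (k : ℕ) (a : TrivJet E G (k + 1)) : TrivJet E G k := (a.1, Fin.init a.2)

variable (G) in
/-- The inclusion `v ↦ (1, 0, …, 0, v)` of `𝔤` into `G × 𝔤^{k+1}`. -/
def topInclusion (k : ℕ) (v : E) : TrivJet E G (k + 1) := (1, Fin.snoc (0 : Fin k → E) v)

/-- The section `(g, x_1, …, x_k) ↦ (g, x_1, …, x_k, 0)`. -/
def zeroSection (k : ℕ) (a : TrivJet E G k) : TrivJet E G (k + 1) :=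
  (a.1, Fin.snoc a.2 (0 : E))

/-! ### The cocycles -/

/-- `ad_{x_{i_{ℓ-1}}} ⋯ ad_{x_{i_1}} Ad_g y_{i_ℓ}` for a list `(i_1, …, i_ℓ)` of block sizes. -/
noncomputable def cocycleTerm {k : ℕ} (a b : TrivJet E G k) (i : List ℕ) : E :=
  i.dropLast.foldl (fun z r => ad G (jetComp a.2 r) z) (Ad E a.1 (jetComp b.2 (i.getLastD 0)))

/-- The group cocycle `c_{k+1}` on `G × 𝔤^k`: the sum over all partitions `λ = λ_1|…|λ_ℓ` of a set
with `k + 1` elements other than the partition into a single block, the blocks being ordered by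
increasing greatest element (that is, anti-lexicographically). -/
noncomputable def groupCocycle (k : ℕ) (a b : TrivJet E G k) : E :=
  ∑ p : OrderedFinpartition (k + 1) with p.length ≠ 1, cocycleTerm a b (List.ofFn p.partSize)

/-- `N_{(i_1, …, i_ℓ)} = ∏_{r=2}^ℓ binom(i_1 + ⋯ + i_r - 1, i_r - 1)`; the factor for `i_r` has
index `r - 1`. -/
def partitionNumber (i : List ℕ) : ℕ :=
  ∏ r ∈ Finset.Ico 1 i.length, ((i.take (r + 1)).sum - 1).choose (i.getD r 0 - 1)

variable (G) in
/-- The action `(ξ, x) · v = [ξ, v]` on `𝔤` of the Lie algebra `𝔤 × 𝔤^k` of `G × 𝔤^k`. -/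
noncomputable def lieAction (k : ℕ) (X : E × (Fin k → E)) (v : E) : E := ad G X.1 v

variable (G) in
/-- The Lie algebra cocycle `σ_{k+1}((ξ, x), (η, y)) = ∑_{i=1}^k binom(k+1, i) [x_i, y_{k+1-i}]` on
the Lie algebra `𝔤 × 𝔤^k` of `G × 𝔤^k`. -/
noncomputable def lieCocycle (k : ℕ) (X Y : E × (Fin k → E)) : E :=
  ∑ i ∈ Finset.Icc 1 k, (k + 1).choose i • ad G (jetComp X.2 i) (jetComp Y.2 (k + 1 - i))

end RightTrivialization

/-! ### Abelian extensions with a prescribed cocycle -/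

/-- The extension `S` of groups `V → A → B`, with `V` a (normed) vector space, is an extension of
Lie groups for which `s` is a smooth section, and the induced action of `B` on `V` and the
`V`-valued `2`-cocycle associated with `s` are `ρ` and `c`. -/
structure IsAbelianLieGroupExtension
    {V : Type*} [NormedAddCommGroup V] [NormedSpace ℝ V]
    {EA : Type*} [NormedAddCommGroup EA] [NormedSpace ℝ EA] {HA : Type*} [TopologicalSpace HA]
    (IA : ModelWithCorners ℝ EA HA)
    {EB : Type*} [NormedAddCommGroup EB] [NormedSpace ℝ EB] {HB : Type*} [TopologicalSpace HB]
    (IB : ModelWithCorners ℝ EB HB)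
    {A : Type*} [TopologicalSpace A] [ChartedSpace HA A] [Group A]
    {B : Type*} [TopologicalSpace B] [ChartedSpace HB B] [Group B]
    (S : GroupExtension (Multiplicative V) A B) (s : B → A)
    (ρ : B → V →L[ℝ] V) (c : B → B → V) : Prop where
  contMDiff_inl : ContMDiff 𝓘(ℝ, V) IA ∞ (fun v : V => S.inl (Multiplicative.ofAdd v))
  contMDiff_rightHom : ContMDiff IA IB ∞ S.rightHom
  contMDiff_section : ContMDiff IB IA ∞ s
  rightHom_section : ∀ b, S.rightHom (s b) = b
  /-- `A` is, through `s`, diffeomorphic to `B × V` over `B`. -/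
  trivialization : ∃ D : (B × V) ≃ₘ^∞⟮IB.prod 𝓘(ℝ, V), IA⟯ A,
    ∀ b v, D (b, v) = S.inl (Multiplicative.ofAdd v) * s b
  /-- `ρ` is a smooth action of the group `B`, induced by conjugation in `A`. -/
  action_one : ∀ v, ρ 1 v = v
  action_mul : ∀ a b v, ρ (a * b) v = ρ a (ρ b v)
  contMDiff_action : ContMDiff (IB.prod 𝓘(ℝ, V)) 𝓘(ℝ, V) ∞ (fun q : B × V => ρ q.1 q.2)
  conj_inl : ∀ (a : A) (v : V), a * S.inl (Multiplicative.ofAdd v) * a⁻¹ =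
    S.inl (Multiplicative.ofAdd (ρ (S.rightHom a) v))
  /-- `c` is a smooth group `2`-cocycle, the factor set of the section `s`. -/
  contMDiff_cocycle : ContMDiff (IB.prod IB) 𝓘(ℝ, V) ∞ (fun q : B × B => c q.1 q.2)
  cocycle : ∀ a b d, c a b + c (a * b) d = ρ a (c b d) + c a (b * d)
  section_mul : ∀ a b, s a * s b = S.inl (Multiplicative.ofAdd (c a b)) * s (a * b)

/-- `N → L → M` is an extension of Lie algebras with abelian `N`, for which `τ` is a linear section,
and the induced action of `M` on `N` and the `N`-valued `2`-cocycle associated with `τ` are `ρ` and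
`σ`. -/
structure IsAbelianLieAlgebraExtension {N L M : Type*}
    [LieRing N] [LieAlgebra ℝ N] [LieRing L] [LieAlgebra ℝ L] [LieRing M] [LieAlgebra ℝ M]
    (ι : N →ₗ⁅ℝ⁆ L) (π : L →ₗ⁅ℝ⁆ M) (τ : M →ₗ[ℝ] L)
    (ρ : M → N → N) (σ : M → M → N) : Prop where
  isLieAbelian : IsLieAbelian N
  isExtension : LieAlgebra.IsExtension ι π
  proj_section : ∀ X, π (τ X) = X
  /-- `ρ` is a representation of `M`, induced by the bracket of `L`. -/
  action_linear : ∀ X, IsLinearMap ℝ (ρ X)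
  linear_action : ∀ v, IsLinearMap ℝ (fun X => ρ X v)
  action_bracket : ∀ X Y v, ρ ⁅X, Y⁆ v = ρ X (ρ Y v) - ρ Y (ρ X v)
  bracket_incl : ∀ X v, ⁅τ X, ι v⁆ = ι (ρ X v)
  /-- `σ` is a Lie algebra `2`-cocycle, the one given by the section `τ`. -/
  cocycle_linear_right : ∀ X, IsLinearMap ℝ (σ X)
  cocycle_linear_left : ∀ Y, IsLinearMap ℝ (fun X => σ X Y)
  cocycle_self : ∀ X, σ X X = 0
  cocycle : ∀ X Y Z, ρ X (σ Y Z) + ρ Y (σ Z X) + ρ Z (σ X Y) =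
    σ ⁅X, Y⁆ Z + σ ⁅Y, Z⁆ X + σ ⁅Z, X⁆ Y
  bracket_section : ∀ X Y, ⁅τ X, τ Y⁆ = τ ⁅X, Y⁆ + ι (σ X Y)

/-- A smooth real Lie group is smooth enough to have a Lie algebra. -/
instance leInfty_minSmoothness_three : ENat.LEInfty (minSmoothness ℝ 3) :=
  ⟨by rw [minSmoothness_of_isRCLikeNormedField]; exact ENat.LEInfty.out⟩

/-!
For a curve `c` in `G` with logarithmic derivative `X = δʳc`, the chart representation `u` of `c`
solves `u' = A(u) X`; this equation determines the jet of `u` from `u 0` and the jet of `X`, and any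
jet of `X` is attained, so the right trivialization is bijective. The rules
`δʳ(cb) = δʳc + Ad_c δʳb` and `(Ad_c)' = ad_{δʳc} Ad_c` turn the Leibniz rule into a formula for the
multiplication of `G × 𝔤ⁿ`: the derivatives of `Ad_c` are sums over set partitions, obtained by
splitting off the block of the greatest element, and the same splitting counts the partitions with
prescribed block sizes by `N`. The top coordinate of a product is affine in the top coordinates of
its factors, which gives the abelian extension; the part independent of them is the group cocycle.
The bracket is the antisymmetrized second derivative of the product at the identity, to which only
terms with at most one factor `ad` contribute, and Pascal's rule combines their coefficients.
-/

section PartitionCount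

open Finset

variable {M : Type*} [AddCommMonoid M]

theorem sum_orderedFinpartition_succ (n : ℕ) (f : List ℕ → M) :
    ∑ p : OrderedFinpartition (n + 1), f (List.ofFn p.partSize) =
      ∑ p : OrderedFinpartition n, (f (1 :: List.ofFn p.partSize) +
        ∑ r ∈ Finset.range (List.ofFn p.partSize).length,
          f ((List.ofFn p.partSize).modify r Nat.succ)) := by
  rw [← (OrderedFinpartition.extendEquiv n).sum_comp, Fintype.sum_sigma]
  refine Finset.sum_congr rfl fun p _ => ?_
  rw [Fintype.sum_option, List.length_ofFn, Finset.sum_range]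
  congr 1
  · exact congrArg f (List.ofFn_cons 1 p.partSize)
  · refine Finset.sum_congr rfl fun r _ => congrArg f ?_
    change List.ofFn (Function.update p.partSize r (p.partSize r + 1)) = _
    refine List.ext_getElem (by simp) fun i h1 h2 => ?_
    simp only [List.getElem_ofFn, List.getElem_modify, Function.update_apply, Fin.ext_iff]
    grind

theorem sum_modify_succ_concat (f : List ℕ → M) (l : List ℕ) (j : ℕ) :
    ∑ r ∈ Finset.range (l ++ [j]).length, f ((l ++ [j]).modify r Nat.succ) =
      ∑ r ∈ Finset.range l.length, f (l.modify r Nat.succ ++ [j]) + f (l ++ [j + 1]) := by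
  rw [List.length_append, List.length_singleton, Finset.sum_range_succ]
  congr 1
  · refine Finset.sum_congr rfl fun r hr => congrArg f ?_
    have hr : r < l.length := Finset.mem_range.1 hr
    exact List.ext_getElem (by simp) fun i _ _ => by
      simp only [List.getElem_modify, List.getElem_append, List.length_modify]; grind
  · exact congrArg f <| List.ext_getElem (by simp) fun i _ _ => by
      simp only [List.getElem_modify, List.getElem_append]; grind

/- The block containing the greatest element comes last; it is determined by its other elements,
of which there are `ij.1`. -/
theorem sum_orderedFinpartition_succ_eq_sum_antidiagonal (n : ℕ) (f : List ℕ → M) :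
    ∑ p : OrderedFinpartition (n + 1), f (List.ofFn p.partSize) =
      ∑ ij ∈ antidiagonal n, n.choose ij.1 •
        ∑ p : OrderedFinpartition ij.2, f (List.ofFn p.partSize ++ [ij.1 + 1]) := by
  induction n generalizing f with
  | zero => simp
  | succ n ih =>
    rw [sum_orderedFinpartition_succ,
      ih fun l => f (1 :: l) + ∑ r ∈ Finset.range l.length, f (l.modify r Nat.succ),
      Finset.sum_antidiagonal_choose_succ_nsmul fun i j =>
        ∑ p : OrderedFinpartition j, f (List.ofFn p.partSize ++ [i + 1]),
      ← Finset.sum_add_distrib]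
    refine Finset.sum_congr rfl fun ij hij => ?_
    rw [← Nat.choose_symm_of_eq_add (HasAntidiagonal.mem_antidiagonal.1 hij).symm, ← smul_add,
      sum_orderedFinpartition_succ ij.2 fun l => f (l ++ [ij.1 + 1]), ← Finset.sum_add_distrib]
    simp only [sum_modify_succ_concat, List.cons_append, add_assoc]

theorem sum_composition_succ (n : ℕ) (f : List ℕ → M) :
    ∑ c : Composition (n + 1), f c.blocks =
      ∑ ij ∈ antidiagonal n, ∑ c : Composition ij.2, f (c.blocks ++ [ij.1 + 1]) := by
  have hpos (q : Σ ij : ℕ × ℕ, Composition ij.2) :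
      ∀ {i}, i ∈ q.2.blocks ++ [q.1.1 + 1] → 0 < i := by
    intro i hi
    rcases List.mem_append.1 hi with hi | hi
    · exact q.2.blocks_pos hi
    · exact List.mem_singleton.1 hi ▸ q.1.1.succ_pos
  have hsum (q : Σ ij : ℕ × ℕ, Composition ij.2)
      (hq : q ∈ (antidiagonal n).sigma fun _ => univ) :
      (q.2.blocks ++ [q.1.1 + 1]).sum = n + 1 := by
    have := HasAntidiagonal.mem_antidiagonal.1 (mem_sigma.1 hq).1
    rw [List.sum_append, q.2.blocks_sum, List.sum_singleton]
    omega
  rw [Finset.sum_sigma']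
  refine (Finset.sum_bij (fun q hq => (⟨_, hpos q, hsum q hq⟩ : Composition (n + 1)))
    (fun _ _ => mem_univ _) ?_ ?_ fun _ _ => rfl).symm
  · rintro ⟨⟨i, j⟩, c⟩ _ ⟨⟨i', j'⟩, c'⟩ _ h
    obtain ⟨hb, hi⟩ := List.append_inj' (congrArg Composition.blocks h) rfl
    obtain rfl : i = i' := by simpa using hi
    obtain rfl : j = j' := c.blocks_sum.symm.trans ((congrArg List.sum hb).trans c'.blocks_sum)
    obtain rfl : c = c' := Composition.ext hb
    rfl
  · intro c _
    have hc : c.blocks ≠ [] := fun h => by simpa [h] using c.blocks_sum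
    have hblocks := List.dropLast_append_getLast hc
    have hlast : 0 < c.blocks.getLast hc := c.blocks_pos (List.getLast_mem hc)
    have hsum := congrArg List.sum hblocks
    rw [List.sum_append, List.sum_singleton, c.blocks_sum] at hsum
    exact ⟨⟨(c.blocks.getLast hc - 1, c.blocks.dropLast.sum),
        ⟨c.blocks.dropLast, fun hi => c.blocks_pos (List.mem_of_mem_dropLast hi), rfl⟩⟩,
      mem_sigma.2 ⟨HasAntidiagonal.mem_antidiagonal.2 (by dsimp only; omega), mem_univ _⟩,
      Composition.ext (by simpa only [Nat.sub_add_cancel hlast] using hblocks)⟩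

theorem partitionNumber_concat (l : List ℕ) (j : ℕ) :
    partitionNumber (l ++ [j]) = (l.sum + j - 1).choose (j - 1) * partitionNumber l := by
  rcases Nat.eq_zero_or_pos l.length with h | h
  · obtain rfl := List.length_eq_zero_iff.1 h
    simp [partitionNumber]
  · unfold partitionNumber
    rw [List.length_append, List.length_singleton, Finset.prod_Ico_succ_top (by omega), mul_comm]
    congr 1
    · simp [List.take_of_length_le]
    · refine Finset.prod_congr rfl fun r hr => ?_
      rw [Finset.mem_Ico] at hr
      rw [List.take_append_of_le_length (by omega), List.getD_append _ _ _ _ hr.2]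

theorem sum_orderedFinpartition (n : ℕ) (f : List ℕ → M) :
    ∑ p : OrderedFinpartition n, f (List.ofFn p.partSize) =
      ∑ c : Composition n, partitionNumber c.blocks • f c.blocks := by
  induction n using Nat.strong_induction_on generalizing f with
  | _ n ih => cases n with
    | zero =>
      have : Subsingleton (Composition 0) :=
        Fintype.card_le_one_iff_subsingleton.1 (composition_card 0).le
      rw [Fintype.sum_unique, Fintype.sum_subsingleton _ (⟨[], by simp, rfl⟩ : Composition 0)]
      exact (one_smul ℕ (f [])).symm
    | succ n =>
      rw [sum_orderedFinpartition_succ_eq_sum_antidiagonal,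
        sum_composition_succ n fun l => partitionNumber l • f l]
      refine Finset.sum_congr rfl fun ij hij => ?_
      have hij := HasAntidiagonal.mem_antidiagonal.1 hij
      rw [ih ij.2 (by omega) fun l => f (l ++ [ij.1 + 1]), Finset.smul_sum]
      refine Finset.sum_congr rfl fun c _ => ?_
      rw [partitionNumber_concat, c.blocks_sum, mul_smul, Nat.add_sub_cancel,
        show ij.2 + (ij.1 + 1) - 1 = n by omega]

end PartitionCount

section Derivation

open VectorField Set Filter Topology

variable {E : Type*} [NormedAddCommGroup E] [NormedSpace ℝ E]
  {H : Type*} [TopologicalSpace H] (I : ModelWithCorners ℝ E H)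
  {M : Type*} [TopologicalSpace M] [ChartedSpace H M]
  {E' : Type*} [NormedAddCommGroup E'] [NormedSpace ℝ E']
  {H' : Type*} [TopologicalSpace H'] (I' : ModelWithCorners ℝ E' H')
  {M' : Type*} [TopologicalSpace M'] [ChartedSpace H' M']
  {E'' : Type*} [NormedAddCommGroup E''] [NormedSpace ℝ E'']
  {H'' : Type*} [TopologicalSpace H''] (I'' : ModelWithCorners ℝ E'' H'')
  {M'' : Type*} [TopologicalSpace M''] [ChartedSpace H'' M'']
  {F : Type*} [NormedAddCommGroup F] [NormedSpace ℝ F]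

/-- The derivative `mfderiv` of a map between manifolds, with the tangent spaces identified with the
model vector spaces through the preferred charts. Its values at different points can be compared and
differentiated again. -/
noncomputable def tderiv (f : M → M') (x : M) : E →L[ℝ] E' := mfderiv I I' f x

variable {I I' I''}

theorem tderiv_comp {g : M' → M''} {f : M → M'} {x : M} (hg : MDifferentiableAt I' I'' g (f x))
    (hf : MDifferentiableAt I I' f x) :
    tderiv I I'' (g ∘ f) x = (tderiv I' I'' g (f x)).comp (tderiv I I' f x) :=
  mfderiv_comp x hg hf

theorem tderiv_comp_apply {g : M' → M''} {f : M → M'} {x : M}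
    (hg : MDifferentiableAt I' I'' g (f x)) (hf : MDifferentiableAt I I' f x) (v : E) :
    tderiv I I'' (g ∘ f) x v = tderiv I' I'' g (f x) (tderiv I I' f x v) := by
  rw [tderiv_comp hg hf]; rfl

theorem tderiv_comp_of_eq {g : M' → M''} {f : M → M'} {x : M} {y : M'}
    (hg : MDifferentiableAt I' I'' g y) (hf : MDifferentiableAt I I' f x) (hy : f x = y) :
    tderiv I I'' (g ∘ f) x = (tderiv I' I'' g y).comp (tderiv I I' f x) := by
  subst hy; exact tderiv_comp hg hf

theorem tderiv_congr {f f₁ : M → M'} {x : M} (h : f₁ =ᶠ[𝓝 x] f) :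
    tderiv I I' f₁ x = tderiv I I' f x := h.mfderiv_eq

theorem tderiv_eq_fderiv (f : E → F) (x : E) : tderiv 𝓘(ℝ, E) 𝓘(ℝ, F) f x = fderiv ℝ f x :=
  mfderiv_eq_fderiv

theorem tderiv_id (x : M) : tderiv I I id x = ContinuousLinearMap.id ℝ E := mfderiv_id

theorem tderiv_const (c : M') (x : M) : tderiv I I' (fun _ => c) x = 0 := mfderiv_const

theorem tderiv_const_add (c : F) {f : M → F} {x : M} (hf : MDifferentiableAt I 𝓘(ℝ, F) f x) :
    tderiv I 𝓘(ℝ, F) (fun y => c + f y) x = tderiv I 𝓘(ℝ, F) f x := by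
  have hadd : MDifferentiableAt 𝓘(ℝ, F) 𝓘(ℝ, F) (fun y => c + y) (f x) :=
    (differentiableAt_id.const_add c).mdifferentiableAt
  refine (tderiv_comp hadd hf).trans ?_
  rw [tderiv_eq_fderiv, fderiv_const_add, fderiv_fun_id, ContinuousLinearMap.id_comp]

theorem tderiv_extChartAt_self [IsManifold I 1 M] (x : M) :
    tderiv I 𝓘(ℝ, E) (extChartAt I x) x = ContinuousLinearMap.id ℝ E := mfderiv_extChartAt_self

theorem eventually_mdifferentiableAt_of_contMDiffAt [IsManifold I ∞ M] {f : M → F} {x : M}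
    (hf : ContMDiffAt I 𝓘(ℝ, F) ∞ f x) : ∀ᶠ y in 𝓝 x, MDifferentiableAt I 𝓘(ℝ, F) f y :=
  have : IsManifold I 1 M := IsManifold.of_le (n := ∞) ENat.LEInfty.out
  ((contMDiffAt_iff_contMDiffAt_nhds (n := 1) (by simp)).1 (hf.of_le ENat.LEInfty.out)).mono
    fun _ hy => hy.mdifferentiableAt one_ne_zero

theorem eventuallyEq_comp_symm_comp_extChartAt {X : Type*} (g : M → X) (x : M) :
    g =ᶠ[𝓝 x] (g ∘ (extChartAt I x).symm) ∘ extChartAt I x := by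
  filter_upwards [extChartAt_source_mem_nhds (I := I) x] with y hy
  simp only [Function.comp_apply, (extChartAt I x).left_inv hy]

variable (I) in
theorem tendsto_extChartAt_symm (x : M) :
    Tendsto (extChartAt I x).symm (𝓝 (extChartAt I x x)) (𝓝 x) := by
  have := continuousAt_extChartAt_symm (I := I) x
  rwa [ContinuousAt, extChartAt_to_inv] at this

variable [I.Boundaryless]

theorem mdifferentiableAt_extChartAt_symm [IsManifold I 1 M] {x : M} {u : E}
    (hu : u ∈ (extChartAt I x).target) :
    MDifferentiableAt 𝓘(ℝ, E) I (extChartAt I x).symm u := by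
  have := mdifferentiableWithinAt_extChartAt_symm (I := I) hu
  rwa [I.range_eq_univ, mdifferentiableWithinAt_univ] at this

theorem isInvertible_tderiv_extChartAt_symm [IsManifold I 1 M] {x : M} {u : E}
    (hu : u ∈ (extChartAt I x).target) :
    (tderiv 𝓘(ℝ, E) I (extChartAt I x).symm u).IsInvertible := by
  have := isInvertible_mfderivWithin_extChartAt_symm (I := I) hu
  rwa [I.range_eq_univ, mfderivWithin_univ] at this

theorem tderiv_extChartAt_symm_self [IsManifold I 1 M] (x : M) :
    tderiv 𝓘(ℝ, E) I (extChartAt I x).symm (extChartAt I x x) = ContinuousLinearMap.id ℝ E := by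
  have := mfderivWithin_range_extChartAt_symm (I := I) (x := x)
  rwa [I.range_eq_univ, mfderivWithin_univ] at this

theorem tderiv_eq_fderiv_comp_extChartAt_symm [IsManifold I 1 M] {f : M → F} {x : M}
    (hf : MDifferentiableAt I 𝓘(ℝ, F) f x) :
    tderiv I 𝓘(ℝ, F) f x = fderiv ℝ (f ∘ (extChartAt I x).symm) (extChartAt I x x) := by
  rw [← tderiv_eq_fderiv, tderiv_comp_of_eq hf
    (mdifferentiableAt_extChartAt_symm (mem_extChartAt_target x)) (extChartAt_to_inv x),
    tderiv_extChartAt_symm_self, ContinuousLinearMap.comp_id]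

theorem contDiffAt_comp_extChartAt_symm [IsManifold I ∞ M] {f : M → F} {x : M}
    (hf : ContMDiffAt I 𝓘(ℝ, F) ∞ f x) :
    ContDiffAt ℝ ∞ (f ∘ (extChartAt I x).symm) (extChartAt I x x) := by
  refine ContMDiffAt.contDiffAt ?_
  refine ContMDiffAt.comp_of_eq hf ?_ (extChartAt_to_inv x)
  exact (contMDiffOn_extChartAt_symm x).contMDiffAt (extChartAt_target_mem_nhds x)

variable (I) in
/-- The vector field `V` read in the preferred chart at `x`, on the model vector space. -/
noncomputable def chartField (x : M) (V : Π x : M, TangentSpace I x) (u : E) : E :=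
  (tderiv 𝓘(ℝ, E) I (extChartAt I x).symm u).inverse (V ((extChartAt I x).symm u))

theorem chartField_extChartAt_self [IsManifold I 1 M] (x : M) (V : Π x : M, TangentSpace I x) :
    chartField I x V (extChartAt I x x) = V x := by
  have hV : ∀ y, y = x → (V y : E) = V x := fun y hy => by subst hy; rfl
  unfold chartField
  rw [tderiv_extChartAt_symm_self, ContinuousLinearMap.inverse_id]
  exact hV _ (extChartAt_to_inv x)

theorem chartField_eq_mpullbackWithin (x : M) (V : Π x : M, TangentSpace I x) :
    chartField I x V = mpullbackWithin 𝓘(ℝ, E) I (extChartAt I x).symm V (range I) := by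
  rw [I.range_eq_univ, mpullbackWithin_univ]
  rfl

theorem mlieBracket_eq_lieBracket_chartField [IsManifold I 1 M]
    (V W : Π x : M, TangentSpace I x) (x : M) :
    mlieBracket I V W x =
      lieBracket ℝ (chartField I x V) (chartField I x W) (extChartAt I x x) := by
  have h : (tderiv I 𝓘(ℝ, E) (extChartAt I x) x).inverse = ContinuousLinearMap.id ℝ E := by
    rw [tderiv_extChartAt_self, ContinuousLinearMap.inverse_id]
  have h1 : mlieBracket I V W x = (tderiv I 𝓘(ℝ, E) (extChartAt I x) x).inverse
      (lieBracketWithin ℝ (mpullbackWithin 𝓘(ℝ, E) I (extChartAt I x).symm V (range I) : E → E)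
      (mpullbackWithin 𝓘(ℝ, E) I (extChartAt I x).symm W (range I) : E → E)
      ((extChartAt I x).symm ⁻¹' univ ∩ range I) (extChartAt I x x)) := rfl
  rw [h1, h, preimage_univ, univ_inter, ← chartField_eq_mpullbackWithin,
    ← chartField_eq_mpullbackWithin, I.range_eq_univ, lieBracketWithin_univ]
  rfl

theorem differentiableAt_chartField [CompleteSpace E] [IsManifold I 2 M]
    {V : Π x : M, TangentSpace I x} {x : M}
    (hV : MDifferentiableAt I I.tangent (fun y => (⟨y, V y⟩ : TangentBundle I M)) x) :
    DifferentiableAt ℝ (chartField I x V) (extChartAt I x x) := by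
  have : DifferentiableWithinAt ℝ
      (mpullbackWithin 𝓘(ℝ, E) I (extChartAt I x).symm V (range I) : E → E)
      ((extChartAt I x).symm ⁻¹' univ ∩ range I) (extChartAt I x x) :=
    MDifferentiableWithinAt.differentiableWithinAt_mpullbackWithin_vectorField
      (V := V) (s := univ) (x := x) (I := I) hV.mdifferentiableWithinAt
  rwa [preimage_univ, univ_inter, ← chartField_eq_mpullbackWithin, I.range_eq_univ,
    differentiableWithinAt_univ] at this

theorem eventually_tderiv_apply_eq [IsManifold I ∞ M] {f : M → F} {x : M}
    (hf : ContMDiffAt I 𝓘(ℝ, F) ∞ f x) (V : Π x : M, TangentSpace I x) :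
    (fun y => tderiv I 𝓘(ℝ, F) f y (V y)) ∘ (extChartAt I x).symm =ᶠ[𝓝 (extChartAt I x x)]
      fun u => fderiv ℝ (f ∘ (extChartAt I x).symm) u
        (chartField I x V u) := by
  filter_upwards [extChartAt_target_mem_nhds (I := I) x, (tendsto_extChartAt_symm I x).eventually
    (eventually_mdifferentiableAt_of_contMDiffAt hf)] with u hu hfu
  rw [← tderiv_eq_fderiv, tderiv_comp hfu (mdifferentiableAt_extChartAt_symm hu)]
  unfold chartField
  obtain ⟨A, hA⟩ := isInvertible_tderiv_extChartAt_symm (I := I) hu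
  rw [← hA, ContinuousLinearMap.inverse_equiv]
  exact congrArg (tderiv I 𝓘(ℝ, F) f _) (A.apply_symm_apply _).symm

theorem differentiableAt_fderiv_chartField [CompleteSpace E] [IsManifold I ∞ M] {f : M → F} {x : M}
    (hf : ContMDiffAt I 𝓘(ℝ, F) ∞ f x) {V : Π x : M, TangentSpace I x}
    (hV : MDifferentiableAt I I.tangent (fun y => (⟨y, V y⟩ : TangentBundle I M)) x) :
    DifferentiableAt ℝ (fun u => fderiv ℝ (f ∘ (extChartAt I x).symm) u (chartField I x V u))
      (extChartAt I x x) := by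
  have : IsManifold I 2 M := IsManifold.of_le (n := ∞) ENat.LEInfty.out
  refine DifferentiableAt.clm_apply ?_ (differentiableAt_chartField hV)
  exact ((contDiffAt_comp_extChartAt_symm hf).fderiv_right (m := 1)
    (by rw [one_add_one_eq_two]; exact ENat.LEInfty.out)).differentiableAt one_ne_zero

theorem mdifferentiableAt_tderiv_apply [CompleteSpace E] [IsManifold I ∞ M] {f : M → F} {x : M}
    (hf : ContMDiffAt I 𝓘(ℝ, F) ∞ f x) {V : Π x : M, TangentSpace I x}
    (hV : MDifferentiableAt I I.tangent (fun y => (⟨y, V y⟩ : TangentBundle I M)) x) :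
    MDifferentiableAt I 𝓘(ℝ, F) (fun y => tderiv I 𝓘(ℝ, F) f y (V y)) x := by
  refine MDifferentiableAt.congr_of_eventuallyEq ?_
    (eventuallyEq_comp_symm_comp_extChartAt (I := I) _ x)
  refine MDifferentiableAt.comp x (I' := 𝓘(ℝ, E)) ?_
    (mdifferentiableAt_extChartAt (mem_chart_source H x))
  exact (differentiableAt_fderiv_chartField hf hV).mdifferentiableAt.congr_of_eventuallyEq
    (eventually_tderiv_apply_eq hf V)

theorem tderiv_tderiv_apply_eq [CompleteSpace E] [IsManifold I ∞ M] {f : M → F} {x : M}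
    (hf : ContMDiffAt I 𝓘(ℝ, F) ∞ f x) {V : Π x : M, TangentSpace I x}
    (hV : MDifferentiableAt I I.tangent (fun y => (⟨y, V y⟩ : TangentBundle I M)) x) :
    tderiv I 𝓘(ℝ, F) (fun y => tderiv I 𝓘(ℝ, F) f y (V y)) x =
      fderiv ℝ (fun u => fderiv ℝ (f ∘ (extChartAt I x).symm) u (chartField I x V u))
        (extChartAt I x x) := by
  rw [tderiv_eq_fderiv_comp_extChartAt_symm (mdifferentiableAt_tderiv_apply hf hV)]
  exact (eventually_tderiv_apply_eq hf V).fderiv_eq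

theorem tderiv_mlieBracket [CompleteSpace E] [IsManifold I ∞ M] {f : M → F} {x : M}
    (hf : ContMDiffAt I 𝓘(ℝ, F) ∞ f x) {V W : Π x : M, TangentSpace I x}
    (hV : MDifferentiableAt I I.tangent (fun y => (⟨y, V y⟩ : TangentBundle I M)) x)
    (hW : MDifferentiableAt I I.tangent (fun y => (⟨y, W y⟩ : TangentBundle I M)) x) :
    tderiv I 𝓘(ℝ, F) f x (mlieBracket I V W x) =
      tderiv I 𝓘(ℝ, F) (fun y => tderiv I 𝓘(ℝ, F) f y (W y)) x (V x) -
      tderiv I 𝓘(ℝ, F) (fun y => tderiv I 𝓘(ℝ, F) f y (V y)) x (W x) := by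
  have : IsManifold I 2 M := IsManifold.of_le (n := ∞) ENat.LEInfty.out
  rw [tderiv_tderiv_apply_eq hf hV, tderiv_tderiv_apply_eq hf hW,
    mlieBracket_eq_lieBracket_chartField,
    tderiv_eq_fderiv_comp_extChartAt_symm (hf.mdifferentiableAt (by simp))]
  refine (fderiv_apply_lieBracket (contDiffAt_comp_extChartAt_symm hf)
    (by rw [minSmoothness_of_isRCLikeNormedField]; exact ENat.LEInfty.out)
    (differentiableAt_chartField hW) (differentiableAt_chartField hV)).trans ?_
  rw [chartField_extChartAt_self, chartField_extChartAt_self]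

end Derivation

section SmoothDerivative

open Set Filter Topology

variable {E : Type*} [NormedAddCommGroup E] [NormedSpace ℝ E]
  {H : Type*} [TopologicalSpace H] {I : ModelWithCorners ℝ E H}
  {M : Type*} [TopologicalSpace M] [ChartedSpace H M] [IsManifold I ∞ M]
  {E' : Type*} [NormedAddCommGroup E'] [NormedSpace ℝ E']
  {H' : Type*} [TopologicalSpace H'] {I' : ModelWithCorners ℝ E' H'}
  {M' : Type*} [TopologicalSpace M'] [ChartedSpace H' M'] [IsManifold I' ∞ M']
  {EN : Type*} [NormedAddCommGroup EN] [NormedSpace ℝ EN]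
  {HN : Type*} [TopologicalSpace HN] {J : ModelWithCorners ℝ EN HN}
  {N : Type*} [TopologicalSpace N] [ChartedSpace HN N] [IsManifold J ∞ N]

theorem tderiv_extChartAt_of_eq {x y : M} (h : y = x) :
    tderiv I 𝓘(ℝ, E) (extChartAt I x) y = ContinuousLinearMap.id ℝ E := by
  subst h
  have : IsManifold I 1 M := IsManifold.of_le (n := ∞) ENat.LEInfty.out
  exact tderiv_extChartAt_self _

variable [I.Boundaryless]

/- Mathlib's `ContMDiffAt.mfderiv` reads the derivative in the preferred charts at `g x₀` and
`f x₀ (g x₀)`; the last two hypotheses say that this does not change it. -/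
theorem contMDiffAt_tderiv {f : N → M → M'} {g : N → M} {x₀ : N}
    (hf : ContMDiffAt (J.prod I) I' ∞ (Function.uncurry f) (x₀, g x₀)) (hg : ContMDiffAt J I ∞ g x₀)
    (h1 : ∀ᶠ x in 𝓝 x₀, tderiv 𝓘(ℝ, E) I (extChartAt I (g x₀)).symm (extChartAt I (g x₀) (g x)) =
      ContinuousLinearMap.id ℝ E)
    (h2 : ∀ᶠ x in 𝓝 x₀, tderiv I' 𝓘(ℝ, E') (extChartAt I' (f x₀ (g x₀))) (f x (g x)) =
      ContinuousLinearMap.id ℝ E') :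
    ContMDiffAt J 𝓘(ℝ, E →L[ℝ] E') ∞ (fun x => tderiv I I' (f x) (g x)) x₀ := by
  have : IsManifold I 1 M := IsManifold.of_le (n := ∞) ENat.LEInfty.out
  have : IsManifold I' 1 M' := IsManifold.of_le (n := ∞) ENat.LEInfty.out
  have key := ContMDiffAt.mfderiv (m := ∞) f g hf hg (by simp)
  refine key.congr_of_eventuallyEq ?_
  have hs : ∀ᶠ x in 𝓝 x₀, g x ∈ (chartAt H (g x₀)).source :=
    hg.continuousAt.eventually_mem ((chartAt H (g x₀)).open_source.mem_nhds (mem_chart_source H _))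
  have hfg : ContinuousAt (fun x => f x (g x)) x₀ :=
    ContinuousAt.comp_of_eq (f := fun x => (x, g x)) (x := x₀) hf.continuousAt
      (continuousAt_id.prodMk hg.continuousAt) rfl
  have ht : ∀ᶠ x in 𝓝 x₀, f x (g x) ∈ (chartAt H' (f x₀ (g x₀))).source :=
    hfg.eventually_mem ((chartAt H' _).open_source.mem_nhds (mem_chart_source H' _))
  filter_upwards [h1, h2, hs, ht] with x h1 h2 hs ht
  rw [inTangentCoordinates_eq_mfderiv_comp hs ht, I.range_eq_univ, mfderivWithin_univ]
  change _ = (tderiv I' 𝓘(ℝ, E') (extChartAt I' (f x₀ (g x₀))) (f x (g x))).comp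
    ((tderiv I I' (f x) (g x)).comp (tderiv 𝓘(ℝ, E) I _ _))
  rw [h1, h2]
  rfl

theorem tderiv_extChartAt_symm_of_eq {x y : M} (h : y = x) :
    tderiv 𝓘(ℝ, E) I (extChartAt I x).symm (extChartAt I x y) = ContinuousLinearMap.id ℝ E := by
  subst h
  have : IsManifold I 1 M := IsManifold.of_le (n := ∞) ENat.LEInfty.out
  exact tderiv_extChartAt_symm_self _

theorem tderiv_extChartAt_model (x y : E) :
    tderiv 𝓘(ℝ, E) 𝓘(ℝ, E) (extChartAt 𝓘(ℝ, E) x) y = ContinuousLinearMap.id ℝ E := by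
  rw [extChartAt_model_space_eq_id]
  exact tderiv_id y

theorem tderiv_extChartAt_symm_model (x y : E) :
    tderiv 𝓘(ℝ, E) 𝓘(ℝ, E) (extChartAt 𝓘(ℝ, E) x).symm y = ContinuousLinearMap.id ℝ E := by
  rw [extChartAt_model_space_eq_id]
  exact tderiv_id y

end SmoothDerivative

section SecondDerivative

open Filter Topology

variable {E : Type*} [NormedAddCommGroup E] [NormedSpace ℝ E]
  {E' : Type*} [NormedAddCommGroup E'] [NormedSpace ℝ E']
  {F : Type*} [NormedAddCommGroup F] [NormedSpace ℝ F]

theorem fderiv_fderiv_partial_left {m : E × E' → F} {e : E} {e' : E'}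
    (hm : ContDiffAt ℝ 2 m (e, e')) (X : E') (Y : E) :
    fderiv ℝ (fun v => fderiv ℝ (fun u => m (u, v)) e Y) e' X =
      fderiv ℝ (fderiv ℝ m) (e, e') (0, X) (Y, 0) := by
  have hpartial : (fun v => fderiv ℝ (fun u => m (u, v)) e Y) =ᶠ[𝓝 e'] fun v =>
      fderiv ℝ m (e, v) (Y, 0) := by
    have hlim : Tendsto (fun v => (e, v)) (𝓝 e') (𝓝 (e, e')) :=
      (continuous_const.prodMk continuous_id).tendsto e'
    filter_upwards [hlim.eventually (hm.eventually (by simp))] with v hv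
    have := HasFDerivAt.comp (f := fun u => (u, v)) e
      (hv.differentiableAt two_ne_zero).hasFDerivAt (hasFDerivAt_prodMk_left e v)
    exact DFunLike.congr_fun this.fderiv Y |>.trans (by simp)
  have hd : HasFDerivAt (fderiv ℝ m) (fderiv ℝ (fderiv ℝ m) (e, e')) (e, e') :=
    ((hm.fderiv_right (m := 1) (by rw [one_add_one_eq_two])).differentiableAt
      one_ne_zero).hasFDerivAt
  have := (HasFDerivAt.comp (f := fun v => (e, v)) e' hd
    (hasFDerivAt_prodMk_right e e')).clm_apply
    (hasFDerivAt_const ((Y, 0) : E × E') e')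
  rw [hpartial.fderiv_eq]
  exact DFunLike.congr_fun this.fderiv X |>.trans (by simp)

theorem fderiv_fderiv_partial_right {m : E × E' → F} {e : E} {e' : E'}
    (hm : ContDiffAt ℝ 2 m (e, e')) (X : E') (Y : E) :
    fderiv ℝ (fun u => fderiv ℝ (fun v => m (u, v)) e' X) e Y =
      fderiv ℝ (fderiv ℝ m) (e, e') (Y, 0) (0, X) := by
  have hpartial : (fun u => fderiv ℝ (fun v => m (u, v)) e' X) =ᶠ[𝓝 e] fun u =>
      fderiv ℝ m (u, e') (0, X) := by
    have hlim : Tendsto (fun u => (u, e')) (𝓝 e) (𝓝 (e, e')) :=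
      (continuous_id.prodMk continuous_const).tendsto e
    filter_upwards [hlim.eventually (hm.eventually (by simp))] with u hu
    have := HasFDerivAt.comp (f := fun v => (u, v)) e'
      (hu.differentiableAt two_ne_zero).hasFDerivAt (hasFDerivAt_prodMk_right u e')
    exact DFunLike.congr_fun this.fderiv X |>.trans (by simp)
  have hd : HasFDerivAt (fderiv ℝ m) (fderiv ℝ (fderiv ℝ m) (e, e')) (e, e') :=
    ((hm.fderiv_right (m := 1) (by rw [one_add_one_eq_two])).differentiableAt
      one_ne_zero).hasFDerivAt
  have := (HasFDerivAt.comp (f := fun u => (u, e')) e hd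
    (hasFDerivAt_prodMk_left e e')).clm_apply
    (hasFDerivAt_const ((0, X) : E × E') e)
  rw [hpartial.fderiv_eq]
  exact DFunLike.congr_fun this.fderiv Y |>.trans (by simp)

variable {H : Type*} [TopologicalSpace H] {I : ModelWithCorners ℝ E H} [I.Boundaryless]
  {M : Type*} [TopologicalSpace M] [ChartedSpace H M] [IsManifold I ∞ M]
  {H' : Type*} [TopologicalSpace H'] {I' : ModelWithCorners ℝ E' H'} [I'.Boundaryless]
  {M' : Type*} [TopologicalSpace M'] [ChartedSpace H' M'] [IsManifold I' ∞ M']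

theorem contDiffAt_uncurry_comp_extChartAt_symm {f : M → M' → F} {x : M} {y : M'}
    (hf : ContMDiffAt (I.prod I') 𝓘(ℝ, F) ∞ (Function.uncurry f) (x, y)) :
    ContDiffAt ℝ ∞ (fun p : E × E' => f ((extChartAt I x).symm p.1) ((extChartAt I' y).symm p.2))
      (extChartAt I x x, extChartAt I' y y) := by
  have := contDiffAt_comp_extChartAt_symm hf
  rw [extChartAt_prod] at this
  exact this

theorem tderiv_tderiv_eq_fderiv_fderiv {f : M → M' → F} {x : M} {y : M'}
    (hf : ContMDiffAt (I.prod I') 𝓘(ℝ, F) ∞ (Function.uncurry f) (x, y)) (X : E') (Y : E) :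
    tderiv I' 𝓘(ℝ, F) (fun z => tderiv I 𝓘(ℝ, F) (fun w => f w z) x Y) y X =
      fderiv ℝ (fun v => fderiv ℝ (fun u => f ((extChartAt I x).symm u) ((extChartAt I' y).symm v))
        (extChartAt I x x) Y) (extChartAt I' y y) X := by
  have : IsManifold I 1 M := IsManifold.of_le (n := ∞) ENat.LEInfty.out
  have : IsManifold I' 1 M' := IsManifold.of_le (n := ∞) ENat.LEInfty.out
  have hswap : ContMDiffAt (I'.prod I) 𝓘(ℝ, F) ∞ (Function.uncurry fun z w => f w z) (y, x) :=
    ContMDiffAt.comp (f := Prod.swap) (y, x) hf (contMDiffAt_snd.prodMk contMDiffAt_fst)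
  have hsmooth : ContMDiffAt I' 𝓘(ℝ, E →L[ℝ] F) ∞ (fun z => tderiv I 𝓘(ℝ, F) (f · z) x) y :=
    contMDiffAt_tderiv (f := fun z w => f w z) (g := fun _ => x) hswap contMDiffAt_const
      (.of_forall fun _ => tderiv_extChartAt_symm_self x)
      (.of_forall fun _ => tderiv_extChartAt_model _ _)
  have hmd : ∀ᶠ z in 𝓝 y, MDifferentiableAt I 𝓘(ℝ, F) (f · z) x := by
    have hlim : Tendsto (fun z => (x, z)) (𝓝 y) (𝓝 (x, y)) :=
      (continuous_const.prodMk continuous_id).tendsto y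
    filter_upwards [hlim.eventually (eventually_mdifferentiableAt_of_contMDiffAt hf)] with z hz
    exact MDifferentiableAt.comp (f := fun w => (w, z)) x hz
      (mdifferentiableAt_id.prodMk mdifferentiableAt_const)
  rw [tderiv_eq_fderiv_comp_extChartAt_symm
    ((hsmooth.mdifferentiableAt (by simp)).clm_apply mdifferentiableAt_const)]
  refine DFunLike.congr_fun (EventuallyEq.fderiv_eq ?_) X
  filter_upwards [(tendsto_extChartAt_symm I' y).eventually hmd] with v hv
  exact DFunLike.congr_fun (tderiv_eq_fderiv_comp_extChartAt_symm hv) Y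

theorem tderiv_tderiv_comm {f : M → M' → F} {x : M} {y : M'}
    (hf : ContMDiffAt (I.prod I') 𝓘(ℝ, F) ∞ (Function.uncurry f) (x, y)) (X : E') (Y : E) :
    tderiv I' 𝓘(ℝ, F) (fun z => tderiv I 𝓘(ℝ, F) (fun w => f w z) x Y) y X =
      tderiv I 𝓘(ℝ, F) (fun w => tderiv I' 𝓘(ℝ, F) (fun z => f w z) y X) x Y := by
  have hswap : ContMDiffAt (I'.prod I) 𝓘(ℝ, F) ∞ (Function.uncurry fun z w => f w z) (y, x) :=
    ContMDiffAt.comp (f := Prod.swap) (y, x) hf (contMDiffAt_snd.prodMk contMDiffAt_fst)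
  have hm := (contDiffAt_uncurry_comp_extChartAt_symm hf).of_le (m := 2) ENat.LEInfty.out
  rw [tderiv_tderiv_eq_fderiv_fderiv hf, tderiv_tderiv_eq_fderiv_fderiv hswap,
    fderiv_fderiv_partial_left hm, fderiv_fderiv_partial_right hm]
  exact (hm.isSymmSndFDerivAt (by simp)).eq (0, X) (Y, 0)

end SecondDerivative

section ProductRule

variable {E : Type*} [NormedAddCommGroup E] [NormedSpace ℝ E]
  {H : Type*} [TopologicalSpace H] {I : ModelWithCorners ℝ E H} [I.Boundaryless]
  {M : Type*} [TopologicalSpace M] [ChartedSpace H M] [IsManifold I ∞ M]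
  {F : Type*} [NormedAddCommGroup F] [NormedSpace ℝ F]
  {F' : Type*} [NormedAddCommGroup F'] [NormedSpace ℝ F']

theorem differentiableAt_comp_extChartAt_symm {f : M → F} {x : M}
    (hf : MDifferentiableAt I 𝓘(ℝ, F) f x) :
    DifferentiableAt ℝ (f ∘ (extChartAt I x).symm) (extChartAt I x x) := by
  have : IsManifold I 1 M := IsManifold.of_le (n := ∞) ENat.LEInfty.out
  refine MDifferentiableAt.differentiableAt ?_
  exact MDifferentiableAt.comp_of_eq _ hf
    (mdifferentiableAt_extChartAt_symm (mem_extChartAt_target x)) (extChartAt_to_inv x)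

theorem tderiv_clm_apply {A : M → F →L[ℝ] F'} {v : M → F} {x : M}
    (hA : MDifferentiableAt I 𝓘(ℝ, F →L[ℝ] F') A x) (hv : MDifferentiableAt I 𝓘(ℝ, F) v x) (X : E) :
    tderiv I 𝓘(ℝ, F') (fun y => A y (v y)) x X =
      tderiv I 𝓘(ℝ, F →L[ℝ] F') A x X (v x) + A x (tderiv I 𝓘(ℝ, F) v x X) := by
  have : IsManifold I 1 M := IsManifold.of_le (n := ∞) ENat.LEInfty.out
  have hA' := differentiableAt_comp_extChartAt_symm hA
  have hv' := differentiableAt_comp_extChartAt_symm hv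
  rw [tderiv_eq_fderiv_comp_extChartAt_symm hA, tderiv_eq_fderiv_comp_extChartAt_symm hv,
    tderiv_eq_fderiv_comp_extChartAt_symm (hA.clm_apply hv)]
  have := (hA'.hasFDerivAt.clm_apply hv'.hasFDerivAt).fderiv
  refine (DFunLike.congr_fun this X).trans ?_
  simp [add_comm]

theorem tderiv_clm_apply_const {A : M → F →L[ℝ] F'} {x : M}
    (hA : MDifferentiableAt I 𝓘(ℝ, F →L[ℝ] F') A x) (v : F) (X : E) :
    tderiv I 𝓘(ℝ, F') (fun y => A y v) x X = tderiv I 𝓘(ℝ, F →L[ℝ] F') A x X v := by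
  rw [tderiv_clm_apply hA mdifferentiableAt_const, tderiv_const]
  simp

end ProductRule

section LieGroupBracket

open Filter Topology

variable {E : Type*} [NormedAddCommGroup E] [NormedSpace ℝ E]
  {H : Type*} [TopologicalSpace H] {I : ModelWithCorners ℝ E H}
  {G : Type*} [TopologicalSpace G] [ChartedSpace H G] [Group G]
  {F : Type*} [NormedAddCommGroup F] [NormedSpace ℝ F]

variable (I G) in
/-- The Lie bracket of the Lie algebra of `G`, on the model vector space. -/
noncomputable def groupBracket (X Y : E) : E :=
  Bracket.bracket (L := GroupLieAlgebra I G) (M := GroupLieAlgebra I G) X Y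

theorem mulInvariantVectorField_one (Z : E) :
    (mulInvariantVectorField (I := I) (G := G) Z 1 : E) = Z := by
  have : (fun b : G => 1 * b) = id := funext one_mul
  change tderiv I I (fun b : G => 1 * b) 1 Z = Z
  rw [this, tderiv_id]
  rfl

variable [LieGroup I ∞ G]

theorem mdifferentiableAt_const_mul (a b : G) : MDifferentiableAt I I (fun b => a * b) b :=
  (contMDiff_mul_left (I := I) (n := ∞) (a := a)).mdifferentiableAt (by simp)

theorem mdifferentiableAt_mul_const (a b : G) : MDifferentiableAt I I (fun b => b * a) b :=
  (contMDiff_mul_right (I := I) (n := ∞) (a := a)).mdifferentiableAt (by simp)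

theorem tderiv_comp_mul_left {f : G → F} {a : G} (hf : MDifferentiableAt I 𝓘(ℝ, F) f a) (Y : E) :
    tderiv I 𝓘(ℝ, F) (fun b => f (a * b)) 1 Y =
      tderiv I 𝓘(ℝ, F) f a (mulInvariantVectorField (I := I) (G := G) Y a) :=
  DFunLike.congr_fun (tderiv_comp_of_eq (f := fun b => a * b) (x := 1) hf
    (mdifferentiableAt_const_mul a 1) (mul_one a)) Y

theorem eventually_tderiv_comp_mul_left {f : G → F} (hf : ContMDiffAt I 𝓘(ℝ, F) ∞ f 1) (Y : E) :
    (fun a => tderiv I 𝓘(ℝ, F) (fun b => f (a * b)) 1 Y) =ᶠ[𝓝 1]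
      fun a => tderiv I 𝓘(ℝ, F) f a (mulInvariantVectorField (I := I) (G := G) Y a) := by
  filter_upwards [eventually_mdifferentiableAt_of_contMDiffAt hf] with a ha
  exact tderiv_comp_mul_left ha Y

theorem mdifferentiableAt_tderiv_comp_mul_left [CompleteSpace E] [I.Boundaryless] {f : G → F}
    (hf : ContMDiffAt I 𝓘(ℝ, F) ∞ f 1) (Y : E) :
    MDifferentiableAt I 𝓘(ℝ, F) (fun a => tderiv I 𝓘(ℝ, F) (fun b => f (a * b)) 1 Y) 1 :=
  (mdifferentiableAt_tderiv_apply hf (mdifferentiableAt_mulInvariantVectorField _)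
    ).congr_of_eventuallyEq (eventually_tderiv_comp_mul_left hf Y)

theorem tderiv_groupBracket [CompleteSpace E] [I.Boundaryless] {f : G → F}
    (hf : ContMDiffAt I 𝓘(ℝ, F) ∞ f 1) (X Y : E) :
    tderiv I 𝓘(ℝ, F) f 1 (groupBracket I G X Y) =
      tderiv I 𝓘(ℝ, F) (fun a => tderiv I 𝓘(ℝ, F) (fun b => f (a * b)) 1 Y) 1 X -
      tderiv I 𝓘(ℝ, F) (fun a => tderiv I 𝓘(ℝ, F) (fun b => f (a * b)) 1 X) 1 Y := by
  have := tderiv_mlieBracket hf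
    (mdifferentiableAt_mulInvariantVectorField (I := I) (G := G) (g := 1) X)
    (mdifferentiableAt_mulInvariantVectorField (I := I) (G := G) (g := 1) Y)
  rw [mulInvariantVectorField_one, mulInvariantVectorField_one] at this
  rw [tderiv_congr (eventually_tderiv_comp_mul_left hf X),
    tderiv_congr (eventually_tderiv_comp_mul_left hf Y)]
  exact this

variable {E' : Type*} [NormedAddCommGroup E'] [NormedSpace ℝ E'] [CompleteSpace E']
  {H' : Type*} [TopologicalSpace H'] {I' : ModelWithCorners ℝ E' H'} [I'.Boundaryless]
  {G' : Type*} [TopologicalSpace G'] [ChartedSpace H' G'] [Group G'] [LieGroup I' ∞ G']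

omit [LieGroup I ∞ G] in
theorem tderiv_tderiv_comp_monoidHom {φ : G →* G'} (hφ : ContMDiff I I' ∞ φ) {f : G' → F}
    (hf : ContMDiffAt I' 𝓘(ℝ, F) ∞ f 1) (X Y : E) :
    tderiv I 𝓘(ℝ, F) (fun a => tderiv I 𝓘(ℝ, F) (fun b => (f ∘ φ) (a * b)) 1 Y) 1 X =
      tderiv I' 𝓘(ℝ, F) (fun a => tderiv I' 𝓘(ℝ, F) (fun b => f (a * b)) 1 (tderiv I I' φ 1 Y)) 1
        (tderiv I I' φ 1 X) := by
  set h : G' → F := fun a => tderiv I' 𝓘(ℝ, F) (fun b => f (a * b)) 1 (tderiv I I' φ 1 Y)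
  have hφ1 : MDifferentiableAt I I' φ 1 := hφ.mdifferentiableAt (by simp)
  have hlim : Tendsto φ (𝓝 1) (𝓝 1) := by
    simpa only [map_one] using hφ.continuous.tendsto 1
  have hcomp : (fun a => tderiv I 𝓘(ℝ, F) (fun b => (f ∘ φ) (a * b)) 1 Y) =ᶠ[𝓝 1] h ∘ φ := by
    filter_upwards [hlim.eventually (eventually_mdifferentiableAt_of_contMDiffAt hf)] with a ha
    have hmul : (fun b => (f ∘ φ) (a * b)) = (fun b => f (φ a * b)) ∘ φ :=
      funext fun b => congrArg f (map_mul φ a b)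
    rw [hmul]
    exact DFunLike.congr_fun (tderiv_comp_of_eq (g := fun b => f (φ a * b))
      (ha.comp_of_eq 1 (mdifferentiableAt_const_mul _ _) (mul_one _)) hφ1 (map_one φ)) Y
  rw [tderiv_congr hcomp, tderiv_comp_of_eq (mdifferentiableAt_tderiv_comp_mul_left hf _) hφ1
    (map_one φ)]
  rfl

theorem tderiv_monoidHom_groupBracket [CompleteSpace E] [I.Boundaryless] {φ : G →* G'}
    (hφ : ContMDiff I I' ∞ φ) (X Y : E) :
    tderiv I I' φ 1 (groupBracket I G X Y) =
      groupBracket I' G' (tderiv I I' φ 1 X) (tderiv I I' φ 1 Y) := by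
  let f : G' → E' := extChartAt I' (1 : G')
  have hf : ContMDiffAt I' 𝓘(ℝ, E') ∞ f 1 := contMDiffAt_extChartAt
  have hf' : ContMDiffAt I' 𝓘(ℝ, E') ∞ f (φ 1) := by rwa [map_one]
  have hid : tderiv I' 𝓘(ℝ, E') f 1 = ContinuousLinearMap.id ℝ E' := tderiv_extChartAt_of_eq rfl
  have hcomp (Z : E) : tderiv I 𝓘(ℝ, E') (f ∘ φ) 1 Z = tderiv I I' φ 1 Z := by
    rw [tderiv_comp_of_eq (hf.mdifferentiableAt (by simp)) (hφ.mdifferentiableAt (by simp))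
      (map_one φ), hid]
    rfl
  rw [← hcomp, tderiv_groupBracket (hf'.comp 1 hφ.contMDiffAt), tderiv_tderiv_comp_monoidHom hφ hf,
    tderiv_tderiv_comp_monoidHom hφ hf, ← tderiv_groupBracket hf, hid]
  rfl

end LieGroupBracket

section Adjoint

open Filter Topology

variable {E : Type*} [NormedAddCommGroup E] [NormedSpace ℝ E]
  {G : Type*} [TopologicalSpace G] [ChartedSpace E G] [Group G]

theorem Ad_eq_tderiv (g : G) :
    Ad E g = tderiv 𝓘(ℝ, E) 𝓘(ℝ, E) (fun h : G => g * h * g⁻¹) 1 := rfl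

theorem Ad_one : Ad E (1 : G) = ContinuousLinearMap.id ℝ E := by
  have : (fun h : G => 1 * h * 1⁻¹) = id := funext fun h => by simp
  rw [Ad_eq_tderiv, this, tderiv_id]

variable (E G) in
/-- The adjoint representation `ad` of the Lie algebra of `G`, as the derivative of `Ad` at the
identity; it agrees with the bracket by `adL_apply`. -/
noncomputable def adL : E →L[ℝ] E →L[ℝ] E :=
  tderiv 𝓘(ℝ, E) 𝓘(ℝ, E →L[ℝ] E) (Ad E : G → E →L[ℝ] E) 1

variable [LieGroup 𝓘(ℝ, E) ∞ G]

theorem contMDiff_Ad : ContMDiff 𝓘(ℝ, E) 𝓘(ℝ, E →L[ℝ] E) ∞ (Ad E : G → E →L[ℝ] E) := fun _ =>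
  have hconj : ContMDiff (𝓘(ℝ, E).prod 𝓘(ℝ, E)) 𝓘(ℝ, E) ∞ fun p : G × G => p.1 * p.2 * p.1⁻¹ :=
    (contMDiff_fst.mul contMDiff_snd).mul contMDiff_fst.inv
  contMDiffAt_tderiv (f := fun g h : G => g * h * g⁻¹) (g := fun _ : G => (1 : G))
    hconj.contMDiffAt contMDiffAt_const
    (.of_forall fun _ => tderiv_extChartAt_symm_of_eq rfl)
    (.of_forall fun _ => tderiv_extChartAt_of_eq (by simp))

theorem mdifferentiableAt_conj (g h : G) :
    MDifferentiableAt 𝓘(ℝ, E) 𝓘(ℝ, E) (fun h : G => g * h * g⁻¹) h :=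
  ((contMDiff_const.mul contMDiff_id).mul contMDiff_const : ContMDiff _ _ ∞ _).mdifferentiableAt
    (by simp)

theorem tderiv_comp_conj {E' : Type*} [NormedAddCommGroup E'] [NormedSpace ℝ E']
    {H' : Type*} [TopologicalSpace H'] {I' : ModelWithCorners ℝ E' H'}
    {M : Type*} [TopologicalSpace M] [ChartedSpace H' M] {f : G → M}
    (hf : MDifferentiableAt 𝓘(ℝ, E) I' f 1) (g : G) :
    tderiv 𝓘(ℝ, E) I' (fun h => f (g * h * g⁻¹)) 1 = (tderiv 𝓘(ℝ, E) I' f 1).comp (Ad E g) :=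
  tderiv_comp_of_eq (f := fun h => g * h * g⁻¹) hf (mdifferentiableAt_conj g 1) (by simp)

theorem Ad_mul (g h : G) : Ad E (g * h) = (Ad E g).comp (Ad E h) := by
  have hconj : (fun k => g * h * k * (g * h)⁻¹) = fun k => g * (h * k * h⁻¹) * g⁻¹ :=
    funext fun k => by group
  rw [Ad_eq_tderiv, hconj]
  exact tderiv_comp_conj (f := fun k => g * k * g⁻¹) (mdifferentiableAt_conj g 1) h

variable {F : Type*} [NormedAddCommGroup F] [NormedSpace ℝ F]

theorem contMDiffAt_tderiv_comp_mul_right {f : G → F} (hf : ContMDiffAt 𝓘(ℝ, E) 𝓘(ℝ, F) ∞ f 1) :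
    ContMDiffAt 𝓘(ℝ, E) 𝓘(ℝ, E →L[ℝ] F) ∞
      (fun a => tderiv 𝓘(ℝ, E) 𝓘(ℝ, F) (fun h => f (h * a)) 1) 1 :=
  have hmul : ContMDiff (𝓘(ℝ, E).prod 𝓘(ℝ, E)) 𝓘(ℝ, E) ∞ fun p : G × G => p.2 * p.1 :=
    contMDiff_snd.mul contMDiff_fst
  contMDiffAt_tderiv (f := fun a h : G => f (h * a)) (g := fun _ : G => (1 : G))
    (hf.comp_of_eq hmul.contMDiffAt (by simp)) contMDiffAt_const
    (.of_forall fun _ => tderiv_extChartAt_symm_of_eq rfl)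
    (.of_forall fun _ => tderiv_extChartAt_model _ _)

theorem eventually_tderiv_comp_mul_left_eq_Ad {f : G → F}
    (hf : ContMDiffAt 𝓘(ℝ, E) 𝓘(ℝ, F) ∞ f 1) (Y : E) :
    (fun a => tderiv 𝓘(ℝ, E) 𝓘(ℝ, F) (fun b => f (a * b)) 1 Y) =ᶠ[𝓝 1]
      fun a => tderiv 𝓘(ℝ, E) 𝓘(ℝ, F) (fun h => f (h * a)) 1 (Ad E a Y) := by
  filter_upwards [eventually_mdifferentiableAt_of_contMDiffAt hf] with a ha
  have := tderiv_comp_conj (f := fun h => f (h * a))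
    (MDifferentiableAt.comp_of_eq (g := f) 1 ha (mdifferentiableAt_mul_const _ _) (one_mul _)) a
  simp only [inv_mul_cancel_right] at this
  rw [this]
  rfl

/- `a h = (a h a⁻¹) a`: differentiating `f (a h)` in `h` and then in `a` gives the derivative of
`Ad` plus the second derivative of `f (h a)`, and the latter is symmetric. -/
theorem adL_apply [CompleteSpace E] (X Y : E) : adL E G X Y = ad G X Y := by
  let f : G → E := extChartAt 𝓘(ℝ, E) (1 : G)
  have hf : ContMDiffAt 𝓘(ℝ, E) 𝓘(ℝ, E) ∞ f 1 := contMDiffAt_extChartAt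
  have hid : tderiv 𝓘(ℝ, E) 𝓘(ℝ, E) f 1 = ContinuousLinearMap.id ℝ E := tderiv_extChartAt_of_eq rfl
  let R : G → E →L[ℝ] E := fun a => tderiv 𝓘(ℝ, E) 𝓘(ℝ, E) (fun h => f (h * a)) 1
  have hR1 : R 1 = ContinuousLinearMap.id ℝ E := by simp only [R, mul_one, hid]
  have hR : MDifferentiableAt 𝓘(ℝ, E) 𝓘(ℝ, E →L[ℝ] E) R 1 :=
    (contMDiffAt_tderiv_comp_mul_right hf).mdifferentiableAt (by simp)
  have hAd : MDifferentiableAt 𝓘(ℝ, E) 𝓘(ℝ, E →L[ℝ] E) (Ad E : G → E →L[ℝ] E) 1 :=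
    contMDiff_Ad.mdifferentiableAt (by simp)
  have hleft : tderiv 𝓘(ℝ, E) 𝓘(ℝ, E) (fun a => R a (Ad E a Y)) 1 X =
      tderiv 𝓘(ℝ, E) 𝓘(ℝ, E) (fun a => R a Y) 1 X + adL E G X Y := by
    rw [tderiv_clm_apply hR (hAd.clm_apply mdifferentiableAt_const), tderiv_clm_apply_const hR,
      tderiv_clm_apply_const hAd, hR1, Ad_one]
    rfl
  have hmul : ContMDiff (𝓘(ℝ, E).prod 𝓘(ℝ, E)) 𝓘(ℝ, E) ∞ fun p : G × G => p.1 * p.2 :=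
    contMDiff_fst.mul contMDiff_snd
  have hright := tderiv_tderiv_comm (f := fun h a : G => f (h * a)) (x := 1) (y := 1)
    (hf.comp_of_eq hmul.contMDiffAt (mul_one 1)) X Y
  have hbracket := tderiv_groupBracket hf X Y
  rw [hid, tderiv_congr (eventually_tderiv_comp_mul_left_eq_Ad hf Y), hleft, hright,
    add_sub_cancel_left] at hbracket
  exact hbracket.symm

end Adjoint

section JetEq

open Filter Topology

variable {E F F' : Type*} [NormedAddCommGroup E] [NormedSpace ℝ E] [NormedAddCommGroup F]
  [NormedSpace ℝ F] [NormedAddCommGroup F'] [NormedSpace ℝ F']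

/-- The curves `u` and `v` in a vector space have the same derivatives at `0` of all orders less
than `n`, that is, the same `(n - 1)`-jet if `n` is positive. -/
def JetEq (n : ℕ) (u v : ℝ → F) : Prop :=
  ∀ j < n, iteratedDeriv j u 0 = iteratedDeriv j v 0

theorem JetEq.refl (n : ℕ) (u : ℝ → F) : JetEq n u u := fun _ _ => rfl

theorem JetEq.symm {n : ℕ} {u v : ℝ → F} (h : JetEq n u v) : JetEq n v u :=
  fun j hj => (h j hj).symm

theorem JetEq.trans {n : ℕ} {u v w : ℝ → F} (h : JetEq n u v) (h' : JetEq n v w) : JetEq n u w :=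
  fun j hj => (h j hj).trans (h' j hj)

theorem JetEq.of_eventuallyEq {u v : ℝ → F} (h : u =ᶠ[𝓝 0] v) (n : ℕ) : JetEq n u v :=
  fun j _ => h.iteratedDeriv_eq j

theorem contDiffAt_nat_of_infty {f : E → F} {x : E} (hf : ContDiffAt ℝ ∞ f x) (n : ℕ) :
    ContDiffAt ℝ n f x := hf.of_le (by exact_mod_cast le_top)

theorem JetEq.iteratedFDeriv_eq {n : ℕ} {u v : ℝ → F} (h : JetEq n u v) {j : ℕ} (hj : j < n) :
    iteratedFDeriv ℝ j u 0 = iteratedFDeriv ℝ j v 0 := by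
  simp only [iteratedFDeriv_eq_equiv_comp, Function.comp, h j hj]

theorem JetEq.comp {n : ℕ} {u v : ℝ → F} (h : JetEq n u v) {f : F → F'}
    (hf : ContDiffAt ℝ ∞ f (u 0)) (hu : ContDiffAt ℝ ∞ u 0) (hv : ContDiffAt ℝ ∞ v 0) :
    JetEq n (fun t => f (u t)) (fun t => f (v t)) := by
  intro j hj
  obtain ⟨k, rfl⟩ : ∃ k, n = k + 1 := ⟨n - 1, by omega⟩
  exact iteratedDeriv_comp_congr (by simpa using h 0 k.succ_pos) (contDiffAt_nat_of_infty hf k)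
    (contDiffAt_nat_of_infty hu k) (contDiffAt_nat_of_infty hv k)
    (fun m hm => h.iteratedFDeriv_eq (Nat.lt_succ_of_le hm)) (Nat.le_of_lt_succ hj)

theorem JetEq.prodMk {n : ℕ} {u v : ℝ → F} {u' v' : ℝ → F'} (h : JetEq n u v) (h' : JetEq n u' v')
    (hu : ContDiffAt ℝ ∞ u 0) (hv : ContDiffAt ℝ ∞ v 0) (hu' : ContDiffAt ℝ ∞ u' 0)
    (hv' : ContDiffAt ℝ ∞ v' 0) : JetEq n (fun t => (u t, u' t)) (fun t => (v t, v' t)) := by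
  intro j hj
  simp only [iteratedDeriv_eq_iteratedFDeriv]
  rw [iteratedFDeriv_prodMk (contDiffAt_nat_of_infty hu j) (contDiffAt_nat_of_infty hu' j) le_rfl,
    iteratedFDeriv_prodMk (contDiffAt_nat_of_infty hv j) (contDiffAt_nat_of_infty hv' j) le_rfl,
    h.iteratedFDeriv_eq hj, h'.iteratedFDeriv_eq hj]

theorem JetEq.clm_apply {n : ℕ} {A B : ℝ → F →L[ℝ] F'} {u v : ℝ → F} (h : JetEq n A B)
    (h' : JetEq n u v) (hA : ContDiffAt ℝ ∞ A 0) (hB : ContDiffAt ℝ ∞ B 0)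
    (hu : ContDiffAt ℝ ∞ u 0) (hv : ContDiffAt ℝ ∞ v 0) :
    JetEq n (fun t => A t (u t)) (fun t => B t (v t)) :=
  (h.prodMk h' hA hB hu hv).comp (f := fun p : (F →L[ℝ] F') × F => p.1 p.2)
    (contDiff_fst.clm_apply contDiff_snd).contDiffAt (hA.prodMk hu) (hB.prodMk hv)

theorem JetEq.comp_clm_apply {n : ℕ} {A : E → F →L[ℝ] F'} {u v : ℝ → E} {X Y : ℝ → F}
    (h : JetEq n u v) (h' : JetEq n X Y) (hA : ContDiffAt ℝ ∞ A (u 0)) (hu : ContDiffAt ℝ ∞ u 0)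
    (hv : ContDiffAt ℝ ∞ v 0) (hX : ContDiffAt ℝ ∞ X 0) (hY : ContDiffAt ℝ ∞ Y 0) :
    JetEq n (fun t => A (u t) (X t)) (fun t => A (v t) (Y t)) := by
  intro j hj
  have h0 : u 0 = v 0 := by simpa only [iteratedDeriv_zero] using h 0 (j.zero_le.trans_lt hj)
  exact (h.comp hA hu hv).clm_apply h' (ContDiffAt.comp (0 : ℝ) hA hu)
    (ContDiffAt.comp (0 : ℝ) (h0 ▸ hA) hv) hX hY j hj

theorem JetEq.deriv {n : ℕ} {u v : ℝ → F} (h : JetEq (n + 1) u v) :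
    JetEq n (deriv u) (deriv v) := fun j hj => by
  rw [← iteratedDeriv_succ', ← iteratedDeriv_succ']
  exact h _ (by omega)

theorem JetEq.of_deriv {n : ℕ} {u v : ℝ → F} (h0 : u 0 = v 0)
    (h : JetEq n (_root_.deriv u) (_root_.deriv v)) : JetEq (n + 1) u v := by
  rintro (_ | j) hj
  · simpa
  · rw [iteratedDeriv_succ', iteratedDeriv_succ']
    exact h _ (by omega)

/-- The curve `t ↦ (t ^ k / k!) w`, whose only nonzero derivative at `0` is the `k`-th one, `w`. -/
noncomputable def monomialCurve (k : ℕ) (w : F) (t : ℝ) : F := (t ^ k / (k.factorial : ℝ)) • w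

theorem contDiff_monomialCurve (k : ℕ) (w : F) : ContDiff ℝ ∞ (monomialCurve k w) := by
  unfold monomialCurve
  fun_prop

theorem deriv_monomialCurve_succ (k : ℕ) (w : F) :
    deriv (monomialCurve (k + 1) w) = monomialCurve k w := by
  ext t
  have : HasDerivAt (fun t : ℝ => t ^ (k + 1) / ((k + 1).factorial : ℝ))
      (((k + 1 : ℕ) : ℝ) * t ^ k / ((k + 1).factorial : ℝ)) t := by
    simpa using (hasDerivAt_pow (k + 1) t).div_const ((k + 1).factorial : ℝ)
  unfold monomialCurve
  rw [(this.smul_const w).deriv]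
  congr 1
  rw [Nat.factorial_succ]
  push_cast
  field_simp

theorem iteratedDeriv_monomialCurve (k j : ℕ) (w : F) :
    iteratedDeriv j (monomialCurve k w) 0 = if j = k then w else 0 := by
  induction k generalizing j with
  | zero =>
    have : monomialCurve 0 w = fun _ => w := by ext; simp [monomialCurve]
    rw [this]
    cases j <;> simp [iteratedDeriv_const]
  | succ k ih =>
    cases j with
    | zero => simp [monomialCurve]
    | succ j => rw [iteratedDeriv_succ', deriv_monomialCurve_succ, ih]; simp

/- Integrating `u' = A(u) X` order by order: the correction of `u` by a monomial of degree `n + 1`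
changes the left hand side in order `n` and leaves the right hand side unchanged up to that
order. -/
theorem exists_jetEq_deriv (n : ℕ) {e : E} {A : E → F →L[ℝ] E} (hA : ContDiffAt ℝ ∞ A e) {X : ℝ → F}
    (hX : ContDiff ℝ ∞ X) :
    ∃ u : ℝ → E, ContDiff ℝ ∞ u ∧ u 0 = e ∧ JetEq n (deriv u) (fun t => A (u t) (X t)) := by
  induction n with
  | zero => exact ⟨fun _ => e, contDiff_const, rfl, fun j hj => absurd hj j.not_lt_zero⟩
  | succ n ih =>
    obtain ⟨u, hu, rfl, h⟩ := ih
    set w := iteratedDeriv n (fun t => A (u t) (X t)) 0 - iteratedDeriv (n + 1) u 0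
    set v := u + monomialCurve (n + 1) w
    have hm := contDiff_monomialCurve (n + 1) w
    have hv : ContDiff ℝ ∞ v := hu.add hm
    have hder (j : ℕ) : iteratedDeriv j v 0 =
        iteratedDeriv j u 0 + if j = n + 1 then w else 0 := by
      rw [iteratedDeriv_add (contDiffAt_nat_of_infty hu.contDiffAt j)
        (contDiffAt_nat_of_infty hm.contDiffAt j), iteratedDeriv_monomialCurve]
    have huv : JetEq (n + 1) u v := fun j hj => by rw [hder, if_neg hj.ne, add_zero]
    have h0 : v 0 = u 0 := by simpa using (huv 0 n.succ_pos).symm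
    have hAuv : JetEq (n + 1) (fun t => A (u t) (X t)) (fun t => A (v t) (X t)) :=
      huv.comp_clm_apply (JetEq.refl _ X) hA hu.contDiffAt hv.contDiffAt hX.contDiffAt
        hX.contDiffAt
    refine ⟨v, hv, h0, fun j hj => ?_⟩
    rw [← hAuv j hj, ← iteratedDeriv_succ', hder]
    rcases (Nat.le_of_lt_succ hj).eq_or_lt with rfl | hjn
    · rw [if_pos rfl, add_sub_cancel]
    · rw [if_neg (by omega), add_zero, iteratedDeriv_succ', h j hjn]

end JetEq

section MaurerCartan

open Filter Topology

variable {E : Type*} [NormedAddCommGroup E] [NormedSpace ℝ E]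
  {G : Type*} [TopologicalSpace G] [ChartedSpace E G]

theorem contMDiffAt_extChartAt_symm [IsManifold 𝓘(ℝ, E) ∞ G] (x : G) :
    ContMDiffAt 𝓘(ℝ, E) 𝓘(ℝ, E) ∞ (extChartAt 𝓘(ℝ, E) x).symm (extChartAt 𝓘(ℝ, E) x x) :=
  (contMDiffOn_extChartAt_symm x).contMDiffAt (extChartAt_target_mem_nhds x)

theorem contDiffAt_extChartAt_comp_curve [IsManifold 𝓘(ℝ, E) ∞ G] (x : G) (c : SmoothCurve E G)
    {t : ℝ} (ht : c t ∈ (extChartAt 𝓘(ℝ, E) x).source) :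
    ContDiffAt ℝ ∞ (fun s => extChartAt 𝓘(ℝ, E) x (c s)) t :=
  ContMDiffAt.contDiffAt <| ContMDiffAt.comp t
    (contMDiffAt_extChartAt' (by rwa [extChartAt_source] at ht)) c.contMDiff.contMDiffAt

variable [Group G]

theorem rightLogDeriv_eq_tderiv (c : ℝ → G) (t : ℝ) : (rightLogDeriv c t : E) =
    tderiv 𝓘(ℝ, ℝ) 𝓘(ℝ, E) (fun s => c s * (c t)⁻¹) t (1 : ℝ) := rfl

/-- The right Maurer-Cartan form of `G` in the chart at `x`, which maps the velocity of a curve to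
its right logarithmic derivative. -/
noncomputable def chartMC (x : G) (w : E) : E →L[ℝ] E :=
  tderiv 𝓘(ℝ, E) 𝓘(ℝ, E)
    (fun z => (extChartAt 𝓘(ℝ, E) x).symm z * ((extChartAt 𝓘(ℝ, E) x).symm w)⁻¹) w

/-- The inverse of the right Maurer-Cartan form of `G` in the chart at `x`. -/
noncomputable def chartMCInv (x : G) (w : E) : E →L[ℝ] E :=
  tderiv 𝓘(ℝ, E) 𝓘(ℝ, E)
    (fun h : G => extChartAt 𝓘(ℝ, E) x (h * (extChartAt 𝓘(ℝ, E) x).symm w)) 1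

variable [LieGroup 𝓘(ℝ, E) ∞ G]

theorem contDiff_rightLogDeriv (c : SmoothCurve E G) :
    ContDiff ℝ ∞ (rightLogDeriv (c : ℝ → G) : ℝ → E) := by
  refine contDiff_iff_contDiffAt.2 fun t₀ => ContMDiffAt.contDiffAt ?_
  have hquot : ContMDiff (𝓘(ℝ, ℝ).prod 𝓘(ℝ, ℝ)) 𝓘(ℝ, E) ∞ fun p : ℝ × ℝ => c p.2 * (c p.1)⁻¹ :=
    (c.contMDiff.comp contMDiff_snd).mul (c.contMDiff.comp contMDiff_fst).inv
  have : ContMDiffAt 𝓘(ℝ, ℝ) 𝓘(ℝ, ℝ →L[ℝ] E) ∞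
      (fun t => tderiv 𝓘(ℝ, ℝ) 𝓘(ℝ, E) (fun s => c s * (c t)⁻¹) t) t₀ :=
    contMDiffAt_tderiv (f := fun t s => c s * (c t)⁻¹) (g := fun t => t) hquot.contMDiffAt
      contMDiffAt_id (.of_forall fun _ => tderiv_extChartAt_symm_model _ _)
      (.of_forall fun _ => tderiv_extChartAt_of_eq (by simp))
  exact this.clm_apply contMDiffAt_const

theorem contDiffAt_chartMC (x : G) : ContDiffAt ℝ ∞ (chartMC x) (extChartAt 𝓘(ℝ, E) x x) := by
  set φ := extChartAt 𝓘(ℝ, E) x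
  have hsymm : ContMDiffAt 𝓘(ℝ, E) 𝓘(ℝ, E) ∞ φ.symm (φ x) := contMDiffAt_extChartAt_symm x
  have hquot : ContMDiffAt (𝓘(ℝ, E).prod 𝓘(ℝ, E)) 𝓘(ℝ, E) ∞
      (fun p : E × E => φ.symm p.2 * (φ.symm p.1)⁻¹) (φ x, φ x) :=
    ContMDiffAt.mul (I := 𝓘(ℝ, E)) (ContMDiffAt.comp (φ x, φ x) hsymm contMDiffAt_snd)
      (ContMDiffAt.comp (φ x, φ x) hsymm contMDiffAt_fst).inv
  exact ContMDiffAt.contDiffAt <| contMDiffAt_tderiv (f := fun w z => φ.symm z * (φ.symm w)⁻¹)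
    (g := fun w => w) hquot contMDiffAt_id
    (.of_forall fun _ => tderiv_extChartAt_symm_model _ _)
    (.of_forall fun _ => tderiv_extChartAt_of_eq (by simp))

theorem contDiffAt_chartMCInv (x : G) :
    ContDiffAt ℝ ∞ (chartMCInv x) (extChartAt 𝓘(ℝ, E) x x) := by
  set φ := extChartAt 𝓘(ℝ, E) x
  have hsymm : ContMDiffAt 𝓘(ℝ, E) 𝓘(ℝ, E) ∞ φ.symm (φ x) := contMDiffAt_extChartAt_symm x
  have hmul : ContMDiffAt (𝓘(ℝ, E).prod 𝓘(ℝ, E)) 𝓘(ℝ, E) ∞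
      (fun p : E × G => φ (p.2 * φ.symm p.1)) (φ x, 1) :=
    ContMDiffAt.comp_of_eq (g := φ) (y := x) contMDiffAt_extChartAt
      (ContMDiffAt.mul (I := 𝓘(ℝ, E)) contMDiffAt_snd
        (ContMDiffAt.comp (φ x, (1 : G)) hsymm contMDiffAt_fst))
      ((one_mul _).trans (extChartAt_to_inv x))
  exact ContMDiffAt.contDiffAt <| contMDiffAt_tderiv (f := fun w h => φ (h * φ.symm w))
    (g := fun _ => (1 : G)) hmul contMDiffAt_const
    (.of_forall fun _ => tderiv_extChartAt_symm_of_eq rfl)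
    (.of_forall fun _ => tderiv_extChartAt_model _ _)

theorem mdifferentiableAt_extChartAt_symm_mul (x g : G) {w : E}
    (hw : w ∈ (extChartAt 𝓘(ℝ, E) x).target) :
    MDifferentiableAt 𝓘(ℝ, E) 𝓘(ℝ, E) (fun z => (extChartAt 𝓘(ℝ, E) x).symm z * g) w :=
  have : IsManifold 𝓘(ℝ, E) 1 G := IsManifold.of_le (n := ∞) ENat.LEInfty.out
  MDifferentiableAt.comp w (g := fun h : G => h * g) (mdifferentiableAt_mul_const _ _)
    (mdifferentiableAt_extChartAt_symm hw)

theorem mdifferentiableAt_extChartAt_comp_mul (x : G) {g : G}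
    (hg : g ∈ (extChartAt 𝓘(ℝ, E) x).source) :
    MDifferentiableAt 𝓘(ℝ, E) 𝓘(ℝ, E) (fun h : G => extChartAt 𝓘(ℝ, E) x (h * g)) 1 :=
  have : IsManifold 𝓘(ℝ, E) 1 G := IsManifold.of_le (n := ∞) ENat.LEInfty.out
  MDifferentiableAt.comp_of_eq (g := extChartAt 𝓘(ℝ, E) x) 1
    (mdifferentiableAt_extChartAt (by rwa [extChartAt_source] at hg))
    (mdifferentiableAt_mul_const _ _) (one_mul _)

theorem chartMC_comp_chartMCInv (x : G) {w : E} (hw : w ∈ (extChartAt 𝓘(ℝ, E) x).target) :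
    (chartMC x w).comp (chartMCInv x w) = ContinuousLinearMap.id ℝ E := by
  unfold chartMC chartMCInv
  set φ := extChartAt 𝓘(ℝ, E) x
  have hs : φ.symm w ∈ φ.source := φ.map_target hw
  rw [← tderiv_comp_of_eq (mdifferentiableAt_extChartAt_symm_mul x _ hw)
    (mdifferentiableAt_extChartAt_comp_mul x hs) (by rw [one_mul]; exact φ.right_inv hw),
    ← tderiv_id (I := 𝓘(ℝ, E)) (1 : G)]
  refine tderiv_congr ?_
  have hlim : Tendsto (fun h : G => h * φ.symm w) (𝓝 1) (𝓝 (φ.symm w)) := by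
    simpa only [one_mul] using
      (contMDiff_mul_right (I := 𝓘(ℝ, E)) (n := ∞) (a := φ.symm w)).continuous.tendsto 1
  filter_upwards [hlim.eventually_mem (extChartAt_source_mem_nhds' (I := 𝓘(ℝ, E)) hs)] with h hh
  rw [Function.comp_apply, φ.left_inv hh, mul_inv_cancel_right, id]

theorem rightLogDeriv_eq_chartMC (x : G) (c : SmoothCurve E G) {t : ℝ}
    (ht : c t ∈ (extChartAt 𝓘(ℝ, E) x).source) :
    rightLogDeriv (c : ℝ → G) t = chartMC x (extChartAt 𝓘(ℝ, E) x (c t))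
      (deriv (fun s => extChartAt 𝓘(ℝ, E) x (c s)) t) := by
  have hu := contDiffAt_extChartAt_comp_curve x c ht
  unfold chartMC
  set φ := extChartAt 𝓘(ℝ, E) x
  have hev : (fun s => c s * (c t)⁻¹) =ᶠ[𝓝 t]
      (fun z => φ.symm z * (φ.symm (φ (c t)))⁻¹) ∘ (fun s => φ (c s)) := by
    filter_upwards [c.contMDiff.continuous.continuousAt.eventually_mem
      (extChartAt_source_mem_nhds' (I := 𝓘(ℝ, E)) ht)] with s hs
    rw [Function.comp_apply, φ.left_inv hs, φ.left_inv ht]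
  rw [rightLogDeriv_eq_tderiv, tderiv_congr hev, tderiv_comp (f := fun s => φ (c s))
    (mdifferentiableAt_extChartAt_symm_mul x _ (φ.map_source ht))
    (hu.contMDiffAt.mdifferentiableAt (by simp)), tderiv_eq_fderiv, ← fderiv_apply_one_eq_deriv]
  rfl

theorem deriv_chart_eq_chartMCInv (x : G) (c : SmoothCurve E G) {t : ℝ}
    (ht : c t ∈ (extChartAt 𝓘(ℝ, E) x).source) :
    deriv (fun s => extChartAt 𝓘(ℝ, E) x (c s)) t =
      chartMCInv x (extChartAt 𝓘(ℝ, E) x (c t)) (rightLogDeriv (c : ℝ → G) t) := by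
  unfold chartMCInv
  set φ := extChartAt 𝓘(ℝ, E) x
  have hmul : (fun s => φ (c s)) = (fun h : G => φ (h * c t)) ∘ fun s => c s * (c t)⁻¹ :=
    funext fun s => congrArg φ (inv_mul_cancel_right _ _).symm
  have hquot : MDifferentiableAt 𝓘(ℝ, ℝ) 𝓘(ℝ, E) (fun s => c s * (c t)⁻¹) t :=
    (c.contMDiff.mul contMDiff_const).mdifferentiableAt (by simp)
  rw [φ.left_inv ht, rightLogDeriv_eq_tderiv, ← fderiv_apply_one_eq_deriv, ← tderiv_eq_fderiv, hmul]
  exact DFunLike.congr_fun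
    (tderiv_comp_of_eq (mdifferentiableAt_extChartAt_comp_mul x ht) hquot (mul_inv_cancel _)) 1

end MaurerCartan

section JetEquiv

open Filter Topology

variable {E : Type*} [NormedAddCommGroup E] [NormedSpace ℝ E]

theorem contDiffAt_deriv {u : ℝ → E} {t : ℝ} (hu : ContDiffAt ℝ ∞ u t) :
    ContDiffAt ℝ ∞ (deriv u) t := by
  rw [show deriv u = fun t => fderiv ℝ u t 1 from funext fun t => fderiv_apply_one_eq_deriv.symm]
  exact (hu.fderiv_right (m := ∞) (by simp)).clm_apply contDiffAt_const

theorem exists_contDiff_iteratedDeriv_eq {n : ℕ} (y : Fin n → E) :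
    ∃ X : ℝ → E, ContDiff ℝ ∞ X ∧ ∀ j : Fin n, iteratedDeriv j X 0 = y j := by
  have hmono (i : Fin n) := contDiff_monomialCurve (i : ℕ) (y i)
  refine ⟨fun t => ∑ i : Fin n, monomialCurve (i : ℕ) (y i) t,
    ContDiff.sum fun i _ => hmono i, fun j => ?_⟩
  rw [iteratedDeriv_fun_sum fun i _ => contDiffAt_nat_of_infty (hmono i).contDiffAt j]
  simp [iteratedDeriv_monomialCurve, ← Fin.ext_iff]

theorem exists_contDiff_eventuallyEq_mem {u : ℝ → E} (hu : ContDiff ℝ ∞ u) {s : Set E}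
    (hs : s ∈ 𝓝 (u 0)) : ∃ v : ℝ → E, ContDiff ℝ ∞ v ∧ v =ᶠ[𝓝 0] u ∧ ∀ t, v t ∈ s := by
  obtain ⟨r, hr, hball⟩ := Metric.mem_nhds_iff.1 hs
  obtain ⟨δ, hδ, hδu⟩ := Metric.continuousAt_iff.1 (hu.continuous.continuousAt (x := 0)) r hr
  let χ : ContDiffBump (0 : ℝ) := ⟨δ / 2, δ, by positivity, by linarith⟩
  refine ⟨fun t => u 0 + χ t • (u t - u 0),
    contDiff_const.add (χ.contDiff.smul (hu.sub contDiff_const)), ?_, fun t => hball ?_⟩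
  · filter_upwards [χ.eventuallyEq_one] with t ht
    rw [ht, Pi.one_apply, one_smul, add_sub_cancel]
  · rw [Metric.mem_ball, dist_eq_norm, add_sub_cancel_left, norm_smul, Real.norm_of_nonneg χ.nonneg]
    by_cases ht : dist t 0 < δ
    · calc χ t * ‖u t - u 0‖ ≤ 1 * ‖u t - u 0‖ := by gcongr; exact χ.le_one
        _ < r := by simpa only [one_mul, dist_eq_norm] using hδu ht
    · rwa [χ.zero_of_le_dist (not_lt.1 ht), zero_mul]

variable {G : Type*} [TopologicalSpace G] [ChartedSpace E G]

theorem sameJet_iff {n : ℕ} {c b : SmoothCurve E G} :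
    SameJet n c b ↔ c 0 = b 0 ∧ JetEq (n + 1) (fun t => extChartAt 𝓘(ℝ, E) (c 0) (c t))
      (fun t => extChartAt 𝓘(ℝ, E) (c 0) (b t)) :=
  and_congr_right fun _ => forall_congr' fun _ => imp_congr Nat.lt_succ_iff.symm Iff.rfl

theorem rightTriv_eq_iff [Group G] {n : ℕ} {c b : SmoothCurve E G} :
    rightTriv n c = rightTriv n b ↔
      c 0 = b 0 ∧ JetEq n (rightLogDeriv (c : ℝ → G) : ℝ → E) (rightLogDeriv (b : ℝ → G)) := by
  simp only [rightTriv, Prod.mk.injEq, funext_iff, JetEq, Fin.forall_iff]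

theorem eventually_mem_extChartAt_source (c : SmoothCurve E G) {x : G} (hc : c 0 = x) :
    ∀ᶠ t in 𝓝 (0 : ℝ), c t ∈ (extChartAt 𝓘(ℝ, E) x).source :=
  c.contMDiff.continuous.continuousAt.eventually_mem (hc ▸ extChartAt_source_mem_nhds _)

theorem exists_smoothCurve_eventuallyEq [IsManifold 𝓘(ℝ, E) ∞ G] (x : G) {u : ℝ → E}
    (hu : ContDiff ℝ ∞ u) (hu0 : u 0 = extChartAt 𝓘(ℝ, E) x x) :
    ∃ c : SmoothCurve E G, c 0 = x ∧ (fun t => extChartAt 𝓘(ℝ, E) x (c t)) =ᶠ[𝓝 0] u := by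
  obtain ⟨v, hv, hvu, hmem⟩ := exists_contDiff_eventuallyEq_mem hu
    (hu0 ▸ extChartAt_target_mem_nhds (I := 𝓘(ℝ, E)) x)
  have hc : ContMDiff 𝓘(ℝ, ℝ) 𝓘(ℝ, E) ∞ fun t => (extChartAt 𝓘(ℝ, E) x).symm (v t) :=
    contMDiffOn_univ.1 <| (contMDiffOn_extChartAt_symm x).comp hv.contMDiff.contMDiffOn
      fun t _ => hmem t
  refine ⟨⟨_, hc⟩, ?_, ?_⟩
  · exact (congrArg (extChartAt 𝓘(ℝ, E) x).symm (hvu.eq_of_nhds.trans hu0)).trans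
      (extChartAt_to_inv x)
  · filter_upwards [hvu] with t ht
    exact ((extChartAt 𝓘(ℝ, E) x).right_inv (hmem t)).trans ht

variable [Group G] [LieGroup 𝓘(ℝ, E) ∞ G]

theorem eventually_rightLogDeriv_eq (c : SmoothCurve E G) {x : G} (hc : c 0 = x) :
    (rightLogDeriv (c : ℝ → G) : ℝ → E) =ᶠ[𝓝 0] fun t =>
      chartMC x (extChartAt 𝓘(ℝ, E) x (c t)) (deriv (fun s => extChartAt 𝓘(ℝ, E) x (c s)) t) :=
  (eventually_mem_extChartAt_source c hc).mono fun _ => rightLogDeriv_eq_chartMC x c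

theorem eventually_deriv_chart_eq (c : SmoothCurve E G) {x : G} (hc : c 0 = x) :
    deriv (fun s => extChartAt 𝓘(ℝ, E) x (c s)) =ᶠ[𝓝 0] fun t =>
      chartMCInv x (extChartAt 𝓘(ℝ, E) x (c t)) (rightLogDeriv (c : ℝ → G) t) :=
  (eventually_mem_extChartAt_source c hc).mono fun _ => deriv_chart_eq_chartMCInv x c

theorem jetEq_rightLogDeriv_of_jetEq {n : ℕ} {x : G} {c b : SmoothCurve E G}
    (hc : c 0 = x) (hb : b 0 = x)
    (h : JetEq (n + 1) (fun t => extChartAt 𝓘(ℝ, E) x (c t))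
      (fun t => extChartAt 𝓘(ℝ, E) x (b t))) :
    JetEq n (rightLogDeriv (c : ℝ → G) : ℝ → E) (rightLogDeriv (b : ℝ → G)) := by
  have hu := contDiffAt_extChartAt_comp_curve x c
    (eventually_mem_extChartAt_source c hc).self_of_nhds
  have hv := contDiffAt_extChartAt_comp_curve x b
    (eventually_mem_extChartAt_source b hb).self_of_nhds
  have hMC : ContDiffAt ℝ ∞ (chartMC x : E → E →L[ℝ] E) (extChartAt 𝓘(ℝ, E) x (c 0)) :=
    hc.symm ▸ contDiffAt_chartMC x
  have h' : JetEq n (fun t => extChartAt 𝓘(ℝ, E) x (c t)) (fun t => extChartAt 𝓘(ℝ, E) x (b t)) :=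
    fun j hj => h j (hj.trans n.lt_succ_self)
  exact (JetEq.of_eventuallyEq (eventually_rightLogDeriv_eq c hc) n).trans <|
    (h'.comp_clm_apply h.deriv hMC hu hv (contDiffAt_deriv hu)
      (contDiffAt_deriv hv)).trans
    (JetEq.of_eventuallyEq (eventually_rightLogDeriv_eq b hb) n).symm

theorem jetEq_of_jetEq_rightLogDeriv {n : ℕ} {x : G} {c b : SmoothCurve E G} (hc : c 0 = x)
    (hb : b 0 = x) (h : JetEq n (rightLogDeriv (c : ℝ → G) : ℝ → E)
      (rightLogDeriv (b : ℝ → G))) :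
    JetEq (n + 1) (fun t => extChartAt 𝓘(ℝ, E) x (c t))
      (fun t => extChartAt 𝓘(ℝ, E) x (b t)) := by
  have hu := contDiffAt_extChartAt_comp_curve x c
    (eventually_mem_extChartAt_source c hc).self_of_nhds
  have hv := contDiffAt_extChartAt_comp_curve x b
    (eventually_mem_extChartAt_source b hb).self_of_nhds
  have hMCInv : ContDiffAt ℝ ∞ (chartMCInv x : E → E →L[ℝ] E) (extChartAt 𝓘(ℝ, E) x (c 0)) :=
    hc.symm ▸ contDiffAt_chartMCInv x
  induction n with
  | zero => exact JetEq.of_deriv (by rw [hc, hb]) fun j hj => absurd hj j.not_lt_zero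
  | succ n ih =>
    have huv := ih fun j hj => h j (hj.trans n.lt_succ_self)
    refine JetEq.of_deriv (by rw [hc, hb]) ?_
    exact (JetEq.of_eventuallyEq (eventually_deriv_chart_eq c hc) _).trans <|
      (huv.comp_clm_apply h hMCInv hu hv
        (contDiff_rightLogDeriv c).contDiffAt (contDiff_rightLogDeriv b).contDiffAt).trans
      (JetEq.of_eventuallyEq (eventually_deriv_chart_eq b hb) _).symm

theorem sameJet_iff_rightTriv_eq {n : ℕ} {c b : SmoothCurve E G} :
    SameJet n c b ↔ rightTriv n c = rightTriv n b := by
  rw [sameJet_iff, rightTriv_eq_iff]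
  exact and_congr_right fun h0 =>
    ⟨jetEq_rightLogDeriv_of_jetEq rfl h0.symm, jetEq_of_jetEq_rightLogDeriv rfl h0.symm⟩

theorem exists_smoothCurve_jetEq_rightLogDeriv (n : ℕ) (x : G) {X : ℝ → E}
    (hX : ContDiff ℝ ∞ X) :
    ∃ c : SmoothCurve E G, c 0 = x ∧ JetEq n (rightLogDeriv (c : ℝ → G)) X := by
  have hMC := contDiffAt_chartMC (E := E) x
  have hMCInv := contDiffAt_chartMCInv (E := E) x
  obtain ⟨u, hu, hu0, huX⟩ := exists_jetEq_deriv n hMCInv hX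
  obtain ⟨c, hc0, hc⟩ := exists_smoothCurve_eventuallyEq x hu hu0
  rw [← hu0] at hMC hMCInv
  have hδc : (rightLogDeriv (c : ℝ → G) : ℝ → E) =ᶠ[𝓝 0] fun t => chartMC x (u t) (deriv u t) := by
    filter_upwards [eventually_rightLogDeriv_eq c hc0, hc, hc.deriv] with t h h₁ h₂
    rw [h, h₁, h₂]
  have hinv : (fun t => chartMC x (u t) (chartMCInv x (u t) (X t))) =ᶠ[𝓝 0] X := by
    filter_upwards [hu.continuous.continuousAt.eventually_mem
      (hu0 ▸ extChartAt_target_mem_nhds (I := 𝓘(ℝ, E)) x)] with t ht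
    exact DFunLike.congr_fun (chartMC_comp_chartMCInv x ht) (X t)
  refine ⟨c, hc0, (JetEq.of_eventuallyEq hδc n).trans <| JetEq.trans ?_
    (JetEq.of_eventuallyEq hinv n)⟩
  exact (JetEq.refl n u).comp_clm_apply huX hMC hu.contDiffAt hu.contDiffAt
    (contDiffAt_deriv hu.contDiffAt)
    ((ContDiffAt.comp (0 : ℝ) hMCInv hu.contDiffAt).clm_apply hX.contDiffAt)

theorem rightTriv_surjective (n : ℕ) :
    Function.Surjective (rightTriv n : SmoothCurve E G → TrivJet E G n) := by
  rintro ⟨x, y⟩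
  obtain ⟨X, hX, hXy⟩ := exists_contDiff_iteratedDeriv_eq y
  obtain ⟨c, hc0, hc⟩ := exists_smoothCurve_jetEq_rightLogDeriv n x hX
  exact ⟨c, Prod.ext hc0 <| funext fun j => (hc j j.2).trans (hXy j)⟩

variable (E G) in
/-- The right trivialization `J^n G ≃ G × 𝔤^n`. -/
noncomputable def jetEquiv (n : ℕ) : Jet E G n ≃ TrivJet E G n :=
  Equiv.ofBijective
    (Quotient.lift (rightTriv n) fun _ _ h => sameJet_iff_rightTriv_eq.1 h)
    ⟨by rintro ⟨c⟩ ⟨b⟩ h; exact Quotient.sound (sameJet_iff_rightTriv_eq.2 h),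
      Quotient.lift_surjective _ _ (rightTriv_surjective n)⟩

theorem jetEquiv_jet (n : ℕ) (c : SmoothCurve E G) : jetEquiv E G n (jet n c) = rightTriv n c := rfl

end JetEquiv

section Leibniz

open Finset

variable {𝕜 : Type*} [NontriviallyNormedField 𝕜]
  {E : Type*} [NormedAddCommGroup E] [NormedSpace 𝕜 E]
  {F : Type*} [NormedAddCommGroup F] [NormedSpace 𝕜 F]
  {F' : Type*} [NormedAddCommGroup F'] [NormedSpace 𝕜 F']

theorem hasDerivAt_iteratedDeriv {u : 𝕜 → E} {n i : ℕ} (hu : ContDiff 𝕜 n u) (hi : i < n) (t : 𝕜) :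
    HasDerivAt (iteratedDeriv i u) (iteratedDeriv (i + 1) u t) t := by
  rw [iteratedDeriv_succ]
  exact (hu.differentiable_iteratedDeriv i (by exact_mod_cast hi) t).hasDerivAt

theorem iteratedDeriv_bilinear (B : E →L[𝕜] F →L[𝕜] F') {u : 𝕜 → E} {v : 𝕜 → F} (n : ℕ)
    (hu : ContDiff 𝕜 n u) (hv : ContDiff 𝕜 n v) (t : 𝕜) :
    iteratedDeriv n (fun s => B (u s) (v s)) t = ∑ ij ∈ antidiagonal n,
      n.choose ij.1 • B (iteratedDeriv ij.1 u t) (iteratedDeriv ij.2 v t) := by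
  induction n generalizing t with
  | zero => simp
  | succ n ih =>
    have hterm (ij : ℕ × ℕ) (h : ij ∈ antidiagonal n) :=
      (B.hasDerivAt_of_bilinear
        (fun _ => hasDerivAt_iteratedDeriv hu
          (Nat.lt_succ_of_le (HasAntidiagonal.antidiagonal.fst_le h)) t)
        (fun _ => hasDerivAt_iteratedDeriv hv
          (Nat.lt_succ_of_le (HasAntidiagonal.antidiagonal.snd_le h)) t)).fun_const_smul
            (n.choose ij.1)
    have hle : ((n : ℕ) : ℕ∞ω) ≤ (n + 1 : ℕ) := by exact_mod_cast n.le_succ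
    rw [iteratedDeriv_succ, funext (ih (hu.of_le hle) (hv.of_le hle)),
      (HasDerivAt.fun_sum hterm).deriv,
      sum_antidiagonal_choose_succ_nsmul fun i j => B (iteratedDeriv i u t) (iteratedDeriv j v t),
      ← sum_add_distrib]
    refine sum_congr rfl fun ij h => ?_
    rw [smul_add, Nat.choose_symm_of_eq_add (mem_antidiagonal.1 h).symm]

end Leibniz

section BellPolynomial

open Finset

section Ring

variable {R : Type*} [Semiring R]

/-- The noncommutative complete Bell polynomial: the sum over the partitions `λ_1|…|λ_ℓ` of an
`m`-element set, with blocks in increasing order of their greatest elements, of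
`A_{|λ_ℓ|} ⋯ A_{|λ_1|}`. It expresses the higher derivatives of a solution of `u' = A u`. -/
noncomputable def bellPoly (A : ℕ → R) (m : ℕ) : R :=
  ∑ p : OrderedFinpartition m, ((List.ofFn p.partSize).map A).reverse.prod

theorem bellPoly_zero (A : ℕ → R) : bellPoly A 0 = 1 := by
  rw [bellPoly, Fintype.sum_unique]
  rfl

theorem bellPoly_succ (A : ℕ → R) (m : ℕ) : bellPoly A (m + 1) =
    ∑ ij ∈ antidiagonal m, m.choose ij.1 • (A (ij.1 + 1) * bellPoly A ij.2) := by
  rw [bellPoly, sum_orderedFinpartition_succ_eq_sum_antidiagonal m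
    fun l => (l.map A).reverse.prod]
  refine sum_congr rfl fun ij _ => ?_
  simp only [bellPoly, mul_sum, List.map_append, List.map_cons, List.map_nil, List.reverse_append,
    List.reverse_singleton, List.singleton_append, List.prod_cons]

theorem bellPoly_congr {A B : ℕ → R} {m : ℕ} (h : ∀ i, 1 ≤ i → i ≤ m → A i = B i) :
    bellPoly A m = bellPoly B m := by
  induction m using Nat.strong_induction_on with
  | _ m ih =>
    cases m with
    | zero => simp only [bellPoly_zero]
    | succ m =>
      rw [bellPoly_succ, bellPoly_succ]
      refine sum_congr rfl fun ij hij => ?_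
      have hi := HasAntidiagonal.antidiagonal.fst_le hij
      have hj := HasAntidiagonal.antidiagonal.snd_le hij
      rw [h _ (Nat.le_add_left 1 _) (Nat.succ_le_succ hi),
        ih _ (Nat.lt_succ_of_le hj) fun i h1 h2 => h i h1 (h2.trans (Nat.le_succ_of_le hj))]

theorem bellPoly_zero_left {m : ℕ} (hm : m ≠ 0) : bellPoly (0 : ℕ → R) m = 0 := by
  obtain ⟨m, rfl⟩ := Nat.exists_eq_succ_of_ne_zero hm
  simp [bellPoly_succ]

end Ring

section NormedAlgebra

variable {𝕜 : Type*} [NontriviallyNormedField 𝕜]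
  {V : Type*} [NormedAddCommGroup V] [NormedSpace 𝕜 V]
  {R : Type*} [NormedRing R] [NormedAlgebra 𝕜 R]

theorem contDiff_bellPoly {n : ℕ∞ω} {A : ℕ → V → R} (hA : ∀ i, ContDiff 𝕜 n (A i)) (m : ℕ) :
    ContDiff 𝕜 n (fun x => bellPoly (A · x) m) := by
  induction m using Nat.strong_induction_on with
  | _ m ih =>
    cases m with
    | zero => simpa only [bellPoly_zero] using contDiff_const
    | succ m =>
      simp only [bellPoly_succ]
      exact ContDiff.sum fun ij hij =>
        ((hA _).mul (ih _
          (Nat.lt_succ_of_le (HasAntidiagonal.antidiagonal.snd_le hij)))).const_smul _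

theorem hasFDerivAt_bellPoly_of_eq_zero {A : ℕ → V → R} {A' : ℕ → V →L[𝕜] R} {x : V}
    (hA : ∀ i, ContDiff 𝕜 1 (A i)) (hA' : ∀ i, HasFDerivAt (A i) (A' i) x)
    (hx : ∀ i, A i x = 0) {m : ℕ} (hm : m ≠ 0) :
    HasFDerivAt (fun y => bellPoly (A · y) m) (A' m) x := by
  obtain ⟨m, rfl⟩ := Nat.exists_eq_succ_of_ne_zero hm
  have hbell (j : ℕ) := ((contDiff_bellPoly hA j).differentiable one_ne_zero x).hasFDerivAt
  have hsum := HasFDerivAt.fun_sum (u := antidiagonal m) fun ij _ =>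
    ((hA' (ij.1 + 1)).fun_mul' (hbell ij.2)).fun_const_smul (m.choose ij.1)
  simp only [bellPoly_succ]
  refine hsum.congr_fderiv ((sum_eq_single (m, 0) ?_ ?_).trans ?_)
  · rintro ⟨i, j⟩ hij hne
    have hj : j ≠ 0 := by
      rintro rfl
      exact hne (Prod.ext (mem_antidiagonal.1 hij) rfl)
    have hbell0 : bellPoly (A · x) j = 0 := by rw [funext hx]; exact bellPoly_zero_left hj
    ext v
    simp [hx (i + 1), hbell0]
  · simp
  · ext v
    simp [hx, bellPoly_zero]

end NormedAlgebra

theorem iteratedDeriv_eq_bellPoly_mul {𝕜 : Type*} [NontriviallyNormedField 𝕜]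
    {R : Type*} [NormedRing R] [NormedAlgebra 𝕜 R] {a u : 𝕜 → R}
    (ha : ContDiff 𝕜 ∞ a) (hu : ContDiff 𝕜 ∞ u) (h : ∀ t, HasDerivAt u (a t * u t) t)
    (m : ℕ) (t : 𝕜) :
    iteratedDeriv m u t = bellPoly (fun i => iteratedDeriv (i - 1) a t) m * u t := by
  induction m using Nat.strong_induction_on with
  | _ m ih =>
    cases m with
    | zero => simp [bellPoly_zero]
    | succ m =>
      have hm : ((m : ℕ) : ℕ∞ω) ≤ ∞ := by exact_mod_cast le_top
      have hu' : deriv u = fun s => ContinuousLinearMap.mul 𝕜 R (a s) (u s) :=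
        funext fun s => (h s).deriv
      rw [iteratedDeriv_succ', hu', iteratedDeriv_bilinear _ m (ha.of_le hm) (hu.of_le hm),
        bellPoly_succ, sum_mul]
      refine sum_congr rfl fun ij hij => ?_
      rw [ih _ (Nat.lt_succ_of_le (HasAntidiagonal.antidiagonal.snd_le hij)),
        ContinuousLinearMap.mul_apply',
        Nat.add_sub_cancel, smul_mul_assoc, mul_assoc]

end BellPolynomial

section LogDerivMul

variable {E : Type*} [NormedAddCommGroup E] [NormedSpace ℝ E]
  {G : Type*} [TopologicalSpace G] [ChartedSpace E G] [Group G] [LieGroup 𝓘(ℝ, E) ∞ G]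

theorem tderiv_mul_one_one :
    tderiv (𝓘(ℝ, E).prod 𝓘(ℝ, E)) 𝓘(ℝ, E) (fun p : G × G => p.1 * p.2) (1, 1) =
      ContinuousLinearMap.fst ℝ E E + ContinuousLinearMap.snd ℝ E E := by
  have hμ : MDifferentiableAt (𝓘(ℝ, E).prod 𝓘(ℝ, E)) 𝓘(ℝ, E) (fun p : G × G => p.1 * p.2) (1, 1) :=
    (contMDiff_mul 𝓘(ℝ, E) ∞).mdifferentiableAt (by simp)
  have hleft : (fun g : G => g * 1) = id := funext mul_one
  have hright : (fun g : G => 1 * g) = id := funext one_mul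
  refine ContinuousLinearMap.ext fun v => (mfderiv_prod_eq_add_apply (v := v) hμ).trans ?_
  change tderiv 𝓘(ℝ, E) 𝓘(ℝ, E) (fun g : G => g * 1) 1 v.1 +
    tderiv 𝓘(ℝ, E) 𝓘(ℝ, E) (fun g : G => 1 * g) 1 v.2 = v.1 + v.2
  rw [hleft, hright, tderiv_id]
  rfl

theorem tderiv_mul_of_eq_one {EM : Type*} [NormedAddCommGroup EM] [NormedSpace ℝ EM]
    {HM : Type*} [TopologicalSpace HM] {I : ModelWithCorners ℝ EM HM}
    {M : Type*} [TopologicalSpace M] [ChartedSpace HM M] {p q : M → G} {x : M}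
    (hp : MDifferentiableAt I 𝓘(ℝ, E) p x) (hq : MDifferentiableAt I 𝓘(ℝ, E) q x)
    (hp1 : p x = 1) (hq1 : q x = 1) :
    tderiv I 𝓘(ℝ, E) (fun y => p y * q y) x = tderiv I 𝓘(ℝ, E) p x + tderiv I 𝓘(ℝ, E) q x := by
  have hprod : tderiv I (𝓘(ℝ, E).prod 𝓘(ℝ, E)) (fun y => (p y, q y)) x =
      (tderiv I 𝓘(ℝ, E) p x).prod (tderiv I 𝓘(ℝ, E) q x) := mfderiv_prodMk hp hq
  refine (tderiv_comp_of_eq (g := fun p : G × G => p.1 * p.2) (y := (1, 1))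
    ((contMDiff_mul 𝓘(ℝ, E) ∞).mdifferentiableAt (by simp)) (hp.prodMk hq)
    (Prod.ext hp1 hq1)).trans ?_
  rw [tderiv_mul_one_one, hprod]
  rfl

theorem mdifferentiableAt_mul_const_curve (c : SmoothCurve E G) (g : G) (t : ℝ) :
    MDifferentiableAt 𝓘(ℝ, ℝ) 𝓘(ℝ, E) (fun s => c s * g) t :=
  (c.contMDiff.mul contMDiff_const).mdifferentiableAt (by simp)

theorem rightLogDeriv_mul (c b : SmoothCurve E G) (t : ℝ) :
    (rightLogDeriv (c * b : SmoothCurve E G) t : E) =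
      rightLogDeriv c t + Ad E (c t) (rightLogDeriv b t) := by
  have hb := mdifferentiableAt_mul_const_curve b (b t)⁻¹ t
  have hconj := mdifferentiableAt_conj (E := E) (c t) 1
  have hquot : (fun s => (c * b : SmoothCurve E G) s * ((c * b : SmoothCurve E G) t)⁻¹) =
      fun s => c s * (c t)⁻¹ * ((fun h : G => c t * h * (c t)⁻¹) ∘ fun s => b s * (b t)⁻¹) s := by
    ext s
    simp only [ContMDiffMap.coe_mul, Pi.mul_apply, Function.comp_apply]
    group
  rw [rightLogDeriv_eq_tderiv, hquot, tderiv_mul_of_eq_one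
    (mdifferentiableAt_mul_const_curve c _ t)
    (MDifferentiableAt.comp_of_eq t hconj hb (mul_inv_cancel _)) (mul_inv_cancel _) (by simp),
    tderiv_comp_of_eq hconj hb (mul_inv_cancel _)]
  rfl

omit [LieGroup 𝓘(ℝ, E) ∞ G] in
theorem rightLogDeriv_one : (rightLogDeriv (1 : ℝ → G) : ℝ → E) = 0 := by
  ext t
  have hquot : (fun s : ℝ => (1 : ℝ → G) s * ((1 : ℝ → G) t)⁻¹) = fun _ => 1 :=
    funext fun _ => mul_inv_cancel 1
  rw [rightLogDeriv_eq_tderiv, hquot, tderiv_const]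
  rfl

theorem hasDerivAt_Ad (c : SmoothCurve E G) (t : ℝ) :
    HasDerivAt (fun s => Ad E (c s)) (adL E G (rightLogDeriv c t) * Ad E (c t)) t := by
  have hc := mdifferentiableAt_mul_const_curve c (c t)⁻¹ t
  have hAd : MDifferentiableAt 𝓘(ℝ, E) 𝓘(ℝ, E →L[ℝ] E) (Ad E : G → E →L[ℝ] E) 1 :=
    contMDiff_Ad.mdifferentiableAt (by simp)
  have hdiff : DifferentiableAt ℝ (fun s => Ad E (c s * (c t)⁻¹)) t :=
    (MDifferentiableAt.comp_of_eq t hAd hc (mul_inv_cancel _)).differentiableAt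
  have hderiv : deriv (fun s => Ad E (c s * (c t)⁻¹)) t = adL E G (rightLogDeriv c t) := by
    rw [← fderiv_apply_one_eq_deriv, ← tderiv_eq_fderiv]
    exact DFunLike.congr_fun
      (tderiv_comp_of_eq (g := (Ad E : G → E →L[ℝ] E)) hAd hc (mul_inv_cancel _)) 1
  have hsplit : (fun s => Ad E (c s)) = fun s => Ad E (c s * (c t)⁻¹) * Ad E (c t) := by
    funext s
    rw [ContinuousLinearMap.mul_def, ← Ad_mul, inv_mul_cancel_right]
  rw [hsplit, ← hderiv]
  exact hdiff.hasDerivAt.mul_const _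

theorem contDiff_Ad_curve (c : SmoothCurve E G) : ContDiff ℝ ∞ fun s => Ad E (c s) :=
  (contMDiff_Ad.comp c.contMDiff).contDiff

end LogDerivMul

section JetAd

open Finset

variable {E : Type*} [NormedAddCommGroup E]

theorem jetComp_of_mem {n : ℕ} (x : Fin n → E) {i : ℕ} (h : 1 ≤ i ∧ i ≤ n) :
    jetComp x i = x ⟨i - 1, by omega⟩ := dif_pos h

theorem jetComp_of_not_mem {n : ℕ} (x : Fin n → E) {i : ℕ} (h : ¬(1 ≤ i ∧ i ≤ n)) :
    jetComp x i = 0 := dif_neg h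

theorem jetComp_zero_index {n : ℕ} (x : Fin n → E) : jetComp x 0 = 0 :=
  jetComp_of_not_mem x (by omega)

theorem jetComp_zero (n i : ℕ) : jetComp (0 : Fin n → E) i = 0 := by
  unfold jetComp
  split_ifs <;> rfl

theorem jetComp_snoc_of_le {k i : ℕ} (y : Fin k → E) (v : E) (hi : i ≤ k) :
    jetComp (Fin.snoc y v : Fin (k + 1) → E) i = jetComp y i := by
  rcases i.eq_zero_or_pos with rfl | hi'
  · rw [jetComp_zero_index, jetComp_zero_index]
  · rw [jetComp_of_mem _ ⟨hi', hi.trans k.le_succ⟩, jetComp_of_mem _ ⟨hi', hi⟩]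
    exact Fin.snoc_castSucc (α := fun _ => E) v y ⟨i - 1, by omega⟩

theorem jetComp_snoc_last {k : ℕ} (y : Fin k → E) (v : E) :
    jetComp (Fin.snoc y v : Fin (k + 1) → E) (k + 1) = v :=
  (jetComp_of_mem _ (by omega)).trans (Fin.snoc_last (α := fun _ => E) v y)

theorem jetComp_snoc_zero {k i : ℕ} (y : Fin k → E) (hi : i ≤ k + 1) :
    jetComp (Fin.snoc y 0 : Fin (k + 1) → E) i = jetComp y i := by
  rcases hi.eq_or_lt with rfl | hi
  · rw [jetComp_snoc_last, jetComp_of_not_mem y (by omega)]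
  · exact jetComp_snoc_of_le y 0 (Nat.le_of_lt_succ hi)

variable [NormedSpace ℝ E]

/-- `jetComp`, as a continuous linear map. -/
noncomputable def jetCompL (n i : ℕ) : (Fin n → E) →L[ℝ] E :=
  if h : 1 ≤ i ∧ i ≤ n then ContinuousLinearMap.proj ⟨i - 1, by omega⟩ else 0

theorem jetCompL_apply {n i : ℕ} (x : Fin n → E) : jetCompL n i x = jetComp x i := by
  unfold jetCompL jetComp
  split_ifs <;> rfl

variable {G : Type*} [TopologicalSpace G] [ChartedSpace E G] [Group G]

variable (G) in
/-- The operator `∑_λ ad_{x_{|λ_ℓ|}} ⋯ ad_{x_{|λ_1|}}`, `λ` ranging over the partitions of a set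
with `j` elements. If `x` is the jet of `δʳc`, then the `j`-th derivative of `Ad_c` at `0` is
`bellAd G x j * Ad_{c(0)}`. -/
noncomputable def bellAd {n : ℕ} (x : Fin n → E) (j : ℕ) : E →L[ℝ] E :=
  bellPoly (fun i => adL E G (jetComp x i)) j

theorem bellAd_zero_index {n : ℕ} (x : Fin n → E) : bellAd G x 0 = 1 := bellPoly_zero _

theorem bellAd_zero {n j : ℕ} (hj : j ≠ 0) : bellAd G (0 : Fin n → E) j = 0 := by
  simp only [bellAd, jetComp_zero, map_zero]
  exact bellPoly_zero_left hj

theorem contDiff_bellAd (n j : ℕ) : ContDiff ℝ ∞ fun x : Fin n → E => bellAd G x j := by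
  simp only [bellAd, ← jetCompL_apply]
  exact contDiff_bellPoly (A := fun i x => adL E G (jetCompL n i x))
    (fun i => ((adL E G).comp (jetCompL n i)).contDiff) j

theorem fderiv_bellAd_zero (n j : ℕ) (X : Fin n → E) :
    fderiv ℝ (fun x : Fin n → E => bellAd G x j) 0 X = adL E G (jetComp X j) := by
  rcases eq_or_ne j 0 with rfl | hj
  · simp only [bellAd_zero_index, fderiv_fun_const, jetComp_zero_index, map_zero]
    rfl
  · have := hasFDerivAt_bellPoly_of_eq_zero (A := fun i x => adL E G (jetCompL n i x))
      (fun i => ((adL E G).comp (jetCompL n i)).contDiff)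
      (fun i => ((adL E G).comp (jetCompL n i)).hasFDerivAt) (x := 0) (by simp) hj
    simp only [jetCompL_apply] at this
    exact (DFunLike.congr_fun this.fderiv X).trans (by simp [jetCompL_apply])

/-- If `a` is the right trivialized `k`-jet of a curve `c`, then `jetAd a` maps the derivatives at
`0` up to order `k` of a curve `y` in `𝔤` to the `k`-th derivative of `Ad_c y` at `0`. -/
noncomputable def jetAd {k : ℕ} (a : TrivJet E G k) : (Fin (k + 1) → E) →L[ℝ] E :=
  ∑ ij ∈ antidiagonal k,
    k.choose ij.1 • (bellAd G a.2 ij.2 * Ad E a.1).comp (jetCompL (k + 1) (ij.1 + 1))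

theorem jetAd_apply {k : ℕ} (a : TrivJet E G k) (y : Fin (k + 1) → E) :
    jetAd a y = ∑ ij ∈ antidiagonal k,
      k.choose ij.1 • bellAd G a.2 ij.2 (Ad E a.1 (jetComp y (ij.1 + 1))) := by
  simp [jetAd, jetCompL_apply]

theorem jetAd_mk_zero {k : ℕ} (g : G) (y : Fin (k + 1) → E) :
    jetAd (g, 0) y = Ad E g (y (Fin.last k)) := by
  rw [jetAd_apply, sum_eq_single_of_mem (k, 0) (by simp)]
  · rw [Nat.choose_self, one_smul, bellAd_zero_index, jetComp_of_mem y (by omega)]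
    rfl
  · rintro ⟨i, j⟩ hij hne
    have hj : j ≠ 0 := by
      rw [HasAntidiagonal.mem_antidiagonal] at hij
      rw [Ne, Prod.mk.injEq] at hne
      omega
    rw [bellAd_zero hj, zero_apply, smul_zero]

theorem jetAd_snoc_zero {k : ℕ} (a : TrivJet E G k) (v : E) :
    jetAd a (Fin.snoc 0 v) = Ad E a.1 v := by
  rw [jetAd_apply, sum_eq_single_of_mem (k, 0) (by simp)]
  · simp [jetComp_snoc_last, bellAd_zero_index]
  · rintro ⟨i, j⟩ hij hne
    have hi : i + 1 ≤ k := by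
      rw [HasAntidiagonal.mem_antidiagonal] at hij
      rw [Ne, Prod.mk.injEq] at hne
      omega
    rw [jetComp_snoc_of_le _ _ hi, jetComp_zero, map_zero, map_zero, smul_zero]

theorem jetAd_snoc {k : ℕ} (a : TrivJet E G k) (y : Fin k → E) (v : E) :
    jetAd a (Fin.snoc y v) = Ad E a.1 v + jetAd a (Fin.snoc y 0) := by
  have hsplit : (Fin.snoc y v : Fin (k + 1) → E) = Fin.snoc 0 v + Fin.snoc y 0 := by
    ext i
    refine Fin.lastCases ?_ (fun i => ?_) i <;> simp
  rw [hsplit, map_add, jetAd_snoc_zero]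

variable [LieGroup 𝓘(ℝ, E) ∞ G]

theorem cocycleTerm_concat [CompleteSpace E] {k : ℕ} (a b : TrivJet E G k) (l : List ℕ) (r : ℕ) :
    cocycleTerm a b (l ++ [r]) =
      (l.map fun i => adL E G (jetComp a.2 i)).reverse.prod (Ad E a.1 (jetComp b.2 r)) := by
  rw [cocycleTerm, List.dropLast_concat, List.getLastD_concat]
  generalize Ad E a.1 (jetComp b.2 r) = z
  induction l generalizing z with
  | nil => rfl
  | cons i l ih => simp [ih, adL_apply]

theorem groupCocycle_eq_jetAd [CompleteSpace E] {k : ℕ} (a b : TrivJet E G k) :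
    groupCocycle k a b = jetAd a (Fin.snoc b.2 0) := by
  have hsum := sum_orderedFinpartition_succ_eq_sum_antidiagonal k
    fun l => if l.length ≠ 1 then cocycleTerm a b l else 0
  simp only [List.length_ofFn, ← sum_filter] at hsum
  rw [groupCocycle, hsum, jetAd_apply]
  refine sum_congr rfl fun ⟨i, j⟩ hij => congrArg _ ?_
  rw [HasAntidiagonal.mem_antidiagonal] at hij
  dsimp only at hij ⊢
  rw [jetComp_snoc_zero _ (by omega)]
  rcases eq_or_ne j 0 with rfl | hj
  · rw [jetComp_of_not_mem b.2 (by omega), map_zero, map_zero, filter_false_of_mem, sum_empty]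
    intro p _
    simp [p.length_le.antisymm p.length.zero_le]
  · rw [filter_true_of_mem fun p _ => by simpa using (p.length_pos hj.bot_lt).ne']
    simp only [cocycleTerm_concat, bellAd, bellPoly, _root_.sum_apply]

end JetAd

section JetGroup

open Finset

theorem iteratedDeriv_clm_comp {𝕜 E F : Type*} [NontriviallyNormedField 𝕜] [NormedAddCommGroup E]
    [NormedSpace 𝕜 E] [NormedAddCommGroup F] [NormedSpace 𝕜 F] (L : E →L[𝕜] F) {n : ℕ} {u : 𝕜 → E}
    {t : 𝕜} (hu : ContDiffAt 𝕜 n u t) :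
    iteratedDeriv n (fun s => L (u s)) t = L (iteratedDeriv n u t) := by
  simp only [iteratedDeriv]
  rw [show (fun s => L (u s)) = L ∘ u from rfl, L.iteratedFDeriv_comp_left hu le_rfl]
  rfl

theorem trivJet_ext {E G : Type*} {k : ℕ} {a b : TrivJet E G (k + 1)}
    (h : truncate k a = truncate k b)
    (hlast : a.2 (Fin.last k) = b.2 (Fin.last k)) : a = b := by
  obtain ⟨hfst, hinit⟩ := Prod.ext_iff.1 h
  exact Prod.ext hfst (funext fun i => i.lastCases hlast (congrFun hinit))

variable {E : Type*} [NormedAddCommGroup E] [NormedSpace ℝ E]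
  {G : Type*} [TopologicalSpace G] [ChartedSpace E G] [Group G]

theorem jetComp_rightTriv {n : ℕ} (c : SmoothCurve E G) {i : ℕ} (h : 1 ≤ i ∧ i ≤ n) :
    jetComp (rightTriv n c).2 i = iteratedDeriv (i - 1) (rightLogDeriv (c : ℝ → G)) 0 :=
  jetComp_of_mem _ h

theorem truncate_rightTriv (k : ℕ) (c : SmoothCurve E G) :
    truncate k (rightTriv (k + 1) c) = rightTriv k c := rfl

theorem groupCocycle_eq_sum_composition (k : ℕ) (a b : TrivJet E G k) : groupCocycle k a b =
    ∑ i : Composition (k + 1) with i.length ≠ 1,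
      partitionNumber i.blocks • cocycleTerm a b i.blocks := by
  have hsum := sum_orderedFinpartition (k + 1) fun l =>
    if l.length ≠ 1 then cocycleTerm a b l else 0
  simp only [List.length_ofFn, Composition.blocks_length, smul_ite, smul_zero] at hsum
  rw [groupCocycle, sum_filter, hsum, sum_filter]

theorem groupCocycle_eq_sum_sum (k : ℕ) (a b : TrivJet E G k) : groupCocycle k a b =
    ∑ l ∈ Icc 2 (k + 1), ∑ i : Composition (k + 1) with i.length = l,
      partitionNumber i.blocks • cocycleTerm a b i.blocks := by
  have hlength : ∀ i : Composition (k + 1), i.length ≠ 1 ↔ i.length ∈ Icc 2 (k + 1) := fun i => by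
    have := i.length_le
    have := i.length_pos_of_pos k.succ_pos
    rw [mem_Icc]
    omega
  simp only [groupCocycle_eq_sum_composition, hlength]
  rw [← sum_fiberwise_of_maps_to (g := fun i : Composition (k + 1) => i.length)
    fun i hi => (mem_filter.1 hi).2]
  refine sum_congr rfl fun l hl => sum_congr ?_ fun _ _ => rfl
  rw [filter_filter]
  exact filter_congr fun i _ => and_iff_right_of_imp fun h => h ▸ hl

variable [LieGroup 𝓘(ℝ, E) ∞ G]

theorem iteratedDeriv_Ad (m : ℕ) (c : SmoothCurve E G) :
    iteratedDeriv m (fun t => Ad E (c t)) 0 =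
      bellPoly (fun i => adL E G (iteratedDeriv (i - 1) (rightLogDeriv c) 0)) m * Ad E (c 0) := by
  rw [iteratedDeriv_eq_bellPoly_mul ((adL E G).contDiff.comp (contDiff_rightLogDeriv c))
    (contDiff_Ad_curve c) (hasDerivAt_Ad c) m 0]
  exact congrArg (· * _) (bellPoly_congr fun i _ _ =>
    iteratedDeriv_clm_comp _ (contDiffAt_nat_of_infty (contDiff_rightLogDeriv c).contDiffAt _))

theorem iteratedDeriv_Ad_rightLogDeriv (k : ℕ) (c b : SmoothCurve E G) :
    iteratedDeriv k (fun t => Ad E (c t) (rightLogDeriv b t)) 0 =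
      jetAd (rightTriv k c) (rightTriv (k + 1) b).2 := by
  have h := iteratedDeriv_bilinear (ContinuousLinearMap.apply ℝ E) k
    ((contDiff_rightLogDeriv b).of_le (by exact_mod_cast le_top))
    ((contDiff_Ad_curve c).of_le (by exact_mod_cast le_top)) 0
  rw [jetAd_apply]
  refine h.trans (sum_congr rfl fun ⟨i, j⟩ hij => congrArg _ ?_)
  rw [HasAntidiagonal.mem_antidiagonal] at hij
  have hbell : bellAd G (rightTriv k c).2 j =
      bellPoly (fun i => adL E G (iteratedDeriv (i - 1) (rightLogDeriv c) 0)) j :=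
    bellPoly_congr fun i hi hij => congrArg _ (jetComp_rightTriv c (by omega))
  rw [jetComp_rightTriv b (by omega), iteratedDeriv_Ad, hbell]
  rfl

theorem iteratedDeriv_rightLogDeriv_mul (k : ℕ) (c b : SmoothCurve E G) :
    iteratedDeriv k (rightLogDeriv (c * b : SmoothCurve E G)) 0 =
      iteratedDeriv k (rightLogDeriv c) 0 + jetAd (rightTriv k c) (rightTriv (k + 1) b).2 := by
  have hmul : (rightLogDeriv (c * b : SmoothCurve E G) : ℝ → E) =
      rightLogDeriv c + fun s => Ad E (c s) (rightLogDeriv b s) :=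
    funext fun t => rightLogDeriv_mul c b t
  have hb : ContDiff ℝ ∞ fun s => Ad E (c s) (rightLogDeriv b s) :=
    (contDiff_Ad_curve c).clm_apply (contDiff_rightLogDeriv b)
  rw [hmul, iteratedDeriv_add (contDiffAt_nat_of_infty (contDiff_rightLogDeriv c).contDiffAt k)
    (contDiffAt_nat_of_infty hb.contDiffAt k), iteratedDeriv_Ad_rightLogDeriv]

/-- The group structure on `G × 𝔤^n` transported from the jet group `J^n G`. -/
noncomputable abbrev trivJetGroup (n : ℕ) : Group (TrivJet E G n) := (jetEquiv E G n).symm.group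

attribute [local instance] trivJetGroup

theorem rightTriv_mul (n : ℕ) (c b : SmoothCurve E G) :
    rightTriv n (c * b) = rightTriv n c * rightTriv n b := by
  change _ = jetEquiv E G n ((jetEquiv E G n).symm (rightTriv n c) *
    (jetEquiv E G n).symm (rightTriv n b))
  simp only [← jetEquiv_jet, Equiv.symm_apply_apply]
  rfl

theorem rightTriv_one (n : ℕ) : rightTriv n (1 : SmoothCurve E G) = 1 := rfl

theorem trivJet_one (n : ℕ) : (1 : TrivJet E G n) = ((1 : G), (0 : Fin n → E)) := by
  rw [← rightTriv_one]
  refine Prod.ext rfl (funext fun j => ?_)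
  change iteratedDeriv j (rightLogDeriv (1 : ℝ → G)) 0 = 0
  rw [rightLogDeriv_one]
  simp

theorem trivJet_mul_fst (n : ℕ) (a b : TrivJet E G n) : (a * b).1 = a.1 * b.1 := by
  obtain ⟨c, rfl⟩ := rightTriv_surjective n a
  obtain ⟨d, rfl⟩ := rightTriv_surjective n b
  rw [← rightTriv_mul]
  rfl

theorem truncate_mul (k : ℕ) (a b : TrivJet E G (k + 1)) :
    truncate k (a * b) = truncate k a * truncate k b := by
  obtain ⟨c, rfl⟩ := rightTriv_surjective _ a
  obtain ⟨d, rfl⟩ := rightTriv_surjective _ b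
  simp only [← rightTriv_mul, truncate_rightTriv]

theorem truncate_one (k : ℕ) : truncate k (1 : TrivJet E G (k + 1)) = 1 := by
  rw [← rightTriv_one, truncate_rightTriv, rightTriv_one]

theorem truncate_inv (k : ℕ) (a : TrivJet E G (k + 1)) : truncate k a⁻¹ = (truncate k a)⁻¹ :=
  eq_inv_of_mul_eq_one_left (by rw [← truncate_mul, inv_mul_cancel, truncate_one])

theorem trivJet_mul_last (k : ℕ) (a b : TrivJet E G (k + 1)) :
    (a * b).2 (Fin.last k) = a.2 (Fin.last k) + jetAd (truncate k a) b.2 := by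
  obtain ⟨c, rfl⟩ := rightTriv_surjective _ a
  obtain ⟨d, rfl⟩ := rightTriv_surjective _ b
  rw [← rightTriv_mul]
  exact iteratedDeriv_rightLogDeriv_mul k c d

end JetGroup

section JetLieGroup

section

variable {E G : Type*} [NormedAddCommGroup E]

theorem truncate_zeroSection (k : ℕ) (a : TrivJet E G k) : truncate k (zeroSection k a) = a := by
  simp only [truncate, zeroSection, Fin.init_snoc]

theorem zeroSection_last (k : ℕ) (a : TrivJet E G k) : (zeroSection k a).2 (Fin.last k) = 0 :=
  Fin.snoc_last (α := fun _ => E) 0 a.2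

variable [Group G]

theorem truncate_topInclusion_eq (k : ℕ) (v : E) :
    truncate k (topInclusion G k v) = ((1 : G), (0 : Fin k → E)) := by
  simp only [truncate, topInclusion, Fin.init_snoc]

theorem topInclusion_last (k : ℕ) (v : E) : (topInclusion G k v).2 (Fin.last k) = v :=
  Fin.snoc_last (α := fun _ => E) v 0

end

variable {E : Type*} [NormedAddCommGroup E] [NormedSpace ℝ E]
  {G : Type*} [TopologicalSpace G] [ChartedSpace E G]
  {EM : Type*} [NormedAddCommGroup EM] [NormedSpace ℝ EM] {HM : Type*} [TopologicalSpace HM]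
  {I : ModelWithCorners ℝ EM HM} {M : Type*} [TopologicalSpace M] [ChartedSpace HM M]

theorem contMDiff_trivJet_iff {n : ℕ} {f : M → TrivJet E G n} :
    ContMDiff I (trivJetModel E n) ∞ f ↔ ContMDiff I 𝓘(ℝ, E) ∞ (fun x => (f x).1) ∧
      ContMDiff I 𝓘(ℝ, Fin n → E) ∞ (fun x => (f x).2) :=
  contMDiff_prod_iff f

theorem contMDiff_trivJet_succ_iff {k : ℕ} {f : M → TrivJet E G (k + 1)} :
    ContMDiff I (trivJetModel E (k + 1)) ∞ f ↔
      ContMDiff I (trivJetModel E k) ∞ (fun x => truncate k (f x)) ∧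
      ContMDiff I 𝓘(ℝ, E) ∞ (fun x => (f x).2 (Fin.last k)) := by
  rw [contMDiff_trivJet_iff, contMDiff_trivJet_iff, contMDiff_pi_space, contMDiff_pi_space,
    Fin.forall_fin_succ', and_assoc]
  rfl

theorem contMDiff_trivJet_fst (n : ℕ) :
    ContMDiff (trivJetModel E n) 𝓘(ℝ, E) ∞ (fun a : TrivJet E G n => a.1) :=
  contMDiff_fst

theorem contMDiff_truncate (k : ℕ) :
    ContMDiff (trivJetModel E (k + 1)) (trivJetModel E k) ∞
      (truncate k : TrivJet E G (k + 1) → TrivJet E G k) :=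
  (contMDiff_trivJet_succ_iff.1 contMDiff_id).1

theorem contMDiff_trivJet_last (k : ℕ) : ContMDiff (trivJetModel E (k + 1)) 𝓘(ℝ, E) ∞
    (fun a : TrivJet E G (k + 1) => a.2 (Fin.last k)) :=
  (contMDiff_trivJet_succ_iff.1 contMDiff_id).2

theorem contMDiff_zeroSection (k : ℕ) :
    ContMDiff (trivJetModel E k) (trivJetModel E (k + 1)) ∞
      (zeroSection k : TrivJet E G k → TrivJet E G (k + 1)) := by
  simp only [contMDiff_trivJet_succ_iff, truncate_zeroSection, zeroSection_last]
  exact ⟨contMDiff_id, contMDiff_const⟩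

variable [Group G]

theorem contMDiff_topInclusion (k : ℕ) :
    ContMDiff 𝓘(ℝ, E) (trivJetModel E (k + 1)) ∞
      (topInclusion G k : E → TrivJet E G (k + 1)) := by
  simp only [contMDiff_trivJet_succ_iff, truncate_topInclusion_eq, topInclusion_last]
  exact ⟨contMDiff_const, contMDiff_id⟩

variable [LieGroup 𝓘(ℝ, E) ∞ G]

theorem contMDiff_jetAd (k : ℕ) : ContMDiff (trivJetModel E k) 𝓘(ℝ, (Fin (k + 1) → E) →L[ℝ] E) ∞
    (jetAd : TrivJet E G k → (Fin (k + 1) → E) →L[ℝ] E) := by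
  refine contMDiff_finsetSum fun ij _ => ?_
  have hbell : ContMDiff (trivJetModel E k) 𝓘(ℝ, E →L[ℝ] E) ∞
      fun a : TrivJet E G k => bellAd G a.2 ij.2 :=
    (contDiff_bellAd k ij.2).contMDiff.comp contMDiff_snd
  have hAd := contMDiff_Ad.comp (contMDiff_trivJet_fst (E := E) (G := G) k)
  exact ((contDiff_const_smul (k.choose ij.1)).contMDiff).comp
    ((hbell.clm_comp hAd).clm_comp contMDiff_const)

theorem contMDiff_groupCocycle [CompleteSpace E] {k : ℕ} {a b : M → TrivJet E G k}
    (ha : ContMDiff I (trivJetModel E k) ∞ a) (hb : ContMDiff I (trivJetModel E k) ∞ b) :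
    ContMDiff I 𝓘(ℝ, E) ∞ (fun m => groupCocycle k (a m) (b m)) := by
  simp only [groupCocycle_eq_jetAd]
  exact ((contMDiff_jetAd k).comp ha).clm_apply
    (contMDiff_trivJet_iff.1 ((contMDiff_zeroSection k).comp hb)).2

attribute [local instance] trivJetGroup

theorem trivJet_inv_fst {n : ℕ} (a : TrivJet E G n) : (a⁻¹).1 = a.1⁻¹ :=
  eq_inv_of_mul_eq_one_left (by rw [← trivJet_mul_fst, inv_mul_cancel, trivJet_one])

theorem trivJet_inv_last {k : ℕ} (a : TrivJet E G (k + 1)) :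
    (a⁻¹).2 (Fin.last k) = -jetAd (truncate k a)⁻¹ a.2 := by
  have hlast := trivJet_mul_last k a⁻¹ a
  rw [inv_mul_cancel, trivJet_one, truncate_inv] at hlast
  exact eq_neg_of_add_eq_zero_left hlast.symm

theorem contMDiff_trivJet_mul (n : ℕ) :
    ContMDiff ((trivJetModel E n).prod (trivJetModel E n)) (trivJetModel E n) ∞
      (fun p : TrivJet E G n × TrivJet E G n => p.1 * p.2) := by
  induction n with
  | zero =>
    simp only [contMDiff_trivJet_iff, trivJet_mul_fst]
    exact ⟨(contMDiff_fst.comp contMDiff_fst).mul (contMDiff_fst.comp contMDiff_snd),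
      contMDiff_of_subsingleton⟩
  | succ k ih =>
    have hfst := (contMDiff_truncate (E := E) (G := G) k).comp
      (contMDiff_fst (I := trivJetModel E (k + 1)) (J := trivJetModel E (k + 1))
        (N := TrivJet E G (k + 1)))
    have hsnd := (contMDiff_truncate (E := E) (G := G) k).comp
      (contMDiff_snd (I := trivJetModel E (k + 1)) (J := trivJetModel E (k + 1))
        (M := TrivJet E G (k + 1)))
    simp only [contMDiff_trivJet_succ_iff, truncate_mul, trivJet_mul_last]
    exact ⟨ih.comp (hfst.prodMk hsnd), ((contMDiff_trivJet_last k).comp contMDiff_fst).add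
      (((contMDiff_jetAd k).comp hfst).clm_apply (contMDiff_snd.comp contMDiff_snd))⟩

theorem contMDiff_trivJet_inv (n : ℕ) :
    ContMDiff (trivJetModel E n) (trivJetModel E n) ∞ (fun a : TrivJet E G n => a⁻¹) := by
  induction n with
  | zero =>
    simp only [contMDiff_trivJet_iff, trivJet_inv_fst]
    exact ⟨(contMDiff_trivJet_fst 0).inv, contMDiff_of_subsingleton⟩
  | succ k ih =>
    have htrunc := ih.comp (contMDiff_truncate (E := E) (G := G) k)
    simp only [contMDiff_trivJet_succ_iff, truncate_inv, trivJet_inv_last]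
    exact ⟨htrunc, (((contMDiff_jetAd k).comp htrunc).clm_apply contMDiff_snd).neg⟩

theorem trivJet_lieGroup (n : ℕ) : LieGroup (trivJetModel E n) ∞ (TrivJet E G n) where
  contMDiff_mul := contMDiff_trivJet_mul n
  contMDiff_inv := contMDiff_trivJet_inv n

end JetLieGroup

section JetGroupExtension

variable {E : Type*} [NormedAddCommGroup E] [NormedSpace ℝ E]
  {G : Type*} [TopologicalSpace G] [ChartedSpace E G] [Group G] [LieGroup 𝓘(ℝ, E) ∞ G]

attribute [local instance] trivJetGroup

theorem truncate_topInclusion (k : ℕ) (v : E) : truncate k (topInclusion G k v) = 1 := by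
  rw [truncate_topInclusion_eq, trivJet_one]

theorem topInclusion_mul {k : ℕ} (v : E) (a : TrivJet E G (k + 1)) :
    topInclusion G k v * a = (a.1, Fin.snoc (Fin.init a.2) (v + a.2 (Fin.last k))) := by
  refine trivJet_ext ?_ ?_
  · rw [truncate_mul, truncate_topInclusion, one_mul]
    simp only [truncate, Fin.init_snoc]
  · rw [trivJet_mul_last, truncate_topInclusion, trivJet_one, jetAd_mk_zero, Ad_one,
      topInclusion_last]
    exact (Fin.snoc_last (α := fun _ => E) _ _).symm

theorem topInclusion_add (k : ℕ) (v w : E) :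
    topInclusion G k (v + w) = topInclusion G k v * topInclusion G k w := by
  rw [topInclusion_mul, topInclusion_last]
  simp only [topInclusion, Fin.init_snoc]

theorem topInclusion_mul_zeroSection {k : ℕ} (v : E) (a : TrivJet E G k) :
    topInclusion G k v * zeroSection k a = (a.1, Fin.snoc a.2 v) := by
  rw [topInclusion_mul, zeroSection_last, add_zero]
  simp only [zeroSection, Fin.init_snoc]

theorem mul_topInclusion {k : ℕ} (a : TrivJet E G (k + 1)) (v : E) :
    a * topInclusion G k v = topInclusion G k (Ad E a.1 v) * a := by
  rw [topInclusion_mul]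
  refine trivJet_ext ?_ ?_
  · rw [truncate_mul, truncate_topInclusion, mul_one]
    simp only [truncate, Fin.init_snoc]
  · rw [trivJet_mul_last, topInclusion, jetAd_snoc_zero, add_comm]
    exact (Fin.snoc_last (α := fun _ => E) _ _).symm

variable (E G) in
/-- The extension `𝔤 → J^{k+1} G → J^k G` given by the projection of jets. -/
noncomputable def jetGroupExtension (k : ℕ) :
    GroupExtension (Multiplicative E) (TrivJet E G (k + 1)) (TrivJet E G k) where
  inl :=
    { toFun := fun v => topInclusion G k v.toAdd
      map_one' := trivJet_ext ((truncate_topInclusion k _).trans (truncate_one k).symm)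
        (by rw [topInclusion_last, trivJet_one]; rfl)
      map_mul' := fun v w => topInclusion_add k v.toAdd w.toAdd }
  rightHom :=
    { toFun := truncate k
      map_one' := truncate_one k
      map_mul' := truncate_mul k }
  inl_injective v w h := by
    have hlast := congrArg (fun a : TrivJet E G (k + 1) => a.2 (Fin.last k)) h
    exact (topInclusion_last k v.toAdd).symm.trans (hlast.trans (topInclusion_last k w.toAdd))
  range_inl_eq_ker_rightHom := by
    ext a
    rw [MonoidHom.mem_range, MonoidHom.mem_ker]
    constructor
    · rintro ⟨v, rfl⟩
      exact truncate_topInclusion k _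
    · exact fun h => ⟨Multiplicative.ofAdd (a.2 (Fin.last k)),
        trivJet_ext ((truncate_topInclusion k _).trans h.symm) (topInclusion_last k _)⟩
  rightHom_surjective a := ⟨zeroSection k a, truncate_zeroSection k a⟩

variable [CompleteSpace E]

theorem zeroSection_mul_zeroSection (k : ℕ) (a b : TrivJet E G k) :
    zeroSection k a * zeroSection k b =
      topInclusion G k (groupCocycle k a b) * zeroSection k (a * b) := by
  refine trivJet_ext ?_ ?_
  · rw [truncate_mul, truncate_mul, truncate_topInclusion, one_mul]
    simp only [truncate_zeroSection]
  · rw [topInclusion_mul_zeroSection, trivJet_mul_last, zeroSection_last, truncate_zeroSection,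
      zero_add, groupCocycle_eq_jetAd]
    exact (Fin.snoc_last (α := fun _ => E) _ _).symm

theorem groupCocycle_isCocycle (k : ℕ) (a b d : TrivJet E G k) :
    groupCocycle k a b + groupCocycle k (a * b) d =
      Ad E a.1 (groupCocycle k b d) + groupCocycle k a (b * d) := by
  have hmul : ∀ a b : TrivJet E G k, zeroSection k a * zeroSection k b =
      ((a * b).1, Fin.snoc (a * b).2 (groupCocycle k a b)) := fun a b => by
    rw [zeroSection_mul_zeroSection, topInclusion_mul_zeroSection]
  have hassoc := congrArg (fun c : TrivJet E G (k + 1) => c.2 (Fin.last k))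
    (mul_assoc (zeroSection k a) (zeroSection k b) (zeroSection k d))
  simp only [trivJet_mul_last _ (_ * _), trivJet_mul_last _ (zeroSection k a) (_ * _), truncate_mul,
    truncate_zeroSection, zeroSection_last, zero_add] at hassoc
  simp only [hmul, Fin.snoc_last, jetAd_snoc _ _ (groupCocycle _ _ _)] at hassoc
  simpa only [groupCocycle_eq_jetAd, zeroSection] using hassoc

variable (E G) in
/-- The diffeomorphism `((g, x), v) ↦ ι(v) s(g, x)`. -/
noncomputable def jetTrivialization (k : ℕ) :
    (TrivJet E G k × E) ≃ₘ^∞⟮(trivJetModel E k).prod 𝓘(ℝ, E), trivJetModel E (k + 1)⟯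
      TrivJet E G (k + 1) where
  toFun q := (q.1.1, Fin.snoc q.1.2 q.2)
  invFun a := (truncate k a, a.2 (Fin.last k))
  left_inv q := by simp only [truncate, Fin.init_snoc, Fin.snoc_last]
  right_inv a := by simp only [truncate, Fin.snoc_init_self]
  contMDiff_toFun := by
    rw [contMDiff_trivJet_succ_iff]
    simpa [truncate] using ⟨contMDiff_fst, contMDiff_snd⟩
  contMDiff_invFun := (contMDiff_truncate k).prodMk (contMDiff_trivJet_last k)

variable (E G) in
theorem isAbelianLieGroupExtension_jetGroupExtension (k : ℕ) :
    IsAbelianLieGroupExtension (trivJetModel E (k + 1)) (trivJetModel E k)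
      (jetGroupExtension E G k) (zeroSection k) (fun a => Ad E a.1) (groupCocycle k) where
  contMDiff_inl := contMDiff_topInclusion k
  contMDiff_rightHom := contMDiff_truncate k
  contMDiff_section := contMDiff_zeroSection k
  rightHom_section := truncate_zeroSection k
  trivialization :=
    ⟨jetTrivialization E G k, fun a v => (topInclusion_mul_zeroSection v a).symm⟩
  action_one v := by
    rw [trivJet_one, Ad_one]
    rfl
  action_mul a b v := by
    rw [trivJet_mul_fst, Ad_mul]
    rfl
  contMDiff_action :=
    (contMDiff_Ad.comp ((contMDiff_trivJet_fst k).comp contMDiff_fst)).clm_apply contMDiff_snd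
  conj_inl a v := mul_inv_eq_iff_eq_mul.2 (mul_topInclusion a v)
  contMDiff_cocycle := contMDiff_groupCocycle contMDiff_fst contMDiff_snd
  cocycle := groupCocycle_isCocycle k
  section_mul := zeroSection_mul_zeroSection k

end JetGroupExtension

section JetTangent

variable {E : Type*} [NormedAddCommGroup E] [NormedSpace ℝ E]
  {G : Type*} [TopologicalSpace G] [ChartedSpace E G]

theorem tderiv_clm_trivJet_snd {n : ℕ} {F : Type*} [NormedAddCommGroup F] [NormedSpace ℝ F]
    (L : (Fin n → E) →L[ℝ] F) (a : TrivJet E G n) (X : E × (Fin n → E)) :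
    tderiv (trivJetModel E n) 𝓘(ℝ, F) (fun a : TrivJet E G n => L a.2) a X = L X.2 := by
  have hL : MDifferentiableAt 𝓘(ℝ, Fin n → E) 𝓘(ℝ, F) L a.2 :=
    L.differentiableAt.mdifferentiableAt
  have hsnd : MDifferentiableAt (trivJetModel E n) 𝓘(ℝ, Fin n → E)
      (Prod.snd : TrivJet E G n → Fin n → E) a := mdifferentiableAt_snd
  refine (tderiv_comp_apply hL hsnd X).trans ?_
  rw [tderiv_eq_fderiv, L.fderiv]
  exact congrArg L (DFunLike.congr_fun mfderiv_snd X)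

theorem tderiv_truncate {k : ℕ} (a : TrivJet E G (k + 1)) (X : E × (Fin (k + 1) → E)) :
    tderiv (trivJetModel E (k + 1)) (trivJetModel E k) (truncate k) a X =
      (X.1, Fin.init X.2) := by
  let init : (Fin (k + 1) → E) →L[ℝ] (Fin k → E) :=
    ContinuousLinearMap.pi fun j => ContinuousLinearMap.proj j.castSucc
  have hinit : MDifferentiableAt (trivJetModel E (k + 1)) 𝓘(ℝ, Fin k → E)
      (fun a : TrivJet E G (k + 1) => init a.2) a :=
    init.contMDiff.contMDiffAt.mdifferentiableAt one_ne_zero |>.comp a mdifferentiableAt_snd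
  refine (DFunLike.congr_fun (mfderiv_prodMk mdifferentiableAt_fst hinit) X).trans ?_
  exact Prod.ext (DFunLike.congr_fun mfderiv_fst X) (tderiv_clm_trivJet_snd init a X)

variable {EM : Type*} [NormedAddCommGroup EM] [NormedSpace ℝ EM] {HM : Type*} [TopologicalSpace HM]
  {I : ModelWithCorners ℝ EM HM} {M : Type*} [TopologicalSpace M] [ChartedSpace HM M]

theorem tderiv_trivJet_succ_apply {k : ℕ} {f : M → TrivJet E G (k + 1)} {x : M}
    (hf : MDifferentiableAt I (trivJetModel E (k + 1)) f x) (v : EM) :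
    tderiv I (trivJetModel E (k + 1)) f x v =
      ((tderiv I (trivJetModel E k) (fun x => truncate k (f x)) x v).1,
        Fin.snoc (tderiv I (trivJetModel E k) (fun x => truncate k (f x)) x v).2
          (tderiv I 𝓘(ℝ, E) (fun x => (f x).2 (Fin.last k)) x v)) := by
  set T := tderiv I (trivJetModel E (k + 1)) f x v
  have htruncate : tderiv I (trivJetModel E k) (fun x => truncate k (f x)) x v =
      (T.1, Fin.init T.2) :=
    (tderiv_comp_apply ((contMDiff_truncate k).mdifferentiableAt (by simp)) hf v).trans
      (tderiv_truncate (f x) T)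
  have hlast : tderiv I 𝓘(ℝ, E) (fun x => (f x).2 (Fin.last k)) x v = T.2 (Fin.last k) :=
    (tderiv_comp_apply ((contMDiff_trivJet_last k).mdifferentiableAt (by simp)) hf v).trans
      (tderiv_clm_trivJet_snd (ContinuousLinearMap.proj (Fin.last k)) (f x) T)
  rw [htruncate, hlast]
  exact Prod.ext rfl (Fin.snoc_init_self _).symm

theorem tderiv_zeroSection {k : ℕ} (a : TrivJet E G k) (X : E × (Fin k → E)) :
    tderiv (trivJetModel E k) (trivJetModel E (k + 1)) (zeroSection k) a X =
      (X.1, Fin.snoc X.2 (0 : E)) := by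
  rw [tderiv_trivJet_succ_apply ((contMDiff_zeroSection k).mdifferentiableAt (by simp))]
  simp only [truncate_zeroSection, zeroSection_last, tderiv_const]
  exact congrArg (fun T : E × (Fin k → E) => ((T.1, Fin.snoc T.2 (0 : E)) : E × (Fin (k + 1) → E)))
    (DFunLike.congr_fun (tderiv_id a) X)

theorem tderiv_topInclusion [Group G] {k : ℕ} (v w : E) :
    tderiv 𝓘(ℝ, E) (trivJetModel E (k + 1)) (topInclusion G k) v w =
      (0, Fin.snoc (0 : Fin k → E) w) := by
  rw [tderiv_trivJet_succ_apply ((contMDiff_topInclusion k).mdifferentiableAt (by simp))]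
  simp only [truncate_topInclusion_eq, topInclusion_last, tderiv_const]
  exact congrArg (fun u : E => ((0, Fin.snoc (0 : Fin k → E) u) : E × (Fin (k + 1) → E)))
    (DFunLike.congr_fun (tderiv_id v) w)

end JetTangent

section JetBracket

open Finset

theorem sum_antidiagonal_succ_eq_sum_Icc {A : Type*} [AddCommMonoid A] {n : ℕ} (f : ℕ → ℕ → A)
    (hleft : ∀ j, f 0 j = 0) (hright : ∀ i, f i 0 = 0) :
    ∑ ij ∈ antidiagonal (n + 1), f ij.1 ij.2 = ∑ i ∈ Icc 1 n, f i (n + 1 - i) := by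
  rw [Finset.Nat.sum_antidiagonal_eq_sum_range_succ f, sum_range_succ, sum_range_succ',
    Nat.sub_self, hleft, hright, add_zero, add_zero]
  rw [range_eq_Ico, sum_Ico_add' (fun i => f i (n + 1 - i)) 0 n 1]
  rfl

theorem jetComp_init_of_le {E : Type*} [NormedAddCommGroup E] {k i : ℕ} (y : Fin (k + 1) → E)
    (hi : i ≤ k) : jetComp (Fin.init y : Fin k → E) i = jetComp y i := by
  rw [← jetComp_snoc_of_le (Fin.init y) (y (Fin.last k)) hi, Fin.snoc_init_self]

variable {E : Type*} [NormedAddCommGroup E] [NormedSpace ℝ E]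
  {G : Type*} [TopologicalSpace G] [ChartedSpace E G] [Group G]

theorem jetAd_one_mk {k : ℕ} (x : Fin k → E) (y : Fin (k + 1) → E) :
    jetAd ((1 : G), x) y =
      ∑ ij ∈ antidiagonal k, k.choose ij.1 • bellAd G x ij.2 (jetComp y (ij.1 + 1)) := by
  simp only [jetAd_apply, Ad_one, ContinuousLinearMap.id_apply]

variable [LieGroup 𝓘(ℝ, E) ∞ G]

attribute [local instance] trivJetGroup

theorem tderiv_mul_last {k : ℕ} (a : TrivJet E G (k + 1)) (Y : E × (Fin (k + 1) → E)) :
    tderiv (trivJetModel E (k + 1)) 𝓘(ℝ, E)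
      (fun b : TrivJet E G (k + 1) => (a * b).2 (Fin.last k)) 1 Y = jetAd (truncate k a) Y.2 := by
  simp only [trivJet_mul_last]
  have hjetAd : MDifferentiableAt (trivJetModel E (k + 1)) 𝓘(ℝ, E)
      (fun b : TrivJet E G (k + 1) => jetAd (truncate k a) b.2) 1 :=
    (contMDiff_const.clm_apply contMDiff_snd).mdifferentiableAt (n := ∞) (by simp)
  rw [tderiv_const_add _ hjetAd]
  exact tderiv_clm_trivJet_snd (jetAd (truncate k a)) 1 Y

variable [CompleteSpace E]

theorem fderiv_jetAd_one_mk {k : ℕ} (x : Fin k → E) (y : Fin (k + 1) → E) :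
    fderiv ℝ (fun x => jetAd ((1 : G), x) y) 0 x =
      ∑ ij ∈ antidiagonal k, k.choose ij.1 • ad G (jetComp x ij.2) (jetComp y (ij.1 + 1)) := by
  have hbell (j : ℕ) : DifferentiableAt ℝ (fun x : Fin k → E => bellAd G x j) 0 :=
    (contDiff_bellAd k j).differentiable (by simp) 0
  have hterm (j : ℕ) (u : E) : HasFDerivAt (fun x : Fin k → E => bellAd G x j u)
      ((fderiv ℝ (fun x => bellAd G x j) 0).flip u) 0 := by
    simpa using (hbell j).hasFDerivAt.clm_apply (hasFDerivAt_const u 0)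
  simp only [jetAd_one_mk]
  rw [(HasFDerivAt.fun_sum fun ij _ => (hterm ij.2 (jetComp y (ij.1 + 1))).fun_const_smul
    (k.choose ij.1)).fderiv, _root_.sum_apply]
  refine sum_congr rfl fun ij _ => ?_
  rw [_root_.smul_apply, ContinuousLinearMap.flip_apply, fderiv_bellAd_zero, adL_apply]

theorem tderiv_jetAd {k : ℕ} (y : Fin (k + 1) → E) (X : E × (Fin k → E)) :
    tderiv (trivJetModel E k) 𝓘(ℝ, E) (fun a : TrivJet E G k => jetAd a y) (1, 0) X =
      ad G X.1 (y (Fin.last k)) +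
      ∑ ij ∈ antidiagonal k, k.choose ij.1 • ad G (jetComp X.2 ij.2) (jetComp y (ij.1 + 1)) := by
  have hjetAd : MDifferentiableAt (trivJetModel E k) 𝓘(ℝ, E)
      (fun a : TrivJet E G k => jetAd a y) (1, 0) :=
    ((contMDiff_jetAd k).clm_apply contMDiff_const).mdifferentiableAt (by simp)
  have hfst : tderiv 𝓘(ℝ, E) 𝓘(ℝ, E) (fun g : G => jetAd (g, (0 : Fin k → E)) y) 1 X.1 =
      ad G X.1 (y (Fin.last k)) := by
    simp only [jetAd_mk_zero]
    rw [tderiv_clm_apply_const (contMDiff_Ad.mdifferentiableAt (by simp)), ← adL_apply]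
    rfl
  refine (mfderiv_prod_eq_add_apply hjetAd).trans (congrArg₂ (· + ·) hfst ?_)
  rw [← fderiv_jetAd_one_mk, ← tderiv_eq_fderiv]
  rfl

theorem ad_skew (X Y : E) : ad G Y X = -ad G X Y :=
  (lie_skew (L := GroupLieAlgebra 𝓘(ℝ, E) G) Y X).symm

theorem ad_zero_left (Y : E) : ad G 0 Y = 0 :=
  zero_lie (L := GroupLieAlgebra 𝓘(ℝ, E) G) (M := GroupLieAlgebra 𝓘(ℝ, E) G) Y

theorem ad_zero_right (X : E) : ad G X 0 = 0 :=
  lie_zero (L := GroupLieAlgebra 𝓘(ℝ, E) G) (M := GroupLieAlgebra 𝓘(ℝ, E) G) X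

theorem lieCocycle_init_init {k : ℕ} (X Y : E × (Fin (k + 1) → E)) :
    lieCocycle G k (X.1, Fin.init X.2) (Y.1, Fin.init Y.2) = ∑ ij ∈ antidiagonal (k + 1),
      (k + 1).choose ij.1 • ad G (jetComp X.2 ij.1) (jetComp Y.2 ij.2) := by
  rw [sum_antidiagonal_succ_eq_sum_Icc
    (fun i j => (k + 1).choose i • ad G (jetComp X.2 i) (jetComp Y.2 j))
    (fun j => by rw [jetComp_zero_index, ad_zero_left, smul_zero])
    (fun i => by rw [jetComp_zero_index, ad_zero_right, smul_zero])]
  refine sum_congr rfl fun i hi => ?_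
  rw [mem_Icc] at hi
  rw [jetComp_init_of_le _ (by omega), jetComp_init_of_le _ (by omega)]

/- Pascal's rule splits `binom(k+1, i)`; skew-symmetry and the symmetry of `binom(k, i)` turn one of
the two halves into the other one with `X` and `Y` exchanged. -/
theorem lieCocycle_init_init_eq_sub {k : ℕ} (X Y : E × (Fin (k + 1) → E)) :
    lieCocycle G k (X.1, Fin.init X.2) (Y.1, Fin.init Y.2) =
      ∑ ij ∈ antidiagonal k, k.choose ij.1 • ad G (jetComp X.2 ij.2) (jetComp Y.2 (ij.1 + 1)) -
      ∑ ij ∈ antidiagonal k, k.choose ij.1 • ad G (jetComp Y.2 ij.2) (jetComp X.2 (ij.1 + 1)) := by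
  rw [lieCocycle_init_init,
    sum_antidiagonal_choose_succ_nsmul (fun i j => ad G (jetComp X.2 i) (jetComp Y.2 j)),
    sub_eq_add_neg, ← sum_neg_distrib]
  refine congrArg₂ (· + ·) ?_ (sum_congr rfl fun ij hij => ?_)
  · rw [← Finset.Nat.sum_antidiagonal_swap]
    refine sum_congr rfl fun ij hij => ?_
    rw [Prod.fst_swap, Prod.snd_swap,
      Nat.choose_symm_of_eq_add (HasAntidiagonal.mem_antidiagonal.1 hij).symm]
  · rw [ad_skew (jetComp X.2 (ij.1 + 1)), smul_neg, neg_neg,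
      Nat.choose_symm_of_eq_add (HasAntidiagonal.mem_antidiagonal.1 hij).symm]

theorem tderiv_tderiv_mul_last {k : ℕ} (X Y : E × (Fin (k + 1) → E)) :
    tderiv (trivJetModel E (k + 1)) 𝓘(ℝ, E) (fun a : TrivJet E G (k + 1) =>
      tderiv (trivJetModel E (k + 1)) 𝓘(ℝ, E)
        (fun b : TrivJet E G (k + 1) => (a * b).2 (Fin.last k)) 1 Y) 1 X =
      ad G X.1 (Y.2 (Fin.last k)) + ∑ ij ∈ antidiagonal k,
        k.choose ij.1 • ad G (jetComp X.2 ij.2) (jetComp Y.2 (ij.1 + 1)) := by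
  simp only [tderiv_mul_last]
  have hjetAd : MDifferentiableAt (trivJetModel E k) 𝓘(ℝ, E)
      (fun a : TrivJet E G k => jetAd a Y.2) (truncate k (1 : TrivJet E G (k + 1))) :=
    ((contMDiff_jetAd k).clm_apply contMDiff_const).mdifferentiableAt (by simp)
  refine (tderiv_comp_apply hjetAd ((contMDiff_truncate k).mdifferentiableAt (by simp)) X).trans ?_
  rw [tderiv_truncate, truncate_one, trivJet_one, tderiv_jetAd]
  refine congrArg _ (sum_congr rfl fun ij hij => ?_)
  rw [jetComp_init_of_le _ (HasAntidiagonal.antidiagonal.snd_le hij)]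

attribute [local instance] trivJet_lieGroup

theorem groupBracket_trivJet_last {k : ℕ} (X Y : E × (Fin (k + 1) → E)) :
    (groupBracket (trivJetModel E (k + 1)) (TrivJet E G (k + 1)) X Y).2 (Fin.last k) =
      ad G X.1 (Y.2 (Fin.last k)) - ad G Y.1 (X.2 (Fin.last k)) +
        lieCocycle G k (X.1, Fin.init X.2) (Y.1, Fin.init Y.2) := by
  have h := tderiv_groupBracket (contMDiff_trivJet_last (E := E) (G := G) k).contMDiffAt X Y
  rw [tderiv_tderiv_mul_last, tderiv_tderiv_mul_last] at h
  rw [lieCocycle_init_init_eq_sub, sub_add_sub_comm, ← h]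
  exact (tderiv_clm_trivJet_snd (ContinuousLinearMap.proj (Fin.last k)) 1 _).symm

theorem groupBracket_trivJet_init {k : ℕ} (X Y : E × (Fin (k + 1) → E)) :
    ((groupBracket (trivJetModel E (k + 1)) (TrivJet E G (k + 1)) X Y).1,
      Fin.init (groupBracket (trivJetModel E (k + 1)) (TrivJet E G (k + 1)) X Y).2) =
      groupBracket (trivJetModel E k) (TrivJet E G k) (X.1, Fin.init X.2) (Y.1, Fin.init Y.2) := by
  have h := tderiv_monoidHom_groupBracket (φ := (jetGroupExtension E G k).rightHom)
    (contMDiff_truncate k) X Y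
  change tderiv _ _ (truncate k) _ _ =
    groupBracket _ _ (tderiv _ _ (truncate k) _ _) (tderiv _ _ (truncate k) _ _) at h
  rwa [tderiv_truncate, tderiv_truncate, tderiv_truncate] at h

end JetBracket

section LieCurvature

variable {R L M : Type*} [CommRing R] [LieRing L] [LieAlgebra R L] [LieRing M] [LieAlgebra R M]

/-- The curvature `(X, Y) ↦ ⁅τ X, τ Y⁆ - τ ⁅X, Y⁆` of a linear map `τ` between Lie algebras, which
measures its failure to be a homomorphism. -/
def lieCurvature (τ : M →ₗ[R] L) : M →ₗ[R] M →ₗ[R] L :=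
  LinearMap.mk₂ R (fun X Y => ⁅τ X, τ Y⁆ - τ ⁅X, Y⁆)
    (fun X X' Y => by simp only [map_add, add_lie]; abel)
    (fun c X Y => by simp only [map_smul, smul_lie, smul_sub])
    (fun X Y Y' => by simp only [map_add, lie_add]; abel)
    (fun c X Y => by simp only [map_smul, lie_smul, smul_sub])

theorem lieCurvature_apply (τ : M →ₗ[R] L) (X Y : M) :
    lieCurvature τ X Y = ⁅τ X, τ Y⁆ - τ ⁅X, Y⁆ := rfl

theorem lieCurvature_self (τ : M →ₗ[R] L) (X : M) : lieCurvature τ X X = 0 := by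
  rw [lieCurvature_apply, lie_self, lie_self, map_zero, sub_zero]

theorem lieCurvature_bianchi (τ : M →ₗ[R] L) (X Y Z : M) :
    ⁅τ X, lieCurvature τ Y Z⁆ + ⁅τ Y, lieCurvature τ Z X⁆ + ⁅τ Z, lieCurvature τ X Y⁆ =
      lieCurvature τ ⁅X, Y⁆ Z + lieCurvature τ ⁅Y, Z⁆ X + lieCurvature τ ⁅Z, X⁆ Y := by
  have hL := lie_jacobi (τ X) (τ Y) (τ Z)
  have hM : τ ⁅⁅X, Y⁆, Z⁆ + τ ⁅⁅Y, Z⁆, X⁆ + τ ⁅⁅Z, X⁆, Y⁆ = 0 := by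
    have hcyc : ⁅⁅X, Y⁆, Z⁆ + ⁅⁅Y, Z⁆, X⁆ + ⁅⁅Z, X⁆, Y⁆ = 0 := by
      rw [← neg_eq_zero, ← lie_jacobi X Y Z, ← lie_skew X ⁅Y, Z⁆, ← lie_skew Y ⁅Z, X⁆,
        ← lie_skew Z ⁅X, Y⁆]
      abel
    rw [← map_add, ← map_add, hcyc, map_zero]
  simp only [lieCurvature_apply, lie_sub]
  rw [← lie_skew (τ X) (τ ⁅Y, Z⁆), ← lie_skew (τ Y) (τ ⁅Z, X⁆), ← lie_skew (τ Z) (τ ⁅X, Y⁆),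
    ← sub_eq_zero]
  refine Eq.trans ?_ (congrArg₂ (· + ·) hL hM |>.trans (add_zero 0))
  abel

end LieCurvature

section AbelianExtension

variable {N L M : Type*} [LieRing N] [LieAlgebra ℝ N] [LieRing L] [LieAlgebra ℝ L] [LieRing M]
  [LieAlgebra ℝ M] {ι : N →ₗ⁅ℝ⁆ L} {π : L →ₗ⁅ℝ⁆ M} {τ : M →ₗ[ℝ] L} {ρ : M → N → N} {σ : M → M → N}

theorem map_cocycle_eq_lieCurvature (hσ : ∀ X Y, ⁅τ X, τ Y⁆ = τ ⁅X, Y⁆ + ι (σ X Y)) (X Y : M) :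
    ι (σ X Y) = lieCurvature τ X Y := by
  rw [lieCurvature_apply, hσ, add_sub_cancel_left]

theorem action_bracket_of_bracket (hN : IsLieAbelian N) (hι : Function.Injective ι)
    (hρ : ∀ X v, ⁅τ X, ι v⁆ = ι (ρ X v)) (hσ : ∀ X Y, ⁅τ X, τ Y⁆ = τ ⁅X, Y⁆ + ι (σ X Y))
    (X Y : M) (v : N) : ρ ⁅X, Y⁆ v = ρ X (ρ Y v) - ρ Y (ρ X v) := by
  apply hι
  have hcomm : ⁅ι (σ X Y), ι v⁆ = 0 := by rw [← LieHom.map_lie, hN.trivial, map_zero]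
  calc ι (ρ ⁅X, Y⁆ v) = ⁅τ ⁅X, Y⁆ + ι (σ X Y), ι v⁆ := by rw [add_lie, hcomm, add_zero, hρ]
    _ = ⁅τ X, ⁅τ Y, ι v⁆⁆ - ⁅τ Y, ⁅τ X, ι v⁆⁆ := by rw [← hσ, lie_lie]
    _ = ι (ρ X (ρ Y v) - ρ Y (ρ X v)) := by rw [hρ, hρ, hρ, hρ, map_sub]

/- The cocycle identity is the Bianchi identity for the curvature of the section. -/
theorem isAbelianLieAlgebraExtension_of_bracket (hN : IsLieAbelian N) (hι : Function.Injective ι)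
    (hexact : ∀ X, π X = 0 ↔ ∃ v, ι v = X) (hτ : ∀ X, π (τ X) = X)
    (hρ : ∀ X v, ⁅τ X, ι v⁆ = ι (ρ X v))
    (hσ : ∀ X Y, ⁅τ X, τ Y⁆ = τ ⁅X, Y⁆ + ι (σ X Y)) :
    IsAbelianLieAlgebraExtension ι π τ ρ σ where
  isLieAbelian := hN
  isExtension :=
    { ker_eq_bot := by rwa [LieHom.ker_eq_bot]
      range_eq_top := (LieHom.range_eq_top π).2 fun X => ⟨τ X, hτ X⟩
      exact := by rwa [LieHom.range_eq_ker_iff] }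
  proj_section := hτ
  action_linear X :=
    ⟨fun v w => hι (by simp only [map_add, ← hρ, lie_add]),
      fun c v => hι (by simp only [map_smul, ← hρ, lie_smul])⟩
  linear_action v :=
    ⟨fun X Y => hι (by simp only [map_add, ← hρ, add_lie]),
      fun c X => hι (by simp only [map_smul, ← hρ, smul_lie])⟩
  action_bracket := action_bracket_of_bracket hN hι hρ hσ
  bracket_incl := hρ
  cocycle_linear_right X :=
    ⟨fun Y Z => hι (by simp only [map_add, map_cocycle_eq_lieCurvature hσ]),
      fun c Y => hι (by simp only [map_smul, map_cocycle_eq_lieCurvature hσ])⟩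
  cocycle_linear_left Y :=
    ⟨fun X Z => hι (by simp only [map_add, map_cocycle_eq_lieCurvature hσ, LinearMap.add_apply]),
      fun c X => hι (by simp only [map_smul, map_cocycle_eq_lieCurvature hσ, LinearMap.smul_apply])⟩
  cocycle_self X := hι (by rw [map_cocycle_eq_lieCurvature hσ, lieCurvature_self, map_zero])
  cocycle X Y Z := hι (by
    simp only [map_add, ← hρ, map_cocycle_eq_lieCurvature hσ]
    exact lieCurvature_bianchi τ X Y Z)
  bracket_section := hσ

end AbelianExtension

section JetLieAlgebraExtension

variable {E : Type*} [NormedAddCommGroup E] [NormedSpace ℝ E]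

theorem tderiv_const_add_apply (g v : E) : tderiv 𝓘(ℝ, E) 𝓘(ℝ, E) (fun x => g + x) 0 v = v := by
  rw [tderiv_eq_fderiv, fderiv_const_add, fderiv_fun_id, ContinuousLinearMap.id_apply]

theorem mlieBracket_model_eq_lieBracket (V W : Π x : E, TangentSpace 𝓘(ℝ, E) x) (x : E) :
    VectorField.mlieBracket 𝓘(ℝ, E) V W x = VectorField.lieBracket ℝ (V : E → E) (W : E → E) x := by
  rw [← VectorField.mlieBracketWithin_univ, VectorField.mlieBracketWithin_eq_lieBracketWithin]
  exact congrFun (VectorField.lieBracketWithin_univ (V := (V : E → E))) x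

theorem isLieAbelian_addGroupLieAlgebra : IsLieAbelian (AddGroupLieAlgebra 𝓘(ℝ, E) E) := by
  have hconst (v : E) :
      (addInvariantVectorField (I := 𝓘(ℝ, E)) (G := E) v : E → E) = fun _ => v :=
    funext fun g => tderiv_const_add_apply g v
  have hzero (v w : E) :
      VectorField.lieBracket ℝ (fun _ : E => v) (fun _ : E => w) (0 : E) = 0 := by
    simp only [VectorField.lieBracket, fderiv_fun_const, Pi.zero_apply, _root_.zero_apply, sub_self]
  exact ⟨fun v w => (mlieBracket_model_eq_lieBracket (addInvariantVectorField v)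
    (addInvariantVectorField w) 0).trans
      ((congrArg₂ (fun V W : E → E => VectorField.lieBracket ℝ V W 0) (hconst v) (hconst w)).trans
        (hzero v w))⟩

variable {G : Type*} [TopologicalSpace G] [ChartedSpace E G] [Group G] [LieGroup 𝓘(ℝ, E) ∞ G]

attribute [local instance] trivJetGroup trivJet_lieGroup

variable (E G) in
/-- The linear section of `jetLieProjection`, the derivative of `zeroSection`. -/
noncomputable def jetLieSection (k : ℕ) :
    GroupLieAlgebra (trivJetModel E k) (TrivJet E G k) →ₗ[ℝ]
      GroupLieAlgebra (trivJetModel E (k + 1)) (TrivJet E G (k + 1)) :=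
  (tderiv (trivJetModel E k) (trivJetModel E (k + 1)) (zeroSection k)
    (1 : TrivJet E G k)).toLinearMap

theorem jetLieSection_apply {k : ℕ} (X : E × (Fin k → E)) :
    jetLieSection E G k X = ((X.1, Fin.snoc X.2 0) : E × (Fin (k + 1) → E)) :=
  tderiv_zeroSection 1 X

variable [CompleteSpace E]

theorem lieCocycle_zero_right {k : ℕ} (X : E × (Fin k → E)) :
    lieCocycle G k X 0 = 0 :=
  Finset.sum_eq_zero fun i _ => by rw [Prod.snd_zero, jetComp_zero, ad_zero_right, smul_zero]

theorem groupBracket_zero_right {n : ℕ} (X : E × (Fin n → E)) :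
    groupBracket (trivJetModel E n) (TrivJet E G n) X 0 = 0 :=
  lie_zero (L := GroupLieAlgebra (trivJetModel E n) (TrivJet E G n))
    (M := GroupLieAlgebra (trivJetModel E n) (TrivJet E G n)) X

theorem groupBracket_snoc_zero {k : ℕ} (X : E × (Fin (k + 1) → E)) (v : E) :
    groupBracket (trivJetModel E (k + 1)) (TrivJet E G (k + 1)) X (0, Fin.snoc 0 v) =
      (0, Fin.snoc 0 (ad G X.1 v)) := by
  have hinit (w : E) : ((0 : E), Fin.init (Fin.snoc 0 w : Fin (k + 1) → E)) =
      (0 : E × (Fin k → E)) := by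
    rw [Fin.init_snoc, Prod.mk_zero_zero]
  refine trivJet_ext (G := E) ?_ ?_
  · refine (groupBracket_trivJet_init X _).trans ?_
    rw [hinit, groupBracket_zero_right]
    exact (hinit _).symm
  · rw [groupBracket_trivJet_last, hinit, lieCocycle_zero_right, ad_zero_left, sub_zero, add_zero]
    simp only [Fin.snoc_last]

theorem groupBracket_tderiv_topInclusion {k : ℕ} (v w : E) :
    groupBracket (trivJetModel E (k + 1)) (TrivJet E G (k + 1))
      (tderiv 𝓘(ℝ, E) (trivJetModel E (k + 1)) (topInclusion (E := E) G k) 0 v)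
      (tderiv 𝓘(ℝ, E) (trivJetModel E (k + 1)) (topInclusion (E := E) G k) 0 w) = 0 := by
  rw [tderiv_topInclusion, tderiv_topInclusion, groupBracket_snoc_zero, ad_zero_left,
    ← tderiv_topInclusion (E := E) (G := G) 0 0, map_zero]

theorem groupBracket_section_section {k : ℕ} (X Y : E × (Fin k → E)) :
    groupBracket (trivJetModel E (k + 1)) (TrivJet E G (k + 1))
      (X.1, Fin.snoc X.2 0) (Y.1, Fin.snoc Y.2 0) =
      ((groupBracket (trivJetModel E k) (TrivJet E G k) X Y).1,
        Fin.snoc (groupBracket (trivJetModel E k) (TrivJet E G k) X Y).2 0) +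
      (0, Fin.snoc 0 (lieCocycle G k X Y)) := by
  refine trivJet_ext (G := E) ?_ ?_
  · refine (groupBracket_trivJet_init _ _).trans ?_
    simp only [Fin.init_snoc]
    refine Prod.ext (add_zero _).symm (funext fun j => ?_)
    simp only [truncate, Fin.init, Prod.snd_add, Pi.add_apply, Fin.snoc_castSucc, Pi.zero_apply,
      add_zero]
  · rw [groupBracket_trivJet_last]
    simp only [Fin.init_snoc, Prod.snd_add, Pi.add_apply, Fin.snoc_last, ad_zero_right, sub_zero,
      zero_add]

variable (E G) in
/-- The homomorphism `𝔤 → J^{k+1} 𝔤` of Lie algebras, the derivative of `topInclusion`. -/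
noncomputable def jetLieInclusion (k : ℕ) : AddGroupLieAlgebra 𝓘(ℝ, E) E →ₗ⁅ℝ⁆
    GroupLieAlgebra (trivJetModel E (k + 1)) (TrivJet E G (k + 1)) where
  __ := (tderiv 𝓘(ℝ, E) (trivJetModel E (k + 1)) (topInclusion (E := E) G k) 0).toLinearMap
  map_lie' {v w} :=
    (congrArg (tderiv 𝓘(ℝ, E) (trivJetModel E (k + 1)) (topInclusion (E := E) G k) 0)
      (isLieAbelian_addGroupLieAlgebra.trivial v w)).trans
        ((map_zero _).trans (groupBracket_tderiv_topInclusion (E := E) v w).symm)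

variable (E G) in
/-- The projection `J^{k+1} 𝔤 → J^k 𝔤` of Lie algebras, the derivative of `truncate`. -/
noncomputable def jetLieProjection (k : ℕ) :
    GroupLieAlgebra (trivJetModel E (k + 1)) (TrivJet E G (k + 1)) →ₗ⁅ℝ⁆
      GroupLieAlgebra (trivJetModel E k) (TrivJet E G k) where
  __ := (tderiv (trivJetModel E (k + 1)) (trivJetModel E k) (truncate k)
      (1 : TrivJet E G (k + 1))).toLinearMap
  map_lie' {X Y} := tderiv_monoidHom_groupBracket (φ := (jetGroupExtension E G k).rightHom)
    (contMDiff_truncate k) X Y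

theorem jetLieInclusion_apply {k : ℕ} (v : E) :
    jetLieInclusion E G k v = ((0, Fin.snoc 0 v) : E × (Fin (k + 1) → E)) :=
  tderiv_topInclusion 0 v

theorem jetLieProjection_apply {k : ℕ} (X : E × (Fin (k + 1) → E)) :
    jetLieProjection E G k X = ((X.1, Fin.init X.2) : E × (Fin k → E)) :=
  tderiv_truncate 1 X

theorem jetLieInclusion_injective (k : ℕ) : Function.Injective (jetLieInclusion E G k) := by
  intro v w h
  have hpair := (jetLieInclusion_apply (E := E) v).symm.trans
    (h.trans (jetLieInclusion_apply (E := E) w))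
  exact ((Fin.snoc_inj (α := fun _ => E)).1 (congrArg Prod.snd hpair)).2

theorem jetLieProjection_section (k : ℕ)
    (X : GroupLieAlgebra (trivJetModel E k) (TrivJet E G k)) :
    jetLieProjection E G k (jetLieSection E G k X) = X := by
  refine (congrArg _ (jetLieSection_apply X)).trans ((jetLieProjection_apply _).trans ?_)
  exact Prod.ext rfl (Fin.init_snoc (α := fun _ => E) _ _)

theorem jetLieProjection_eq_zero_iff (k : ℕ)
    (X : GroupLieAlgebra (trivJetModel E (k + 1)) (TrivJet E G (k + 1))) :
    jetLieProjection E G k X = 0 ↔ ∃ v, jetLieInclusion E G k v = X := by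
  constructor
  · intro h
    refine ⟨(X : E × (Fin (k + 1) → E)).2 (Fin.last k),
      (jetLieInclusion_apply (E := E) _).trans (trivJet_ext (G := E) ?_ ?_)⟩
    · refine Eq.trans ?_ (h.symm.trans (jetLieProjection_apply X))
      exact Prod.ext rfl (Fin.init_snoc (α := fun _ => E) _ _)
    · exact Fin.snoc_last (α := fun _ => E) _ _
  · rintro ⟨v, rfl⟩
    refine (congrArg _ (jetLieInclusion_apply (E := E) v)).trans
      ((jetLieProjection_apply _).trans ?_)
    exact Prod.ext rfl (Fin.init_snoc (α := fun _ => E) _ _)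

theorem lie_jetLieSection_jetLieInclusion (k : ℕ)
    (X : GroupLieAlgebra (trivJetModel E k) (TrivJet E G k)) (v : AddGroupLieAlgebra 𝓘(ℝ, E) E) :
    ⁅jetLieSection E G k X, jetLieInclusion E G k v⁆ =
      jetLieInclusion E G k (lieAction (E := E) G k X v) :=
  (congrArg₂ (groupBracket (trivJetModel E (k + 1)) (TrivJet E G (k + 1)))
    (jetLieSection_apply X) (jetLieInclusion_apply (E := E) v)).trans
    ((groupBracket_snoc_zero (E := E) _ v).trans (jetLieInclusion_apply (E := E) _).symm)

theorem lie_jetLieSection_jetLieSection (k : ℕ)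
    (X Y : GroupLieAlgebra (trivJetModel E k) (TrivJet E G k)) :
    ⁅jetLieSection E G k X, jetLieSection E G k Y⁆ =
      jetLieSection E G k ⁅X, Y⁆ + jetLieInclusion E G k (lieCocycle (E := E) G k X Y) :=
  (congrArg₂ (groupBracket (trivJetModel E (k + 1)) (TrivJet E G (k + 1)))
    (jetLieSection_apply X) (jetLieSection_apply Y)).trans
    ((groupBracket_section_section X Y).trans
      (congrArg₂ (fun A B : E × (Fin (k + 1) → E) => A + B)
        (jetLieSection_apply _).symm (jetLieInclusion_apply (E := E) _).symm))

variable (E G) in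
theorem isAbelianLieAlgebraExtension_jet (k : ℕ) :
    IsAbelianLieAlgebraExtension (jetLieInclusion E G k) (jetLieProjection E G k)
      (jetLieSection E G k) (fun X v => lieAction (E := E) G k X v)
      (fun X Y => lieCocycle (E := E) G k X Y) :=
  isAbelianLieAlgebraExtension_of_bracket isLieAbelian_addGroupLieAlgebra
    (jetLieInclusion_injective k) (jetLieProjection_eq_zero_iff k) (jetLieProjection_section k)
    (lie_jetLieSection_jetLieInclusion k) (lie_jetLieSection_jetLieSection k)

end JetLieAlgebraExtension

theorem proposition4p1 {E : Type*} [NormedAddCommGroup E] [NormedSpace ℝ E] [CompleteSpace E]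
    {G : Type*} [TopologicalSpace G] [ChartedSpace E G] [Group G] [LieGroup 𝓘(ℝ, E) ∞ G] :
    -- the right trivialization is a bijection `J^n G ≃ G × 𝔤^n`
    ∃ e : ∀ n, Jet E G n ≃ TrivJet E G n,
      (∀ n (c : SmoothCurve E G), e n (jet n c) = rightTriv n c) ∧
      -- `G × 𝔤^n` carries the group structure of `J^n G`
      letI : ∀ n, Group (TrivJet E G n) := fun n => (e n).symm.group
      ∃ _ : ∀ n, LieGroup (trivJetModel E n) ∞ (TrivJet E G n),
      ∀ k : ℕ,
        (∀ c : SmoothCurve E G, truncate k (e (k + 1) (jet (k + 1) c)) = e k (jet k c)) ∧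
        -- the extension of Lie groups
        (∃ S : GroupExtension (Multiplicative E) (TrivJet E G (k + 1)) (TrivJet E G k),
          (∀ v : E, S.inl (Multiplicative.ofAdd v) = topInclusion G k v) ∧
          (∀ a, S.rightHom a = truncate k a) ∧
          IsAbelianLieGroupExtension (trivJetModel E (k + 1)) (trivJetModel E k) S
            (zeroSection k) (fun a => Ad E a.1) (groupCocycle k)) ∧
        -- the second formula for the group cocycle
        (∀ a b : TrivJet E G k, groupCocycle k a b =
          ∑ l ∈ Finset.Icc 2 (k + 1), ∑ i : Composition (k + 1) with i.length = l,
            partitionNumber i.blocks • cocycleTerm a b i.blocks) ∧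
        -- the extension of Lie algebras, obtained by differentiation
        ∃ (ι : AddGroupLieAlgebra 𝓘(ℝ, E) E →ₗ⁅ℝ⁆
              GroupLieAlgebra (trivJetModel E (k + 1)) (TrivJet E G (k + 1)))
          (π : GroupLieAlgebra (trivJetModel E (k + 1)) (TrivJet E G (k + 1)) →ₗ⁅ℝ⁆
              GroupLieAlgebra (trivJetModel E k) (TrivJet E G k))
          (τ : GroupLieAlgebra (trivJetModel E k) (TrivJet E G k) →ₗ[ℝ]
              GroupLieAlgebra (trivJetModel E (k + 1)) (TrivJet E G (k + 1))),
          (∀ v, ι v = mfderiv 𝓘(ℝ, E) (trivJetModel E (k + 1)) (topInclusion G k) 0 v) ∧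
          (∀ X, π X = mfderiv (trivJetModel E (k + 1)) (trivJetModel E k) (truncate k) 1 X) ∧
          (∀ X, τ X = mfderiv (trivJetModel E k) (trivJetModel E (k + 1)) (zeroSection k) 1 X) ∧
          IsAbelianLieAlgebraExtension ι π τ
            (fun X v => lieAction (E := E) G k X v)
            (fun X Y => lieCocycle (E := E) G k X Y) := by
  refine ⟨jetEquiv E G, jetEquiv_jet, trivJet_lieGroup, fun k => ⟨truncate_rightTriv k,
    ⟨jetGroupExtension E G k, fun v => rfl, fun a => rfl,
      isAbelianLieGroupExtension_jetGroupExtension E G k⟩, groupCocycle_eq_sum_sum k,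
    jetLieInclusion E G k, jetLieProjection E G k, jetLieSection E G k, fun v => rfl, fun X => rfl,
    fun X => rfl, isAbelianLieAlgebraExtension_jet E G k⟩⟩
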